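/- **Theorem (Sub-optimality of CCB-PV with extended policy class).** *Model.* Let $\mathcal U,\mathcal X,\mathcal Z,\mathcal W$ be standard Borel spaces and $\mathcal A$ a finite set. In the observational process a trial $(X,U,Z,W,A,Y,R_X,R_Z,R_W)$ has law $$p_{\rm ob}=p(x)\,p(u,z,w\mid x)\,\pi_{\rm ob}(a\mid u,x,z)\,p(y\mid u,x,w,a)\,r_X(\cdot\mid x)\,r_Z(\cdot\mid z,u,a,x)\,r_W(\cdot\mid w,x,a),$$ with missingness indicators $R_X,R_Z,R_W\in\{0,1\}$. A policy is a Markov kernel $\pi:\mathcal X\times\mathcal W\to\Delta(\mathcal A)$; under $\pi$ the interventional law is $p_{\rm in}^\pi=\tilde p(x)p(u,z,w\mid x)\pi(a\mid x,w)p(y\mid u,x,w,a)$ with a given context law $\tilde p$, and $v^\pi=\mathbb E_{p^\pi_{\rm in}}[Y]$. Let $\Pi$ be a class of policies, $\pi^*\in\Pi$ maximize $v^\pi$ over $\Pi$, and $\mathrm{SubOpt}(\pi)=v^{\pi^*}-v^{\pi}$. Assume: (PV completeness) $\mathbb E_{\rm ob}[\sigma(U)\mid X,A,Z,R_Z=1]=0$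 iff $\sigma(U)=0$ a.s. (given $R_Z=1$), for functions $\sigma$ that may depend on $(A,X)$ as parameters; (PV independence) $W\perp A\mid(U,X)$ and $Z\perp(Y,W)\mid(A,X,U)$. *Equations.* For $h=(h_1,h_2,h_3,g)$ let $\alpha_1^\pi=h_1(Y,A,X,Z)$, $\alpha_2^\pi=h_2(A,W,X)-h_1(Y,A,X,Z)-Y\pi(A\mid X,W)$, $\alpha_3^\pi=h_3(Y,A,X)-\sum_{a'\in\mathcal A}h_2(a',W,X)$, $\alpha_4^\pi=g(X)-h_3(Y,A,X)$. Let $Z_1=(A,X,Z)$, $Z_2=(A,W,X,Z)$, $Z_3=(A,W,X)$, $Z_4=X$; let $\mu_1,\dots,\mu_4$ be $p_{\rm ob}$ conditioned on $(R_X,R_Z)=1$, $(R_W,R_X,R_Z)=1$, $(R_W,R_X)=1$, $R_X=1$; and put $\mathcal T_k^\pi h=\mathbb E_{\mu_k}[\alpha_k^\pi(h)\mid Z_k]$, $\|\mathcal T^\pi h\|_{\mu,2}^2=\sum_k\|\mathcal T^\pi_kh\|_{\mu_k,2}^2$. Assume that for every $\pi\in\Pi$ the system $\mathcal T_k^\pi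 h=0$ $(k\le4)$ has an exact solution; let $g^\pi$ be its last component. *Classes.* Let $\mathcal H$ be a class of tuples $h$ and $\Theta_k$ classes of functions of $Z_k$, star-shaped around $0$. Assume, for constants $\varepsilon_{\mathcal H},\varepsilon_\Theta\ge0$: for every $\pi\in\Pi$ there is $h^\pi_{\mathcal H}\in\mathcal H$, with last component $g^\pi_{\mathcal H}$, such that $\|\mathcal T^\pi h^\pi_{\mathcal H}\|_{\mu,2}\le\varepsilon_{\mathcal H}$ and $\|g^\pi_{\mathcal H}-g^\pi\|_{\tilde p,2}\le\varepsilon_{\mathcal H}$; and $\inf_{\theta\in\Theta_k}\|\theta-\mathcal T_k^\pi h\|_{\mu_k,2}\le\varepsilon_\Theta$ for all $\pi\in\Pi$, $h\in\mathcal H$, $k$. Assume $|Y|\le L_Y$, $\|h\|_\infty\le L_h$, $\|\alpha_k^\pi(h)\|_\infty\le L_\alpha$, $\|\theta\|_\infty\le L_\theta$ on these classes. Put $\tilde{\mathcal Q}_k=\{\alpha_k^\pi(h)\theta:h\in\mathcal H,\theta\in\Theta_k,\pi\in\Pi\}$. All functions are measurable, and in each of $\Theta_k$ and $\tilde{\mathcal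 Q}_k$ some countable subclass is dense for pointwise convergence of sequences. *Algorithm.* From $T$ i.i.d. trials let $\mathcal D_k$ consist of the $T_k$ trials satisfying the missingness condition of $\mu_k$; $\mathbb E_{\mathcal D_k}$ and $\|\cdot\|_{\mathcal D_k,2}$ are the empirical mean and norm. Let $\mathcal L^\pi_{\mathcal D}(h)=\sum_k\sup_{\theta\in\Theta_k}\{\mathbb E_{\mathcal D_k}[\alpha_k^\pi(h)\theta]-\frac12\|\theta\|^2_{\mathcal D_k,2}\}$, let $\mathrm{CI}^\pi_{\mathcal D}(e)$ be the set of last components $g$ of those $h\in\mathcal H$ with $\mathcal L^\pi_{\mathcal D}(h)\le\inf_{\mathcal H}\mathcal L^\pi_{\mathcal D}+e$, and let $\hat\pi$ be any maximizer over $\Pi$ of $\inf_{g\in\mathrm{CI}^\pi_{\mathcal D}(e_{\mathcal D})}\int g\,d\tilde p$. *Critical radii.* For a class $\mathcal F$ of functions with values in $[-c,c]$, a critical radius on $\mathcal D_k$ is any $\delta>0$ with $\mathbb E_\epsilon\sup\{\frac1{T_k}\sum_{t\in\mathcal D_k}\epsilon_tf(o_t):f\in\mathcal F,\|f\|_{\mathcal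 D_k,2}\le\delta\}\le\delta^2/c$, with i.i.d. random signs $\epsilon_t$. For a level $\xi\in(0,1)$ and constants $\kappa,c_1$, we say that $\eta_k$ bounds the critical radii if, with probability at least $1-\xi$, $T_k\ge1$ and $\eta_k\ge\kappa\big(\delta+\sqrt{\log(c_1/\xi)/T_k}\big)$ for some $\delta$ that is a critical radius on $\mathcal D_k$ both of $\tilde{\mathcal Q}_k$ (with $c=L_\alpha L_\theta$) and of $\Theta_k$ (with $c=L_\theta$). Let $\eta=(\sum_{k=1}^4\eta_k^2)^{1/2}$. *Shift functions.* Let $b_1:\mathcal X\times\mathcal A\times\mathcal Z\to\mathbb R$ be $\mu_1$-integrable with $$\mathbb E_{\rm ob}[b_1(X,A,Z)\mid x,u,a,(R_X,R_Z)=1]=\frac{p_{\rm ob}(u\mid x)\,\tilde p(x)}{p_{\rm ob}(u,x,a\mid (R_X,R_Z)=1)},$$ and let $$b_2(a,w,x,z)=b_1(x,a,z)\frac{p_{\rm ob}(a,w,x\mid (R_X,R_Z)=1)}{p_{\rm ob}(a,w,x\mid(R_W,R_X,R_Z)=1)},\quad b_3(w,x,a)=\frac{\tilde p(x)p_{\rm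 ob}(a,w\mid x,R_X=1)}{p_{\rm ob}(x,a,w\mid(R_W,R_X)=1)},\quad b_4(x)=\frac{\tilde p(x)}{p_{\rm ob}(x\mid R_X=1)},$$ where all ratios of densities (Radon–Nikodym derivatives, with counting measure on $\mathcal A$) are well defined, i.e. the measure in the numerator is absolutely continuous with respect to the one in the denominator. *Conclusion.* For every $L_\alpha>0$ there is $C>0$ depending only on $L_\alpha$, and for every $L_\theta>0$ there are $\kappa>0$, $c_1\ge1$ depending only on $(L_\alpha,L_\theta)$, such that in every setting as above in which $\eta_1,\dots,\eta_4$ bound the critical radii at level $\xi$ and $e_{\mathcal D}>2\varepsilon_{\mathcal H}^2+(2L_\alpha^2+5/4)\eta^2$, with probability at least $1-8\xi$, $$\mathrm{SubOpt}(\hat\pi)\le C\sum_{k=1}^4\|b_k\|_{\mu_k,2}\,\big(\varepsilon_\Theta+\varepsilon_{\mathcal H}+\sqrt{e_{\mathcal D}}+\eta\big).$$ -/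

import Mathlib

open MeasureTheory ProbabilityTheory Filter Topology
open scoped ENNReal

namespace CCB

/-- The record of one trial: context `X`, confounder `U`, treatment proxy `Z`, outcome proxy `W`,
treatment `A`, reward `Y`, and the missingness indicators `(R_X, R_Z, R_W)`
(`true` means that the variable is recorded). -/
abbrev Trial (𝒰 𝒳 𝒵 𝒲 𝒜 : Type*) := (((𝒳 × (𝒰 × 𝒵 × 𝒲)) × 𝒜) × ℝ) × (Bool × Bool × Bool)

section Coordinates

variable {𝒰 𝒳 𝒵 𝒲 𝒜 : Type*}

/-- The context `X`. -/
def ctx (o : Trial 𝒰 𝒳 𝒵 𝒲 𝒜) : 𝒳 := o.1.1.1.1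

/-- The unmeasured confounder `U`. -/
def conf (o : Trial 𝒰 𝒳 𝒵 𝒲 𝒜) : 𝒰 := o.1.1.1.2.1

/-- The treatment proxy `Z`. -/
def tprox (o : Trial 𝒰 𝒳 𝒵 𝒲 𝒜) : 𝒵 := o.1.1.1.2.2.1

/-- The outcome proxy `W`. -/
def oprox (o : Trial 𝒰 𝒳 𝒵 𝒲 𝒜) : 𝒲 := o.1.1.1.2.2.2

/-- The treatment `A`. -/
def act (o : Trial 𝒰 𝒳 𝒵 𝒲 𝒜) : 𝒜 := o.1.1.2

/-- The reward `Y`. -/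
def rew (o : Trial 𝒰 𝒳 𝒵 𝒲 𝒜) : ℝ := o.1.2

/-- The event `R_X = 1`. -/
def obsX : Set (Trial 𝒰 𝒳 𝒵 𝒲 𝒜) := {o | o.2.1 = true}

/-- The event `R_Z = 1`. -/
def obsZ : Set (Trial 𝒰 𝒳 𝒵 𝒲 𝒜) := {o | o.2.2.1 = true}

/-- The event `R_W = 1`. -/
def obsW : Set (Trial 𝒰 𝒳 𝒵 𝒲 𝒜) := {o | o.2.2.2 = true}

/-- The missingness condition of the `k`-th equation: `(R_X, R_Z) = 1`, `(R_W, R_X, R_Z) = 1`,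
`(R_W, R_X) = 1`, `R_X = 1`. -/
def pattern (k : Fin 4) : Set (Trial 𝒰 𝒳 𝒵 𝒲 𝒜) :=
  match k with
  | 0 => obsX ∩ obsZ
  | 1 => obsW ∩ obsX ∩ obsZ
  | 2 => obsW ∩ obsX
  | 3 => obsX

variable [MeasurableSpace 𝒰] [MeasurableSpace 𝒳] [MeasurableSpace 𝒵] [MeasurableSpace 𝒲]
  [MeasurableSpace 𝒜]

@[fun_prop] lemma measurable_ctx : Measurable (ctx : Trial 𝒰 𝒳 𝒵 𝒲 𝒜 → 𝒳) := by
  unfold ctx; fun_prop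

@[fun_prop] lemma measurable_conf : Measurable (conf : Trial 𝒰 𝒳 𝒵 𝒲 𝒜 → 𝒰) := by
  unfold conf; fun_prop

@[fun_prop] lemma measurable_tprox : Measurable (tprox : Trial 𝒰 𝒳 𝒵 𝒲 𝒜 → 𝒵) := by
  unfold tprox; fun_prop

@[fun_prop] lemma measurable_oprox : Measurable (oprox : Trial 𝒰 𝒳 𝒵 𝒲 𝒜 → 𝒲) := by
  unfold oprox; fun_prop

@[fun_prop] lemma measurable_act : Measurable (act : Trial 𝒰 𝒳 𝒵 𝒲 𝒜 → 𝒜) := by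
  unfold act; fun_prop

@[fun_prop] lemma measurable_rew : Measurable (rew : Trial 𝒰 𝒳 𝒵 𝒲 𝒜 → ℝ) := by
  unfold rew; fun_prop

/-- The σ-algebra generated by the conditioning variables `Z_k` of the `k`-th equation:
`(A, X, Z)`, `(A, W, X, Z)`, `(A, W, X)`, `X`. -/
@[reducible] def condSigma (k : Fin 4) : MeasurableSpace (Trial 𝒰 𝒳 𝒵 𝒲 𝒜) :=
  match k with
  | 0 => MeasurableSpace.comap (fun o => (act o, ctx o, tprox o)) inferInstance
  | 1 => MeasurableSpace.comap (fun o => (act o, oprox o, ctx o, tprox o)) inferInstance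
  | 2 => MeasurableSpace.comap (fun o => (act o, oprox o, ctx o)) inferInstance
  | 3 => MeasurableSpace.comap (fun o => ctx o) inferInstance

end Coordinates

/-- A confounded contextual bandit with proxy variables, given by the mechanisms of its causal
graph. There is no arrow from `Z` to `Y`; `R_X` is caused by `X`, `R_Z` by `(Z, U, A, X)` and `R_W`
by `(W, X, A)`. -/
structure Model (𝒰 𝒳 𝒵 𝒲 𝒜 : Type*) [MeasurableSpace 𝒰] [MeasurableSpace 𝒳] [MeasurableSpace 𝒵]
    [MeasurableSpace 𝒲] [MeasurableSpace 𝒜] where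
  /-- the marginal law `p(x)` of the context in the observational process -/
  pX : Measure 𝒳
  /-- the conditional law `p(u, z, w | x)` -/
  kO : Kernel 𝒳 (𝒰 × 𝒵 × 𝒲)
  /-- the observational policy `π_ob(a | u, x, z)` -/
  piOb : Kernel (𝒰 × 𝒳 × 𝒵) 𝒜
  /-- the law `p(y | u, x, w, a)` of the reward -/
  kY : Kernel (𝒰 × 𝒳 × 𝒲 × 𝒜) ℝ
  /-- the mechanism of `R_X` -/
  rX : Kernel 𝒳 Bool
  /-- the mechanism of `R_Z` -/
  rZ : Kernel (𝒵 × 𝒰 × 𝒜 × 𝒳) Bool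
  /-- the mechanism of `R_W` -/
  rW : Kernel (𝒲 × 𝒳 × 𝒜) Bool
  /-- the marginal law of the context in the interventional process -/
  pTilde : Measure 𝒳
  prob_pX : IsProbabilityMeasure pX
  markov_kO : IsMarkovKernel kO
  markov_piOb : IsMarkovKernel piOb
  markov_kY : IsMarkovKernel kY
  markov_rX : IsMarkovKernel rX
  markov_rZ : IsMarkovKernel rZ
  markov_rW : IsMarkovKernel rW
  prob_pTilde : IsProbabilityMeasure pTilde

attribute [instance] Model.prob_pX Model.markov_kO Model.markov_piOb Model.markov_kY
  Model.markov_rX Model.markov_rZ Model.markov_rW Model.prob_pTilde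

/-- An interventional policy `π : 𝒳 × 𝒲 → Δ(𝒜)`. -/
structure Policy (𝒳 𝒲 𝒜 : Type*) [MeasurableSpace 𝒳] [MeasurableSpace 𝒲]
    [MeasurableSpace 𝒜] where
  kernel : Kernel (𝒳 × 𝒲) 𝒜
  markov : IsMarkovKernel kernel

attribute [instance] Policy.markov

/-- A tuple `h = (h₁, h₂, h₃, g)` of candidate bridge functions. -/
structure Bridge (𝒳 𝒵 𝒲 𝒜 : Type*) where
  h₁ : ℝ × 𝒜 × 𝒳 × 𝒵 → ℝ
  h₂ : 𝒜 × 𝒲 × 𝒳 → ℝ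
  h₃ : ℝ × 𝒜 × 𝒳 → ℝ
  g : 𝒳 → ℝ

/-- All components are measurable. -/
def Bridge.IsMeasurable {𝒳 𝒵 𝒲 𝒜 : Type*} [MeasurableSpace 𝒳] [MeasurableSpace 𝒵]
    [MeasurableSpace 𝒲] [MeasurableSpace 𝒜] (h : Bridge 𝒳 𝒵 𝒲 𝒜) : Prop :=
  Measurable h.h₁ ∧ Measurable h.h₂ ∧ Measurable h.h₃ ∧ Measurable h.g

/-- All components are bounded by `L`, for rewards in `[-LY, LY]`. -/
def Bridge.IsBoundedBy {𝒳 𝒵 𝒲 𝒜 : Type*} (h : Bridge 𝒳 𝒵 𝒲 𝒜) (LY L : ℝ) : Prop :=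
  (∀ y a x z, |y| ≤ LY → |h.h₁ (y, a, x, z)| ≤ L) ∧ (∀ a w x, |h.h₂ (a, w, x)| ≤ L) ∧
    (∀ y a x, |y| ≤ LY → |h.h₃ (y, a, x)| ≤ L) ∧ (∀ x, |h.g x| ≤ L)

noncomputable section

variable {𝒰 𝒳 𝒵 𝒲 𝒜 : Type*} [MeasurableSpace 𝒰] [MeasurableSpace 𝒳] [MeasurableSpace 𝒵]
  [MeasurableSpace 𝒲] [MeasurableSpace 𝒜]

/-! ### The observational and the interventional process -/

namespace Model

/-- The law of one trial of the observational process; the three missingness indicators are drawn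
independently of each other given their causes. -/
def pOb (M : Model 𝒰 𝒳 𝒵 𝒲 𝒜) : Measure (Trial 𝒰 𝒳 𝒵 𝒲 𝒜) :=
  (((M.pX ⊗ₘ M.kO) ⊗ₘ
      M.piOb.comap (fun q : 𝒳 × (𝒰 × 𝒵 × 𝒲) => (q.2.1, q.1, q.2.2.1)) (by fun_prop)) ⊗ₘ
      M.kY.comap (fun q : (𝒳 × (𝒰 × 𝒵 × 𝒲)) × 𝒜 => (q.1.2.1, q.1.1, q.1.2.2.2, q.2))
        (by fun_prop)) ⊗ₘ
    ((M.rX.comap (fun q : ((𝒳 × (𝒰 × 𝒵 × 𝒲)) × 𝒜) × ℝ => q.1.1.1) (by fun_prop)) ×ₖ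
      ((M.rZ.comap (fun q : ((𝒳 × (𝒰 × 𝒵 × 𝒲)) × 𝒜) × ℝ =>
          (q.1.1.2.2.1, q.1.1.2.1, q.1.2, q.1.1.1)) (by fun_prop)) ×ₖ
        (M.rW.comap (fun q : ((𝒳 × (𝒰 × 𝒵 × 𝒲)) × 𝒜) × ℝ =>
          (q.1.1.2.2.2, q.1.1.1, q.1.2)) (by fun_prop))))

instance (M : Model 𝒰 𝒳 𝒵 𝒲 𝒜) : IsProbabilityMeasure M.pOb := by
  unfold pOb; infer_instance

/-- The law `p_in^π = p̃(x) p(u, z, w | x) π(a | x, w) p(y | u, x, w, a)` of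
`(((X, (U, Z, W)), A), Y)` in the interventional process. -/
def pIn (M : Model 𝒰 𝒳 𝒵 𝒲 𝒜) (π : Policy 𝒳 𝒲 𝒜) :
    Measure (((𝒳 × (𝒰 × 𝒵 × 𝒲)) × 𝒜) × ℝ) :=
  ((M.pTilde ⊗ₘ M.kO) ⊗ₘ
      π.kernel.comap (fun q : 𝒳 × (𝒰 × 𝒵 × 𝒲) => (q.1, q.2.2.2)) (by fun_prop)) ⊗ₘ
    M.kY.comap (fun q : (𝒳 × (𝒰 × 𝒵 × 𝒲)) × 𝒜 => (q.1.2.1, q.1.1, q.1.2.2.2, q.2))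
      (by fun_prop)

/-- The average reward `v^π`, the expectation of `Y` under `p_in^π`. -/
def value (M : Model 𝒰 𝒳 𝒵 𝒲 𝒜) (π : Policy 𝒳 𝒲 𝒜) : ℝ := ∫ q, q.2 ∂(M.pIn π)

/-- `π` is an optimal policy in the class `Pol`. -/
def IsOptimal (M : Model 𝒰 𝒳 𝒵 𝒲 𝒜) (Pol : Set (Policy 𝒳 𝒲 𝒜)) (π : Policy 𝒳 𝒲 𝒜) : Prop :=
  π ∈ Pol ∧ ∀ π' ∈ Pol, M.value π' ≤ M.value π

/-- The sub-optimality of `π` with respect to an optimal policy `πStar`. -/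
def subOpt (M : Model 𝒰 𝒳 𝒵 𝒲 𝒜) (πStar π : Policy 𝒳 𝒲 𝒜) : ℝ := M.value πStar - M.value π

/-- The law `μ_k` of a trial given the missingness condition of the `k`-th equation. -/
def mu (M : Model 𝒰 𝒳 𝒵 𝒲 𝒜) (k : Fin 4) : Measure (Trial 𝒰 𝒳 𝒵 𝒲 𝒜) :=
  ProbabilityTheory.cond M.pOb (pattern k)

instance (M : Model 𝒰 𝒳 𝒵 𝒲 𝒜) (k : Fin 4) : IsFiniteMeasure (M.mu k) := by
  unfold mu; infer_instance

/-- The law of the data `𝒟` of `T` independent trials. -/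
def dataLaw (M : Model 𝒰 𝒳 𝒵 𝒲 𝒜) (T : ℕ) : Measure (Fin T → Trial 𝒰 𝒳 𝒵 𝒲 𝒜) :=
  Measure.pi fun _ => M.pOb

/-- PV completeness: for functions `σ` of `U` (with parameters `(A, X)`),
`E[σ(U) | X, A, Z, R_Z = 1] = 0` if and only if `σ(U) = 0` almost surely. -/
def PVCompleteness (M : Model 𝒰 𝒳 𝒵 𝒲 𝒜) : Prop :=
  ∀ σ : 𝒜 × 𝒳 × 𝒰 → ℝ, Measurable σ →
    Integrable (fun o => σ (act o, ctx o, conf o)) (ProbabilityTheory.cond M.pOb obsZ) →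
    ((ProbabilityTheory.cond M.pOb obsZ)[fun o => σ (act o, ctx o, conf o) |
        MeasurableSpace.comap
          (fun o : Trial 𝒰 𝒳 𝒵 𝒲 𝒜 => (ctx o, act o, tprox o)) inferInstance]
          =ᵐ[ProbabilityTheory.cond M.pOb obsZ] 0 ↔
      (fun o => σ (act o, ctx o, conf o)) =ᵐ[ProbabilityTheory.cond M.pOb obsZ] 0)

/-- PV independence: `W ⟂ A | (U, X)` and `Z ⟂ (Y, W) | (A, X, U)`. -/
def PVIndependence [StandardBorelSpace 𝒰] [StandardBorelSpace 𝒳] [StandardBorelSpace 𝒵]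
    [StandardBorelSpace 𝒲] [StandardBorelSpace 𝒜] (M : Model 𝒰 𝒳 𝒵 𝒲 𝒜) : Prop :=
  CondIndepFun
      (MeasurableSpace.comap (fun o : Trial 𝒰 𝒳 𝒵 𝒲 𝒜 => (conf o, ctx o)) inferInstance)
      (Measurable.comap_le (by fun_prop)) oprox act M.pOb ∧
    CondIndepFun
      (MeasurableSpace.comap (fun o : Trial 𝒰 𝒳 𝒵 𝒲 𝒜 => (act o, ctx o, conf o)) inferInstance)
      (Measurable.comap_le (by fun_prop)) tprox (fun o => (rew o, oprox o)) M.pOb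

end Model

/-! ### The integral equation system -/

/-- The linear functions `α_k^π(h, Y_k)` of the four equations. -/
def alpha [Fintype 𝒜] (k : Fin 4) (π : Policy 𝒳 𝒲 𝒜) (h : Bridge 𝒳 𝒵 𝒲 𝒜)
    (o : Trial 𝒰 𝒳 𝒵 𝒲 𝒜) : ℝ :=
  match k with
  | 0 => h.h₁ (rew o, act o, ctx o, tprox o)
  | 1 => h.h₂ (act o, oprox o, ctx o) - h.h₁ (rew o, act o, ctx o, tprox o)
      - rew o * (π.kernel (ctx o, oprox o)).real {act o}
  | 2 => h.h₃ (rew o, act o, ctx o) - ∑ a' : 𝒜, h.h₂ (a', oprox o, ctx o)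
  | 3 => h.g (ctx o) - h.h₃ (rew o, act o, ctx o)

namespace Model

/-- The operator `𝒯_k^π h = E_{μ_k}[α_k^π(h, Y_k) | Z_k]`, as a random variable. -/
def opT [Fintype 𝒜] (M : Model 𝒰 𝒳 𝒵 𝒲 𝒜) (k : Fin 4) (π : Policy 𝒳 𝒲 𝒜)
    (h : Bridge 𝒳 𝒵 𝒲 𝒜) : Trial 𝒰 𝒳 𝒵 𝒲 𝒜 → ℝ :=
  (M.mu k)[alpha k π h | condSigma k]

/-- The root mean squared error `‖𝒯^π h‖_{μ,2}`. -/
def rmse [Fintype 𝒜] (M : Model 𝒰 𝒳 𝒵 𝒲 𝒜) (π : Policy 𝒳 𝒲 𝒜) (h : Bridge 𝒳 𝒵 𝒲 𝒜) : ℝ :=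
  √(∑ k : Fin 4, ∫ o, (M.opT k π h o) ^ 2 ∂(M.mu k))

/-- `h` is an exact solution of the integral equation system of the policy `π`. -/
def IsSolution [Fintype 𝒜] (M : Model 𝒰 𝒳 𝒵 𝒲 𝒜) (π : Policy 𝒳 𝒲 𝒜)
    (h : Bridge 𝒳 𝒵 𝒲 𝒜) : Prop :=
  h.IsMeasurable ∧
    ∀ k : Fin 4, Integrable (alpha k π h) (M.mu k) ∧ M.opT k π h =ᵐ[M.mu k] 0

/-- Realizability with error `εH`, uniformly over the policy class; `gExact π` is the last component
of the exact solution for the policy `π`. -/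
def Realizable [Fintype 𝒜] (M : Model 𝒰 𝒳 𝒵 𝒲 𝒜) (Pol : Set (Policy 𝒳 𝒲 𝒜))
    (H : Set (Bridge 𝒳 𝒵 𝒲 𝒜)) (gExact : Policy 𝒳 𝒲 𝒜 → 𝒳 → ℝ) (εH : ℝ) : Prop :=
  ∀ π ∈ Pol, ∃ h ∈ H, M.rmse π h ≤ εH ∧
    eLpNorm (fun x => h.g x - gExact π x) 2 M.pTilde ≤ ENNReal.ofReal εH

/-- Compatibility of the test function classes with error `εΘ`, uniformly over the policy class. -/
def Compatible [Fintype 𝒜] (M : Model 𝒰 𝒳 𝒵 𝒲 𝒜) (Pol : Set (Policy 𝒳 𝒲 𝒜))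
    (H : Set (Bridge 𝒳 𝒵 𝒲 𝒜)) (Θ : Fin 4 → Set (Trial 𝒰 𝒳 𝒵 𝒲 𝒜 → ℝ)) (εΘ : ℝ) : Prop :=
  ∀ π ∈ Pol, ∀ h ∈ H, ∀ k : Fin 4,
    ⨅ θ ∈ Θ k, eLpNorm (fun o => θ o - M.opT k π h o) 2 (M.mu k) ≤ ENNReal.ofReal εΘ

/-- Regularity: the reward, the hypotheses, the functions `α_k^π` and the test functions are bounded
by `LY`, `Lh`, `Lα` and `Lθ`; hypotheses are measurable and the test functions in `Θ k` are
(measurable) functions of the conditioning variables `Z_k`. -/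
def Regular [Fintype 𝒜] (M : Model 𝒰 𝒳 𝒵 𝒲 𝒜) (Pol : Set (Policy 𝒳 𝒲 𝒜))
    (H : Set (Bridge 𝒳 𝒵 𝒲 𝒜)) (Θ : Fin 4 → Set (Trial 𝒰 𝒳 𝒵 𝒲 𝒜 → ℝ))
    (LY Lh Lα Lθ : ℝ) : Prop :=
  (∀ q, ∀ᵐ y ∂(M.kY q), |y| ≤ LY) ∧
    (∀ h ∈ H, h.IsMeasurable ∧ h.IsBoundedBy LY Lh) ∧
    (∀ π ∈ Pol, ∀ h ∈ H, ∀ k : Fin 4, ∀ o : Trial 𝒰 𝒳 𝒵 𝒲 𝒜,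
      |rew o| ≤ LY → |alpha k π h o| ≤ Lα) ∧
    (∀ k : Fin 4, ∀ θ ∈ Θ k, Measurable[condSigma k] θ ∧ ∀ o, |θ o| ≤ Lθ)

end Model

/-- The class `𝒬̃_k` of the functions `α_k^π(h, Y_k) θ_k(Z_k)`. -/
def classQ [Fintype 𝒜] (Pol : Set (Policy 𝒳 𝒲 𝒜)) (H : Set (Bridge 𝒳 𝒵 𝒲 𝒜))
    (Θ : Fin 4 → Set (Trial 𝒰 𝒳 𝒵 𝒲 𝒜 → ℝ)) (k : Fin 4) : Set (Trial 𝒰 𝒳 𝒵 𝒲 𝒜 → ℝ) :=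
  {q | ∃ π ∈ Pol, ∃ h ∈ H, ∃ θ ∈ Θ k, q = fun o => alpha k π h o * θ o}

/-- Every function of the class is a pointwise limit of a sequence from one countable subclass; the
usual measurability convention for suprema of empirical processes. -/
def PointwiseSeparable {S : Type*} (F : Set (S → ℝ)) : Prop :=
  ∃ G ⊆ F, G.Countable ∧ ∀ f ∈ F, ∃ u : ℕ → S → ℝ,
    (∀ n, u n ∈ G) ∧ ∀ s, Tendsto (fun n => u n s) atTop (𝓝 (f s))

/-! ### Empirical quantities -/

section Empirical

variable {T : ℕ}

open scoped Classical in
/-- The indices of the trials in `𝒟_k`. -/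
def subIdx (D : Fin T → Trial 𝒰 𝒳 𝒵 𝒲 𝒜) (k : Fin 4) : Finset (Fin T) :=
  Finset.univ.filter fun t => D t ∈ (pattern k : Set (Trial 𝒰 𝒳 𝒵 𝒲 𝒜))

/-- The number `T_k` of trials in `𝒟_k`. -/
def subSize (D : Fin T → Trial 𝒰 𝒳 𝒵 𝒲 𝒜) (k : Fin 4) : ℕ := (subIdx D k).card

/-- The empirical mean over `𝒟_k`. -/
def empMean (D : Fin T → Trial 𝒰 𝒳 𝒵 𝒲 𝒜) (k : Fin 4) (f : Trial 𝒰 𝒳 𝒵 𝒲 𝒜 → ℝ) : ℝ :=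
  (∑ t ∈ subIdx D k, f (D t)) / (subSize D k : ℝ)

/-- The empirical norm `‖f‖_{𝒟_k,2}`. -/
def empNorm (D : Fin T → Trial 𝒰 𝒳 𝒵 𝒲 𝒜) (k : Fin 4) (f : Trial 𝒰 𝒳 𝒵 𝒲 𝒜 → ℝ) : ℝ :=
  √(empMean D k fun o => f o ^ 2)

/-- The localized empirical Rademacher complexity
`E_ε sup {(1 / T_k) ∑_{t ∈ 𝒟_k} ε_t f(o_t) : f ∈ F, ‖f‖_{𝒟_k} ≤ δ}`. -/
def rademacher (D : Fin T → Trial 𝒰 𝒳 𝒵 𝒲 𝒜) (k : Fin 4) (F : Set (Trial 𝒰 𝒳 𝒵 𝒲 𝒜 → ℝ))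
    (δ : ℝ) : ℝ :=
  (∑ ε : Fin T → Bool, ⨆ f : {f : Trial 𝒰 𝒳 𝒵 𝒲 𝒜 → ℝ // f ∈ F ∧ empNorm D k f ≤ δ},
      (∑ t ∈ subIdx D k, (if ε t then (1 : ℝ) else -1) * f.1 (D t)) / (subSize D k : ℝ))
    / (2 : ℝ) ^ T

/-- `δ` is a positive solution of the critical inequality on `𝒟_k` of the class `F` of
functions with values in `[-c, c]`. -/
def IsCriticalRadius (D : Fin T → Trial 𝒰 𝒳 𝒵 𝒲 𝒜) (k : Fin 4)
    (F : Set (Trial 𝒰 𝒳 𝒵 𝒲 𝒜 → ℝ)) (c δ : ℝ) : Prop :=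
  0 < δ ∧ rademacher D k F δ ≤ δ ^ 2 / c

/-- On the data `D`, the number `r` bounds, at confidence level `ξ`, a critical radius of both
`𝒬̃_k` (with values in `[-Lα Lθ, Lα Lθ]`) and `Θ_k` (with values in `[-Lθ, Lθ]`):
`r ≥ κ (δ + √(log (c₁ / ξ) / T_k))`. -/
def CriticalBound [Fintype 𝒜] (Pol : Set (Policy 𝒳 𝒲 𝒜)) (H : Set (Bridge 𝒳 𝒵 𝒲 𝒜))
    (Θ : Fin 4 → Set (Trial 𝒰 𝒳 𝒵 𝒲 𝒜 → ℝ)) (Lα Lθ κ c₁ ξ : ℝ) (k : Fin 4) (r : ℝ)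
    (D : Fin T → Trial 𝒰 𝒳 𝒵 𝒲 𝒜) : Prop :=
  0 < subSize D k ∧ ∃ δ : ℝ, IsCriticalRadius D k (classQ Pol H Θ k) (Lα * Lθ) δ ∧
    IsCriticalRadius D k (Θ k) Lθ δ ∧ κ * (δ + √(Real.log (c₁ / ξ) / (subSize D k : ℝ))) ≤ r

/-- The empirical loss `ℒ_𝒟^π(h) = ∑_k sup_{θ ∈ Θ_k} E_{𝒟_k}[α_k^π(h) θ] - ‖θ‖²_{𝒟_k} / 2`. -/
def empLoss [Fintype 𝒜] (Θ : Fin 4 → Set (Trial 𝒰 𝒳 𝒵 𝒲 𝒜 → ℝ))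
    (D : Fin T → Trial 𝒰 𝒳 𝒵 𝒲 𝒜) (π : Policy 𝒳 𝒲 𝒜) (h : Bridge 𝒳 𝒵 𝒲 𝒜) : ℝ :=
  ∑ k : Fin 4, ⨆ θ : Θ k,
    (empMean D k (fun o => alpha k π h o * θ.1 o) - 1 / 2 * empNorm D k θ.1 ^ 2)

/-- The confidence set `CI_𝒟^π(e)`. -/
def confSet [Fintype 𝒜] (H : Set (Bridge 𝒳 𝒵 𝒲 𝒜)) (Θ : Fin 4 → Set (Trial 𝒰 𝒳 𝒵 𝒲 𝒜 → ℝ))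
    (e : ℝ) (D : Fin T → Trial 𝒰 𝒳 𝒵 𝒲 𝒜) (π : Policy 𝒳 𝒲 𝒜) : Set (𝒳 → ℝ) :=
  {g | ∃ h ∈ H, g = h.g ∧ empLoss Θ D π h ≤ (⨅ h' : H, empLoss Θ D π h'.1) + e}

/-- The pessimistic value `inf {v(g) : g ∈ CI_𝒟^π(e)}`, where `v(g) = ∫ g dp̃`. -/
def Model.pessValue [Fintype 𝒜] (M : Model 𝒰 𝒳 𝒵 𝒲 𝒜) (H : Set (Bridge 𝒳 𝒵 𝒲 𝒜))
    (Θ : Fin 4 → Set (Trial 𝒰 𝒳 𝒵 𝒲 𝒜 → ℝ)) (e : ℝ) (D : Fin T → Trial 𝒰 𝒳 𝒵 𝒲 𝒜)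
    (π : Policy 𝒳 𝒲 𝒜) : ℝ :=
  sInf ((fun g => ∫ x, g x ∂M.pTilde) '' confSet H Θ e D π)

/-- `π` is an output of the algorithm: it maximizes the pessimistic value over the class. -/
def Model.IsPessimistic [Fintype 𝒜] (M : Model 𝒰 𝒳 𝒵 𝒲 𝒜) (Pol : Set (Policy 𝒳 𝒲 𝒜))
    (H : Set (Bridge 𝒳 𝒵 𝒲 𝒜)) (Θ : Fin 4 → Set (Trial 𝒰 𝒳 𝒵 𝒲 𝒜 → ℝ)) (e : ℝ)
    (D : Fin T → Trial 𝒰 𝒳 𝒵 𝒲 𝒜) (π : Policy 𝒳 𝒲 𝒜) : Prop :=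
  π ∈ Pol ∧ ∀ π' ∈ Pol, M.pessValue H Θ e D π' ≤ M.pessValue H Θ e D π

end Empirical

/-! ### The distribution shift functions -/

/-- The ratio of the densities of two laws. -/
def ratio {S : Type*} [MeasurableSpace S] (ν ρ : Measure S) (s : S) : ℝ := (ν.rnDeriv ρ s).toReal

namespace Model

/-- The law of `V` given the event `E` in the observational process. -/
def lawGiven {S : Type*} [MeasurableSpace S] (M : Model 𝒰 𝒳 𝒵 𝒲 𝒜)
    (V : Trial 𝒰 𝒳 𝒵 𝒲 𝒜 → S) (E : Set (Trial 𝒰 𝒳 𝒵 𝒲 𝒜)) : Measure S :=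
  (ProbabilityTheory.cond M.pOb E).map V

/-- The measure with density `p(u | x) p̃(x)` in `(x, u, a)`, with respect to the counting measure
in the coordinate `a`. -/
def shiftMeasure (M : Model 𝒰 𝒳 𝒵 𝒲 𝒜) : Measure ((𝒳 × 𝒰) × 𝒜) :=
  (M.pTilde ⊗ₘ Kernel.fst M.kO).prod Measure.count

/-- The measure with density `p̃(x) p_ob(a, w | x, R_X = 1)` in `(x, (a, w))`. -/
def awMeasure [StandardBorelSpace 𝒲] [StandardBorelSpace 𝒜] [Nonempty 𝒲] [Nonempty 𝒜]
    (M : Model 𝒰 𝒳 𝒵 𝒲 𝒜) : Measure (𝒳 × (𝒜 × 𝒲)) :=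
  M.pTilde ⊗ₘ condDistrib (fun o : Trial 𝒰 𝒳 𝒵 𝒲 𝒜 => (act o, oprox o)) ctx
    (ProbabilityTheory.cond M.pOb obsX)

/-- `b₁` solves `E_ob[b₁(X, A, Z) | x, u, a, (R_X, R_Z) = 1]
  = p_ob(u | x) p̃(x) / p_ob(u, x, a | (R_X, R_Z) = 1)`. -/
def IsShift (M : Model 𝒰 𝒳 𝒵 𝒲 𝒜) (b₁ : 𝒳 × 𝒜 × 𝒵 → ℝ) : Prop :=
  Measurable b₁ ∧ Integrable (fun o => b₁ (ctx o, act o, tprox o)) (M.mu 0) ∧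
    M.shiftMeasure ≪ M.lawGiven (fun o => ((ctx o, conf o), act o)) (obsX ∩ obsZ) ∧
    (M.mu 0)[fun o => b₁ (ctx o, act o, tprox o) |
        MeasurableSpace.comap
          (fun o : Trial 𝒰 𝒳 𝒵 𝒲 𝒜 => ((ctx o, conf o), act o)) inferInstance]
      =ᵐ[M.mu 0] fun o =>
        ratio M.shiftMeasure (M.lawGiven (fun o => ((ctx o, conf o), act o)) (obsX ∩ obsZ))
          ((ctx o, conf o), act o)

/-- The denominators of `b₂`, `b₃`, `b₄` do not vanish where the numerators do not. -/
def Overlap [StandardBorelSpace 𝒲] [StandardBorelSpace 𝒜] [Nonempty 𝒲] [Nonempty 𝒜]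
    (M : Model 𝒰 𝒳 𝒵 𝒲 𝒜) : Prop :=
  M.lawGiven (fun o => (act o, oprox o, ctx o)) (obsX ∩ obsZ) ≪
      M.lawGiven (fun o => (act o, oprox o, ctx o)) (obsW ∩ obsX ∩ obsZ) ∧
    M.awMeasure ≪ M.lawGiven (fun o => (ctx o, (act o, oprox o))) (obsW ∩ obsX) ∧
    M.pTilde ≪ M.lawGiven ctx obsX

/-- The functions `b₁, b₂, b₃, b₄`, evaluated at a trial. -/
def shiftFun [StandardBorelSpace 𝒲] [StandardBorelSpace 𝒜] [Nonempty 𝒲] [Nonempty 𝒜]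
    (M : Model 𝒰 𝒳 𝒵 𝒲 𝒜) (b₁ : 𝒳 × 𝒜 × 𝒵 → ℝ) (k : Fin 4) (o : Trial 𝒰 𝒳 𝒵 𝒲 𝒜) : ℝ :=
  match k with
  | 0 => b₁ (ctx o, act o, tprox o)
  | 1 => b₁ (ctx o, act o, tprox o) *
      ratio (M.lawGiven (fun o => (act o, oprox o, ctx o)) (obsX ∩ obsZ))
        (M.lawGiven (fun o => (act o, oprox o, ctx o)) (obsW ∩ obsX ∩ obsZ))
        (act o, oprox o, ctx o)
  | 2 => ratio M.awMeasure (M.lawGiven (fun o => (ctx o, (act o, oprox o))) (obsW ∩ obsX))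
        (ctx o, (act o, oprox o))
  | 3 => ratio M.pTilde (M.lawGiven ctx obsX) (ctx o)

end Model

end

end CCB

/-! The equations are indexed by 0, 1, 2, 3 as in the code. The proof combines an exact formula for
the error of a candidate, a uniform concentration statement and a pessimism argument.

Error formula (`integral_g_sub_value`). For a bounded candidate h, the difference between the
integral of g under p̃ and the value of π equals ∑ₖ E[bₖ αₖ(h)] under the laws `mu k`. Weighting `mu
3` by b₄ and `mu 2` by b₃ produces the same law, namely context p̃ followed by the observational
mechanisms, because R_W is caused by (W, X, A) only. Under this law h₃ cancels and E[g - ∑ₐ h₂(a, W,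
X)] remains. Weighting `mu 1` by b₂ amounts to weighting `mu 0` by b₁; there h₁ cancels and h₂ - Yπ
remains. Since Z is independent of (Y, W) given (A, X, U), b₁ acts through its conditional mean, a
density ratio that turns the law of (X, U, A) into p̃(x)p(u | x) times counting measure. Since W is
independent of A given (U, X), W keeps its law given (U, X), and the result is E ∑ₐ h₂ minus the
value. As bₖ is a function of the conditioning variables, αₖ may be replaced by the conditional
residual `opT k π h`, and Cauchy–Schwarz bounds the error by ∑ₖ ‖bₖ‖ ‖`opT k π h`‖
(`abs_integral_g_sub_value_le`).

Concentration (`dataLaw_not_uniformlyClose_le`). The critical radius is computed on the data, so a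
small empirical Rademacher average has to force small deviations. A ghost sample is added and its
entries are swapped at random with those of the data. Given the pair of samples, the Rademacher
average of the first sample and the deviation between the samples are both convex Lipschitz
functions of the swap signs, so both concentrate around their means, by the inf-convolution
inequality on the cube. By contraction, the mean deviation is at most a constant times the mean
Rademacher average. Hence a small observed average together with a large deviation is unlikely
(`signAvg_swap_le`, `measure_ghost_le`). Rescaling within a star-shaped class reduces square norms,
and then means, to functions at one fixed scale. A subsample is handled by conditioning on its set
of indices.

Pessimism (`GoodData.subOpt_le`). On good data the realizable candidate of each policy lies in the
confidence set. Conversely every member of the set has small empirical loss; testing it with half of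
a function close to its residual shows that the residual is small (`GoodData.eLpNorm_opT_le`). So
each confidence set contains one accurate candidate and only fairly accurate ones, and maximizing
the lower end of the values costs at most the sum of the two errors. -/

namespace CCB

/-! ### Concentration on the sign cube -/

/-- The sign encoded by a Boolean. -/
def sgn (b : Bool) : ℝ := if b then 1 else -1

lemma sgn_mem (b : Bool) : sgn b ∈ Set.Icc (-1 : ℝ) 1 := by
  cases b <;> simp [sgn]

lemma abs_sgn (b : Bool) : |sgn b| = 1 := by
  cases b <;> simp [sgn]

lemma sgn_not (b : Bool) : sgn (!b) = -sgn b := by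
  cases b <;> simp [sgn]

/-- The expectation over independent uniform signs. -/
noncomputable def signAvg {n : ℕ} (f : (Fin n → Bool) → ℝ) : ℝ := (∑ ε, f ε) / 2 ^ n

section SignAvg

variable {n : ℕ}

lemma signAvg_mono {f g : (Fin n → Bool) → ℝ} (h : ∀ ε, f ε ≤ g ε) : signAvg f ≤ signAvg g := by
  unfold signAvg
  exact div_le_div_of_nonneg_right (Finset.sum_le_sum fun ε _ => h ε) (by positivity)

lemma signAvg_const (c : ℝ) : signAvg (fun _ : Fin n → Bool => c) = c := by
  simp [signAvg]

lemma signAvg_add (f g : (Fin n → Bool) → ℝ) :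
    signAvg (fun ε => f ε + g ε) = signAvg f + signAvg g := by
  simp [signAvg, Finset.sum_add_distrib, add_div]

lemma signAvg_sub (f g : (Fin n → Bool) → ℝ) :
    signAvg (fun ε => f ε - g ε) = signAvg f - signAvg g := by
  simp [signAvg, Finset.sum_sub_distrib, sub_div]

lemma signAvg_const_mul (c : ℝ) (f : (Fin n → Bool) → ℝ) :
    signAvg (fun ε => c * f ε) = c * signAvg f := by
  unfold signAvg
  rw [← Finset.mul_sum, mul_div_assoc]

lemma signAvg_nonneg {f : (Fin n → Bool) → ℝ} (h : ∀ ε, 0 ≤ f ε) : 0 ≤ signAvg f := by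
  rw [← signAvg_const (n := n) 0]
  exact signAvg_mono h

lemma signAvg_equiv (e : (Fin n → Bool) ≃ (Fin n → Bool)) (f : (Fin n → Bool) → ℝ) :
    signAvg (fun ε => f (e ε)) = signAvg f := by
  unfold signAvg
  rw [Equiv.sum_comp e f]

lemma signAvg_succ (f : (Fin (n + 1) → Bool) → ℝ) :
    signAvg f = (signAvg (fun ε => f (Fin.cons true ε)) +
      signAvg (fun ε => f (Fin.cons false ε))) / 2 := by
  unfold signAvg
  rw [← Equiv.sum_comp (Fin.consEquiv fun _ => Bool), Fintype.sum_prod_type, Fintype.sum_bool]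
  simp only [Fin.consEquiv, Equiv.coe_fn_mk]
  rw [← add_div, div_div, pow_succ]

/-- Jensen's inequality, from the tangent line of the exponential at the mean. -/
lemma exp_signAvg_le (f : (Fin n → Bool) → ℝ) :
    Real.exp (signAvg f) ≤ signAvg fun ε => Real.exp (f ε) := by
  have h : ∀ ε, Real.exp (signAvg f) * (f ε - signAvg f + 1) ≤ Real.exp (f ε) := fun ε => by
    have := mul_le_mul_of_nonneg_left (Real.add_one_le_exp (f ε - signAvg f))
      (Real.exp_nonneg (signAvg f))
    rwa [← Real.exp_add, add_sub_cancel] at this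
  refine le_trans (le_of_eq ?_) (signAvg_mono h)
  rw [signAvg_const_mul, signAvg_add, signAvg_sub, signAvg_const, signAvg_const]
  ring

end SignAvg

/-- A form of Talagrand's one-dimensional optimization: θ is the fraction moved to the opposite face
of the cube, at cost θ²/8 and with gain θD. Here D will be the difference of the logarithms of two
face averages. -/
lemma exists_exp_le_two_sub (D : ℝ) (hD : 0 ≤ D) :
    ∃ θ : ℝ, 0 ≤ θ ∧ θ ≤ 1 ∧ Real.exp (θ ^ 2 / 8 + (1 - θ) * D) ≤ 2 - Real.exp (-D) := by
  set u : ℝ := 1 - Real.exp (-D) with hu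
  have hu0 : 0 ≤ u := by
    have : Real.exp (-D) ≤ 1 := Real.exp_le_one_iff.2 (by linarith)
    linarith
  have hu1 : u < 1 := by
    have := Real.exp_pos (-D)
    linarith
  have hD' : D = -Real.log (1 - u) := by simp [hu]
  have hrw : 2 - Real.exp (-D) = 1 + u := by rw [hu]; ring
  rw [hrw]
  rcases le_total u (1 / 2) with h | h
  -- From (1 - u)D ≤ u and 1 - 2u ≤ (1 - u)² the exponent is at most u²/2 + u(1 - u) = u - u²/2,
  -- which is below log(1 + u).
  · refine ⟨2 * u, by linarith, by linarith, ?_⟩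
    rw [← Real.le_log_iff_exp_le (by linarith)]
    have h1 : 2 * u / (u + 2) ≤ Real.log (1 + u) := Real.le_log_one_add_of_nonneg hu0
    have h2 : u - u ^ 2 / 2 ≤ 2 * u / (u + 2) := by
      rw [le_div_iff₀ (by linarith)]
      nlinarith [pow_nonneg hu0 3]
    have h3 : (1 - u) * D ≤ u := by
      have h4 := Real.log_le_sub_one_of_pos (inv_pos.2 (sub_pos.2 hu1))
      rw [Real.log_inv] at h4
      have h5 : (1 - u) * ((1 - u)⁻¹ - 1) = u := by
        rw [mul_sub, mul_inv_cancel₀ (by linarith)]; ring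
      refine le_trans ?_ h5.le
      rw [hD']
      exact mul_le_mul_of_nonneg_left h4 (by linarith)
    nlinarith [mul_nonneg hu0 hD, mul_nonneg hu0 hu0,
      mul_le_mul_of_nonneg_left h3 (show (0 : ℝ) ≤ 1 - u by linarith)]
  -- For u ≥ 1/2 everything is moved: exp(1/8) ≤ 3/2 ≤ 1 + u.
  · refine ⟨1, by norm_num, le_rfl, ?_⟩
    have h1 : Real.exp (1 / 8) ≤ 3 / 2 := by
      rw [← Real.le_log_iff_exp_le (by norm_num)]
      have h1 : 2 * (1 / 2 : ℝ) / (1 / 2 + 2) ≤ Real.log (1 + 1 / 2) :=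
        Real.le_log_one_add_of_nonneg (by norm_num)
      have : (1 : ℝ) + 1 / 2 = 3 / 2 := by norm_num
      rw [this] at h1
      linarith [h1, show (1 : ℝ) / 8 ≤ 2 * (1 / 2 : ℝ) / (1 / 2 + 2) by norm_num]
    have : (1 : ℝ) ^ 2 / 8 + (1 - 1) * D = 1 / 8 := by ring
    rw [this]
    linarith

/-- The induction step in one coordinate. P and Q are logarithms of the averages of exp(-V) over two
opposite faces, X and Y the averages of exp U. Only the face with the smaller average moves mass;
with r = exp(P - Q) the product is at most (3 - r)(1 + r)/4 = 1 - (1 - r)²/4. -/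
lemma exp_two_point {P Q : ℝ} {X Y : ℝ} (hPQ : P ≤ Q)
    (hX : ∀ θ : ℝ, 0 ≤ θ → θ ≤ 1 → X ≤ Real.exp (θ ^ 2 / 8 - (1 - θ) * P - θ * Q))
    (hY : Y ≤ Real.exp (-Q)) :
    (X + Y) / 2 * ((Real.exp P + Real.exp Q) / 2) ≤ 1 := by
  obtain ⟨θ, h0, h1, h⟩ := exists_exp_le_two_sub (Q - P) (by linarith)
  have hX' := hX θ h0 h1
  set r := Real.exp (-(Q - P)) with hr
  have hX2 : X ≤ Real.exp (-Q) * (2 - r) := by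
    refine hX'.trans (le_trans (le_of_eq ?_) (mul_le_mul_of_nonneg_left h (Real.exp_nonneg _)))
    rw [← Real.exp_add]; congr 1; ring
  have hP : Real.exp P = Real.exp Q * r := by
    rw [hr, ← Real.exp_add]; congr 1; ring
  have hQ : Real.exp (-Q) * Real.exp Q = 1 := by rw [← Real.exp_add]; simp
  have hr0 : 0 < r := Real.exp_pos _
  calc (X + Y) / 2 * ((Real.exp P + Real.exp Q) / 2)
      ≤ (Real.exp (-Q) * (2 - r) + Real.exp (-Q)) / 2 * ((Real.exp P + Real.exp Q) / 2) := by
        gcongr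
    _ = (Real.exp (-Q) * Real.exp Q) * ((3 - r) * (1 + r) / 4) := by rw [hP]; ring
    _ ≤ 1 := by rw [hQ]; nlinarith [sq_nonneg (r - 1)]

/-- The inf-convolution inequality on the sign cube. -/
theorem signAvg_exp_mul_signAvg_exp_neg_le_one {n : ℕ} (V : (Fin n → ℝ) → ℝ)
    (hV : ConvexOn ℝ (Set.Icc (-1) 1) V) (hV0 : ∀ x, 0 ≤ V x) (U : (Fin n → Bool) → ℝ)
    (hU : ∀ ε, ∀ y ∈ Set.Icc (-1 : Fin n → ℝ) 1,
      U ε ≤ V y + (∑ i, (sgn (ε i) - y i) ^ 2) / 32) :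
    signAvg (fun ε => Real.exp (U ε)) * signAvg (fun ε => Real.exp (-V fun i => sgn (ε i))) ≤ 1 := by
  induction n with
  | zero =>
    have h := fun ε => hU ε (fun i => sgn (ε i)) ⟨fun i => i.elim0, fun i => i.elim0⟩
    simp only [signAvg, Finset.univ_unique, Finset.sum_singleton, pow_zero, div_one]
    rw [← Real.exp_add, Real.exp_le_one_iff]
    simp only [Finset.univ_eq_empty, Finset.sum_empty, zero_div, add_zero] at h
    rw [← sub_eq_add_neg, sub_nonpos]
    exact h _
  | succ n ih =>
    have hcons : ∀ (b : Bool), ∀ y ∈ Set.Icc (-1 : Fin n → ℝ) 1,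
        (Fin.cons (sgn b) y : Fin (n + 1) → ℝ) ∈ Set.Icc (-1 : Fin (n + 1) → ℝ) 1 := by
      intro b y hy
      have := sgn_mem b
      exact ⟨fun i => by
          refine Fin.cases ?_ (fun j => ?_) i
          · exact this.1
          · exact hy.1 j, fun i => by
          refine Fin.cases ?_ (fun j => ?_) i
          · exact this.2
          · exact hy.2 j⟩
    have hne : (Set.Icc (-1 : Fin n → ℝ) 1).Nonempty := ⟨0, by simp [Set.mem_Icc]⟩
    have : Nonempty (Set.Icc (-1 : Fin n → ℝ) 1) := hne.to_subtype
    -- The infimum of `F b ε` is the inf-convolution of the face `b` of V; it plays the role of U in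
    -- the induction hypothesis.
    let F : Bool → (Fin n → Bool) → (Set.Icc (-1 : Fin n → ℝ) 1) → ℝ := fun b ε y =>
      V (Fin.cons (sgn b) y.1) + (∑ i, (sgn (ε i) - y.1 i) ^ 2) / 32
    have hF0 : ∀ b ε y, 0 ≤ F b ε y := fun b ε y => add_nonneg (hV0 _)
      (div_nonneg (Finset.sum_nonneg fun i _ => sq_nonneg _) (by norm_num))
    have hbdd : ∀ b ε, BddBelow (Set.range (F b ε)) := fun b ε =>
      ⟨0, by rintro _ ⟨y, rfl⟩; exact hF0 b ε y⟩
    have hV' : ∀ b, ConvexOn ℝ (Set.Icc (-1 : Fin n → ℝ) 1)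
        (fun y => V (Fin.cons (sgn b) y)) := by
      intro b
      refine ⟨convex_Icc _ _, fun x hx y hy s t hs ht hst => ?_⟩
      have := hV.2 (hcons b x hx) (hcons b y hy) hs ht hst
      have he : (Fin.cons (sgn b) (s • x + t • y) : Fin (n + 1) → ℝ) =
          s • (Fin.cons (sgn b) x : Fin (n + 1) → ℝ) + t • (Fin.cons (sgn b) y) := by
        funext i
        refine Fin.cases ?_ (fun j => ?_) i
        · simp [← add_mul, hst]
        · simp
      simpa only [he] using this
    have key := fun b => ih (fun y => V (Fin.cons (sgn b) y)) (hV' b) (fun x => hV0 _)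
      (fun ε => ⨅ y, F b ε y) (fun ε y hy => ciInf_le (hbdd b ε) ⟨y, hy⟩)
    -- the slice inequality
    have hslice : ∀ (b : Bool) (ε : Fin n → Bool) (θ : ℝ), 0 ≤ θ → θ ≤ 1 →
        U (Fin.cons b ε) ≤ (1 - θ) * (⨅ y, F b ε y) + θ * (⨅ y, F (!b) ε y) + θ ^ 2 / 8 := by
      intro b ε θ h0 h1
      refine le_of_forall_pos_le_add fun δ hδ => ?_
      obtain ⟨y, hy⟩ := exists_lt_of_ciInf_lt (lt_add_of_pos_right (⨅ y, F b ε y) hδ)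
      obtain ⟨z, hz⟩ := exists_lt_of_ciInf_lt (lt_add_of_pos_right (⨅ y, F (!b) ε y) hδ)
      -- The competitor lies on the segment between near-minimizers of the two faces, where
      -- convexity controls V.
      have hmem : (1 - θ) • (Fin.cons (sgn b) y.1 : Fin (n + 1) → ℝ) +
          θ • (Fin.cons (sgn !b) z.1 : Fin (n + 1) → ℝ) ∈ Set.Icc (-1 : Fin (n + 1) → ℝ) 1 :=
        convex_Icc _ _ (hcons b _ y.2) (hcons (!b) _ z.2) (by linarith) h0 (by ring)
      have hu := hU (Fin.cons b ε) _ hmem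
      have hc := hV.2 (hcons b _ y.2) (hcons (!b) _ z.2) (sub_nonneg.2 h1) h0 (by ring)
      simp only [smul_eq_mul] at hc
      rw [Fin.sum_univ_succ] at hu
      simp only [Fin.cons_zero, Fin.cons_succ, Pi.add_apply, Pi.smul_apply, smul_eq_mul] at hu
      -- The first coordinate moves by 2θ, which costs 4θ²/32 = θ²/8, the cost in
      -- `exists_exp_le_two_sub`.
      have h00 : (sgn b - ((1 - θ) * sgn b + θ * sgn !b)) ^ 2 = 4 * θ ^ 2 := by
        rw [sgn_not]
        have : sgn b ^ 2 = 1 := by rw [← sq_abs, abs_sgn]; norm_num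
        linear_combination (4 * θ ^ 2) * this
      have hsum : ∑ i, (sgn (ε i) - ((1 - θ) * y.1 i + θ * z.1 i)) ^ 2 ≤
          (1 - θ) * (∑ i, (sgn (ε i) - y.1 i) ^ 2) + θ * (∑ i, (sgn (ε i) - z.1 i) ^ 2) := by
        rw [Finset.mul_sum, Finset.mul_sum, ← Finset.sum_add_distrib]
        refine Finset.sum_le_sum fun i _ => ?_
        nlinarith [mul_nonneg (mul_nonneg h0 (sub_nonneg.2 h1)) (sq_nonneg (y.1 i - z.1 i))]
      rw [h00] at hu
      have hFy : (1 - θ) * F b ε y ≤ (1 - θ) * ((⨅ y, F b ε y) + δ) :=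
        mul_le_mul_of_nonneg_left hy.le (by linarith)
      have hFz : θ * F (!b) ε z ≤ θ * ((⨅ y, F (!b) ε y) + δ) :=
        mul_le_mul_of_nonneg_left hz.le h0
      simp only [F] at hFy hFz ⊢
      linarith
    let E : Bool → ℝ := fun b => signAvg fun ε : Fin n → Bool =>
      Real.exp (-V (Fin.cons (sgn b) fun i => sgn (ε i)))
    have hE : ∀ b, 0 < E b := fun b => by
      simp only [E, signAvg]
      exact div_pos (Finset.sum_pos (fun ε _ => Real.exp_pos _) Finset.univ_nonempty) (by positivity)
    have hkey : ∀ b, signAvg (fun ε => Real.exp (⨅ y, F b ε y)) * Real.exp (Real.log (E b)) ≤ 1 :=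
      fun b => by rw [Real.exp_log (hE b)]; exact key b
    have hX : ∀ (b : Bool) (θ : ℝ), 0 ≤ θ → θ ≤ 1 →
        signAvg (fun ε => Real.exp (U (Fin.cons b ε))) ≤
          Real.exp (θ ^ 2 / 8 - (1 - θ) * Real.log (E b) - θ * Real.log (E (!b))) := by
      intro b θ h0 h1
      -- Weighted by `E b` and `E (!b)`, the two exponentials have mean at most one by the induction
      -- hypothesis, so convexity of the exponential does the work of Hölder's inequality.
      have hpt : ∀ ε : Fin n → Bool, Real.exp (U (Fin.cons b ε)) ≤
          Real.exp (θ ^ 2 / 8 - (1 - θ) * Real.log (E b) - θ * Real.log (E (!b))) *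
            ((1 - θ) * Real.exp (Real.log (E b)) * Real.exp (⨅ y, F b ε y) +
              θ * Real.exp (Real.log (E (!b))) * Real.exp (⨅ y, F (!b) ε y)) := by
        intro ε
        have hc := convexOn_exp.2 (Set.mem_univ (Real.log (E b) + ⨅ y, F b ε y))
          (Set.mem_univ (Real.log (E (!b)) + ⨅ y, F (!b) ε y)) (sub_nonneg.2 h1) h0 (by ring)
        simp only [smul_eq_mul] at hc
        rw [mul_assoc, mul_assoc, ← Real.exp_add, ← Real.exp_add]
        refine le_trans (Real.exp_le_exp.2 (hslice b ε θ h0 h1)) (le_trans (le_of_eq ?_)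
          (mul_le_mul_of_nonneg_left hc (Real.exp_nonneg _)))
        rw [← Real.exp_add]
        congr 1
        ring
      refine (signAvg_mono hpt).trans ?_
      rw [signAvg_const_mul, signAvg_add, signAvg_const_mul, signAvg_const_mul]
      refine mul_le_of_le_one_right (Real.exp_nonneg _) ?_
      nlinarith [mul_le_mul_of_nonneg_left (hkey b) (sub_nonneg.2 h1),
        mul_le_mul_of_nonneg_left (hkey (!b)) h0]
    have hY : ∀ b : Bool, signAvg (fun ε => Real.exp (U (Fin.cons b ε))) ≤
        Real.exp (-Real.log (E b)) := fun b => by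
      have := hX b 0 le_rfl zero_le_one
      simpa using this
    have hVs : ∀ (b : Bool) (ε : Fin n → Bool),
        (fun i => sgn ((Fin.cons b ε : Fin (n + 1) → Bool) i)) =
          (Fin.cons (sgn b) fun i => sgn (ε i) : Fin (n + 1) → ℝ) := by
      intro b ε
      funext i
      refine Fin.cases ?_ (fun j => ?_) i <;> simp
    rw [signAvg_succ, signAvg_succ (fun ε => Real.exp (-V fun i => sgn (ε i)))]
    simp only [hVs]
    change _ * ((E true + E false) / 2) ≤ 1
    -- The face with the smaller average of exp(-V) takes the role of X.
    rcases le_total (Real.log (E true)) (Real.log (E false)) with h | h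
    · have := exp_two_point h (hX true) (hY false)
      rwa [Real.exp_log (hE _), Real.exp_log (hE _)] at this
    · have := exp_two_point h (hX false) (hY true)
      rw [Real.exp_log (hE _), Real.exp_log (hE _)] at this
      rwa [add_comm, add_comm (E true)]

/-- Subgaussian concentration of convex Lipschitz functions of independent signs. -/
theorem signAvg_exp_mul_signAvg_exp_neg_le {n : ℕ} (V : (Fin n → ℝ) → ℝ)
    (hV : ConvexOn ℝ (Set.Icc (-1) 1) V) (hV0 : ∀ x, 0 ≤ V x) {B : ℝ} (hB : 0 ≤ B)
    (hL : ∀ x y, V x - V y ≤ √(B * ∑ i, (x i - y i) ^ 2)) :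
    signAvg (fun ε => Real.exp (V fun i => sgn (ε i))) *
      signAvg (fun ε => Real.exp (-V fun i => sgn (ε i))) ≤ Real.exp (8 * B) := by
  -- U = V - 8B is admissible: by the arithmetic-geometric mean inequality √(BD) ≤ 8B + D/32.
  have h := signAvg_exp_mul_signAvg_exp_neg_le_one V hV hV0
    (fun ε => -(8 * B) + V fun i => sgn (ε i)) (fun ε y _ => by
      have h1 := hL (fun i => sgn (ε i)) y
      set D := ∑ i, (sgn (ε i) - y i) ^ 2
      have hD : 0 ≤ D := Finset.sum_nonneg fun i _ => sq_nonneg _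
      have : √(B * D) ≤ 8 * B + D / 32 := by
        rw [Real.sqrt_le_left (by positivity)]
        nlinarith [sq_nonneg (8 * B - D / 32)]
      linarith)
  simp only [Real.exp_add] at h
  rw [signAvg_const_mul, Real.exp_neg, mul_assoc, inv_mul_le_iff₀ (Real.exp_pos _), mul_one] at h
  exact h


/-! ### Suprema of Rademacher sums -/

lemma signAvg_exp_mul_le {n : ℕ} (V : (Fin n → ℝ) → ℝ)
    (hV : ConvexOn ℝ (Set.Icc (-1) 1) V) (hV0 : ∀ x, 0 ≤ V x) {B : ℝ} (hB : 0 ≤ B)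
    (hL : ∀ x y, V x - V y ≤ √(B * ∑ i, (x i - y i) ^ 2)) {l : ℝ} (hl : 0 ≤ l) :
    signAvg (fun ε => Real.exp (l * V fun i => sgn (ε i))) *
      signAvg (fun ε => Real.exp (-(l * V fun i => sgn (ε i)))) ≤ Real.exp (8 * (l ^ 2 * B)) := by
  refine signAvg_exp_mul_signAvg_exp_neg_le (fun x => l * V x) (hV.smul hl)
    (fun x => mul_nonneg hl (hV0 x)) (by positivity) fun x y => ?_
  rw [mul_assoc, Real.sqrt_mul (sq_nonneg l), Real.sqrt_sq hl, ← mul_sub]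
  exact mul_le_mul_of_nonneg_left (hL x y) hl

/-- Chernoff's bound. In the product inequality the factor with the negative exponent is at least
exp(-l E V) by Jensen, which centres the estimate at the mean. -/
lemma signAvg_upper_tail {n : ℕ} (V : (Fin n → ℝ) → ℝ)
    (hV : ConvexOn ℝ (Set.Icc (-1) 1) V) (hV0 : ∀ x, 0 ≤ V x) {B : ℝ} (hB : 0 ≤ B)
    (hL : ∀ x y, V x - V y ≤ √(B * ∑ i, (x i - y i) ^ 2)) {l : ℝ} (hl : 0 ≤ l)
    (w : ℝ) (A : Set (Fin n → Bool)) (hA : ∀ ε ∈ A, w ≤ V fun i => sgn (ε i)) :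
    signAvg (A.indicator fun _ => 1) ≤
      Real.exp (8 * (l ^ 2 * B) + l * signAvg (fun ε => V fun i => sgn (ε i)) - l * w) := by
  set m := signAvg (fun ε => V fun i => sgn (ε i)) with hm
  have h1 := signAvg_exp_mul_le V hV hV0 hB hL hl
  have h2 : Real.exp (-(l * m)) ≤
      signAvg (fun ε => Real.exp (-(l * V fun i => sgn (ε i)))) := by
    refine le_trans (le_of_eq ?_) (exp_signAvg_le _)
    simp only [← neg_mul]
    rw [signAvg_const_mul]
  have h3 : signAvg (A.indicator fun _ => 1) ≤
      signAvg (fun ε => Real.exp (-(l * w)) * Real.exp (l * V fun i => sgn (ε i))) := by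
    refine signAvg_mono fun ε => ?_
    rw [← Real.exp_add]
    refine Set.indicator_apply_le' (fun h => ?_) fun _ => Real.exp_nonneg _
    rw [Real.one_le_exp_iff]
    have := mul_le_mul_of_nonneg_left (hA ε h) hl
    linarith
  rw [signAvg_const_mul] at h3
  have h4 := mul_le_mul_of_nonneg_left h2
    (signAvg_nonneg fun ε : Fin n → Bool => (Real.exp_nonneg (l * V fun i => sgn (ε i))))
  have h5 := h4.trans h1
  rw [Real.exp_neg, ← div_eq_mul_inv, div_le_iff₀ (Real.exp_pos _), ← Real.exp_add] at h5
  refine h3.trans ((mul_le_mul_of_nonneg_left h5 (Real.exp_nonneg _)).trans (le_of_eq ?_))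
  rw [← Real.exp_add]
  congr 1
  ring

/-- The product inequality is symmetric in the sign of the exponent, so the lower tail of a convex
function obeys the same bound. -/
lemma signAvg_lower_tail {n : ℕ} (V : (Fin n → ℝ) → ℝ)
    (hV : ConvexOn ℝ (Set.Icc (-1) 1) V) (hV0 : ∀ x, 0 ≤ V x) {B : ℝ} (hB : 0 ≤ B)
    (hL : ∀ x y, V x - V y ≤ √(B * ∑ i, (x i - y i) ^ 2)) {l : ℝ} (hl : 0 ≤ l)
    (v : ℝ) (A : Set (Fin n → Bool)) (hA : ∀ ε ∈ A, (V fun i => sgn (ε i)) ≤ v) :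
    signAvg (A.indicator fun _ => 1) ≤
      Real.exp (8 * (l ^ 2 * B) - l * signAvg (fun ε => V fun i => sgn (ε i)) + l * v) := by
  set m := signAvg (fun ε => V fun i => sgn (ε i)) with hm
  have h1 := signAvg_exp_mul_le V hV hV0 hB hL hl
  have h2 : Real.exp (l * m) ≤ signAvg (fun ε => Real.exp (l * V fun i => sgn (ε i))) := by
    refine le_trans (le_of_eq ?_) (exp_signAvg_le _)
    rw [signAvg_const_mul]
  have h3 : signAvg (A.indicator fun _ => 1) ≤
      signAvg (fun ε => Real.exp (l * v) * Real.exp (-(l * V fun i => sgn (ε i)))) := by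
    refine signAvg_mono fun ε => ?_
    rw [← Real.exp_add]
    refine Set.indicator_apply_le' (fun h => ?_) fun _ => Real.exp_nonneg _
    rw [Real.one_le_exp_iff]
    have := mul_le_mul_of_nonneg_left (hA ε h) hl
    linarith
  rw [signAvg_const_mul] at h3
  have h4 := mul_le_mul_of_nonneg_right h2
    (signAvg_nonneg fun ε : Fin n → Bool => (Real.exp_nonneg (-(l * V fun i => sgn (ε i)))))
  have h5 := h4.trans h1
  rw [mul_comm, ← le_div_iff₀ (Real.exp_pos _), ← Real.exp_sub] at h5
  refine h3.trans ((mul_le_mul_of_nonneg_left h5 (Real.exp_nonneg _)).trans (le_of_eq ?_))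
  rw [← Real.exp_add]
  congr 1
  ring

/-! ### Contraction and random swaps for families of vectors -/

section Families

variable {n : ℕ} {J : Type*}

/-- The Rademacher average of a family of vectors. -/
noncomputable def radSup (x : J → Fin n → ℝ) : ℝ :=
  signAvg fun ε => ⨆ j, ∑ t, sgn (ε t) * x j t

lemma bddAbove_range_of_abs_le {u : J → ℝ} (K : ℝ) (h : ∀ j, |u j| ≤ K) :
    BddAbove (Set.range u) :=
  ⟨K, by rintro _ ⟨j, rfl⟩; exact (abs_le.1 (h j)).2⟩

lemma abs_sum_mul_le (x y : Fin n → ℝ) {K : ℝ} (hy : ∀ t, |y t| ≤ K) :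
    |∑ t, x t * y t| ≤ ∑ t, |x t| * K := by
  refine (Finset.abs_sum_le_sum_abs _ _).trans (Finset.sum_le_sum fun t _ => ?_)
  rw [abs_mul]
  exact mul_le_mul_of_nonneg_left (hy t) (abs_nonneg _)

lemma bddAbove_linear (x : Fin n → ℝ) (y : J → Fin n → ℝ) {K : ℝ} (hy : ∀ j t, |y j t| ≤ K) :
    BddAbove (Set.range fun j => ∑ t, x t * y j t) :=
  bddAbove_range_of_abs_le _ fun j => abs_sum_mul_le x (y j) (hy j)

/-- Swapping the entries of two vectors according to a sign pattern. -/
def swapVec {α : Type*} {n : ℕ} (σ : Fin n → Bool) (a b : Fin n → α) : Fin n → α :=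
  fun t => if σ t then a t else b t

lemma abs_swapVec_le {a b : J → Fin n → ℝ} {C : ℝ} (ha : ∀ j t, |a j t| ≤ C)
    (hb : ∀ j t, |b j t| ≤ C) (σ : Fin n → Bool) (j : J) (t : Fin n) :
    |swapVec σ (a j) (b j) t| ≤ C := by
  unfold swapVec
  split_ifs
  exacts [ha j t, hb j t]

lemma sum_mul_le_sqrt (x y : Fin n → ℝ) {B : ℝ} (hy : ∑ t, y t ^ 2 ≤ B) :
    ∑ t, x t * y t ≤ √(B * ∑ t, x t ^ 2) := by
  refine Real.le_sqrt_of_sq_le ((Finset.sum_mul_sq_le_sq_mul_sq _ _ _).trans ?_)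
  rw [mul_comm]
  exact mul_le_mul_of_nonneg_right hy (Finset.sum_nonneg fun t _ => sq_nonneg _)

variable [Nonempty J]

/-- The contraction principle for a single sign. For each pair of indices the order of `a j` and `a
k` decides which of them is used in which supremum on the right. -/
lemma iSup_add_iSup_le_contraction (u a : J → ℝ) (φ : ℝ → ℝ) {ℓ K C : ℝ}
    (hu : ∀ j, |u j| ≤ K) (ha : ∀ j, |a j| ≤ C)
    (hφ : ∀ x y, |x| ≤ C → |y| ≤ C → |φ x - φ y| ≤ ℓ * |x - y|) :
    (⨆ j, (u j + φ (a j))) + (⨆ j, (u j - φ (a j))) ≤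
      (⨆ j, (u j + ℓ * a j)) + ⨆ j, (u j - ℓ * a j) := by
  have hb1 : BddAbove (Set.range fun j => u j + ℓ * a j) :=
    bddAbove_range_of_abs_le (K + |ℓ| * C) fun j => (abs_add_le _ _).trans
      (add_le_add (hu j) (by rw [abs_mul]; exact mul_le_mul_of_nonneg_left (ha j) (abs_nonneg _)))
  have hb2 : BddAbove (Set.range fun j => u j - ℓ * a j) :=
    bddAbove_range_of_abs_le (K + |ℓ| * C) fun j => (abs_sub _ _).trans
      (add_le_add (hu j) (by rw [abs_mul]; exact mul_le_mul_of_nonneg_left (ha j) (abs_nonneg _)))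
  rw [← le_sub_iff_add_le]
  refine ciSup_le fun j => ?_
  rw [le_sub_comm]
  refine ciSup_le fun k => ?_
  have h := (abs_le.1 (hφ (a j) (a k) (ha j) (ha k))).2
  have j1 := le_ciSup hb1 j
  have k1 := le_ciSup hb1 k
  have j2 := le_ciSup hb2 j
  have k2 := le_ciSup hb2 k
  rcases le_total (a j) (a k) with hjk | hjk
  · rw [abs_of_nonpos (by linarith)] at h
    linarith
  · rw [abs_of_nonneg (by linarith)] at h
    linarith

/-- The Ledoux–Talagrand contraction principle, one sign at a time. The offset `o` carries the
exposed coordinate through the induction hypothesis. -/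
lemma signAvg_iSup_contraction {n : ℕ} (o : J → ℝ) (a : J → Fin n → ℝ) (φ : ℝ → ℝ) {ℓ K C : ℝ}
    (ho : ∀ j, |o j| ≤ K) (ha : ∀ j t, |a j t| ≤ C) (hφ0 : φ 0 = 0)
    (hφ : ∀ x y, |x| ≤ C → |y| ≤ C → |φ x - φ y| ≤ ℓ * |x - y|) :
    signAvg (fun ε => ⨆ j, (o j + ∑ t, sgn (ε t) * φ (a j t))) ≤
      signAvg (fun ε => ⨆ j, (o j + ∑ t, sgn (ε t) * (ℓ * a j t))) := by
  induction n generalizing o K with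
  | zero => simp only [Finset.univ_eq_empty, Finset.sum_empty, le_refl]
  | succ n ih =>
    have hC : 0 ≤ C := (abs_nonneg _).trans (ha (Classical.arbitrary J) 0)
    have hφC : ∀ x, |x| ≤ C → |φ x| ≤ |ℓ| * C := fun x hx => by
      have := hφ x 0 hx (by simpa using hC)
      rw [hφ0, sub_zero, sub_zero] at this
      exact this.trans (mul_le_mul (le_abs_self _) hx (abs_nonneg _) (abs_nonneg _))
    have hstep : ∀ b : Bool, signAvg (fun ε : Fin n → Bool =>
        ⨆ j, (o j + ∑ t, sgn ((Fin.cons b ε : Fin (n + 1) → Bool) t) * φ (a j t))) ≤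
        signAvg (fun ε : Fin n → Bool =>
          ⨆ j, ((o j + ∑ t, sgn (ε t) * (ℓ * a j t.succ)) + sgn b * φ (a j 0))) := by
      intro b
      have := ih (fun j => o j + sgn b * φ (a j 0)) (fun j t => a j t.succ) (K := K + |ℓ| * C)
        (fun j => (abs_add_le _ _).trans (add_le_add (ho j) (by
          rw [abs_mul, abs_sgn, one_mul]; exact hφC _ (ha j 0))))
        (fun j t => ha j _)
      simp only [Fin.sum_univ_succ, Fin.cons_zero, Fin.cons_succ]
      refine le_trans (le_of_eq ?_) (this.trans (le_of_eq ?_))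
      · simp only [add_assoc]
      · simp only [add_assoc, add_comm (sgn b * _)]
    rw [signAvg_succ, signAvg_succ (fun ε => ⨆ j, (o j + ∑ t, sgn (ε t) * (ℓ * a j t)))]
    refine div_le_div_of_nonneg_right ((add_le_add (hstep true) (hstep false)).trans ?_) (by norm_num)
    rw [← signAvg_add, ← signAvg_add]
    refine signAvg_mono fun ε => ?_
    have := iSup_add_iSup_le_contraction (fun j => o j + ∑ t, sgn (ε t) * (ℓ * a j t.succ))
      (fun j => a j 0) φ (ℓ := ℓ) (K := K + ∑ t : Fin n, |sgn (ε t)| * (|ℓ| * C)) (C := C)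
      (fun j => (abs_add_le _ _).trans (add_le_add (ho j) (abs_sum_mul_le _ _ fun t => by
        rw [abs_mul]; exact mul_le_mul_of_nonneg_left (ha j _) (abs_nonneg _))))
      (fun j => ha j 0) hφ
    simp only [Fin.sum_univ_succ, Fin.cons_zero, Fin.cons_succ]
    refine le_trans (le_of_eq ?_) (this.trans (le_of_eq ?_))
    · simp [sgn, sub_eq_add_neg]
    · simp [sgn, sub_eq_add_neg, add_comm, add_left_comm]

lemma radSup_comp_le (a : J → Fin n → ℝ) (φ : ℝ → ℝ) {ℓ C : ℝ} (hℓ : 0 ≤ ℓ)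
    (ha : ∀ j t, |a j t| ≤ C) (hφ0 : φ 0 = 0)
    (hφ : ∀ x y, |x| ≤ C → |y| ≤ C → |φ x - φ y| ≤ ℓ * |x - y|) :
    radSup (fun j t => φ (a j t)) ≤ ℓ * radSup a := by
  have := signAvg_iSup_contraction (fun _ => 0) a φ (K := 0) (by simp) ha hφ0 hφ
  simp only [zero_add] at this
  refine this.trans (le_of_eq ?_)
  rw [radSup, ← signAvg_const_mul]
  congr 1
  funext ε
  rw [Real.mul_iSup_of_nonneg hℓ]
  simp only [Finset.mul_sum, mul_left_comm ℓ]

lemma signAvg_not (f : (Fin n → Bool) → ℝ) : signAvg (fun ε => f fun t => !(ε t)) = signAvg f :=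
  signAvg_equiv (Function.Involutive.toPerm (fun (ε : Fin n → Bool) t => !(ε t))
    (fun ε => by funext t; simp)) f

lemma signAvg_beq (τ : Fin n → Bool) (f : (Fin n → Bool) → ℝ) :
    signAvg (fun ε => f fun t => (ε t == τ t)) = signAvg f :=
  signAvg_equiv (Function.Involutive.toPerm (fun (ε : Fin n → Bool) t => (ε t == τ t))
    (fun ε => by funext t; cases hε : ε t <;> cases hτ : τ t <;> simp [hε, hτ])) f

/-- For a fixed pattern τ, a change of signs writes the signed difference as a signed sum over the
τ-swapped vector plus one over the complementary swap. Contraction applies to each, and averaging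
over τ makes the two means equal. -/
lemma signAvg_iSup_sub_le (a b : J → Fin n → ℝ) (φ : ℝ → ℝ) {ℓ C : ℝ} (hℓ : 0 ≤ ℓ)
    (ha : ∀ j t, |a j t| ≤ C) (hb : ∀ j t, |b j t| ≤ C) (hφ0 : φ 0 = 0)
    (hφ : ∀ x y, |x| ≤ C → |y| ≤ C → |φ x - φ y| ≤ ℓ * |x - y|) :
    signAvg (fun σ => ⨆ j, ∑ t, sgn (σ t) * (φ (b j t) - φ (a j t))) ≤
      2 * ℓ * signAvg (fun τ => radSup fun j => swapVec τ (a j) (b j)) := by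
  have hφC : ∀ x, |x| ≤ C → |φ x| ≤ ℓ * C := fun x hx => by
    have := hφ x 0 hx (by simpa using (abs_nonneg x).trans hx)
    rw [hφ0, sub_zero, sub_zero] at this
    exact this.trans (mul_le_mul_of_nonneg_left hx hℓ)
  have key : ∀ τ : Fin n → Bool,
      signAvg (fun σ => ⨆ j, ∑ t, sgn (σ t) * (φ (b j t) - φ (a j t))) ≤
        ℓ * radSup (fun j => swapVec (fun t => !(τ t)) (a j) (b j)) +
          ℓ * radSup (fun j => swapVec τ (a j) (b j)) := by
    intro τ
    refine le_trans ?_ (add_le_add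
      (radSup_comp_le (fun j => swapVec (fun t => !(τ t)) (a j) (b j)) φ hℓ
        (abs_swapVec_le ha hb _) hφ0 hφ)
      (radSup_comp_le (fun j => swapVec τ (a j) (b j)) φ hℓ (abs_swapVec_le ha hb τ) hφ0 hφ))
    rw [← signAvg_beq τ]
    unfold radSup
    rw [← signAvg_not (fun ε => ⨆ j, ∑ t, sgn (ε t) * φ (swapVec τ (a j) (b j) t)), ← signAvg_add]
    refine signAvg_mono fun ε => ciSup_le fun j => ?_
    have h1 := le_ciSup (bddAbove_linear (fun t => sgn (ε t))
      (fun j t => φ (swapVec (fun t => !(τ t)) (a j) (b j) t))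
      fun j t => hφC _ (abs_swapVec_le ha hb (fun t => !(τ t)) j t)) j
    have h2 := le_ciSup (bddAbove_linear (fun t => sgn !(ε t))
      (fun j t => φ (swapVec τ (a j) (b j) t))
      fun j t => hφC _ (abs_swapVec_le ha hb τ j t)) j
    refine le_trans (le_of_eq ?_) (add_le_add h1 h2)
    rw [← Finset.sum_add_distrib]
    refine Finset.sum_congr rfl fun t _ => ?_
    cases hε : ε t <;> cases hτ : τ t <;> simp [sgn, swapVec, hε, hτ] <;> ring
  have h := signAvg_mono key
  rw [signAvg_const, signAvg_add, signAvg_const_mul, signAvg_const_mul,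
    signAvg_not (fun τ => radSup fun j => swapVec τ (a j) (b j))] at h
  linarith

/-- The supremum of affine functions with slopes of norm at most `√B` is convex and Lipschitz. -/
lemma iSup_affine (α : J → ℝ) (β : J → Fin n → ℝ) {B : ℝ} (hβ : ∀ j, ∑ t, β j t ^ 2 ≤ B)
    (hbdd : ∀ x : Fin n → ℝ, BddAbove (Set.range fun j => α j + ∑ t, x t * β j t)) :
    ConvexOn ℝ (Set.Icc (-1) 1) (fun x : Fin n → ℝ => ⨆ j, (α j + ∑ t, x t * β j t)) ∧
      ∀ x y : Fin n → ℝ, (⨆ j, (α j + ∑ t, x t * β j t)) - (⨆ j, (α j + ∑ t, y t * β j t)) ≤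
        √(B * ∑ t, (x t - y t) ^ 2) := by
  refine ⟨⟨convex_Icc _ _, fun x _ y _ s t hs ht hst => ciSup_le fun j => ?_⟩, fun x y => ?_⟩
  · have hx := mul_le_mul_of_nonneg_left (le_ciSup (hbdd x) j) hs
    have hy := mul_le_mul_of_nonneg_left (le_ciSup (hbdd y) j) ht
    simp only [smul_eq_mul]
    refine le_trans (le_of_eq ?_) (add_le_add hx hy)
    simp only [Pi.add_apply, Pi.smul_apply, smul_eq_mul, add_mul, Finset.sum_add_distrib, mul_assoc,
      ← Finset.mul_sum]
    linear_combination (-(α j)) * hst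
  · rw [sub_le_iff_le_add]
    refine ciSup_le fun j => ?_
    have h := sum_mul_le_sqrt (fun t => x t - y t) (β j) (hβ j)
    have hy := le_ciSup (hbdd y) j
    simp only [sub_mul, Finset.sum_sub_distrib] at h hy
    linarith

/-- With high probability over the swaps of two samples, a small Rademacher average of the first
sample forces a small deviation between the two samples. -/
theorem signAvg_swap_le (a b : J → Fin n → ℝ) (φ : ℝ → ℝ) {ℓ c q B : ℝ} (hℓ : 0 < ℓ)
    (hc : 0 < c) (hq : 0 < q) (hB : 0 ≤ B)
    (ha : ∀ j t, |a j t| ≤ c) (hb : ∀ j t, |b j t| ≤ c) (hφ0 : φ 0 = 0)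
    (hφ : ∀ x y, |x| ≤ c → |y| ≤ c → |φ x - φ y| ≤ ℓ * |x - y|)
    (hab : ∀ j, ∑ t, (a j t ^ 2 + b j t ^ 2) ≤ B) (j₀ : J) (ha0 : a j₀ = 0) (hb0 : b j₀ = 0) :
    signAvg (Set.indicator {σ : Fin n → Bool |
        radSup (fun j => swapVec σ (a j) (b j)) ≤ q * B / c ∧
        ∃ j, 29 * q * ℓ * B / c < ∑ t, sgn (σ t) * (φ (b j t) - φ (a j t))} fun _ => 1) ≤
      Real.exp (-(q ^ 2 * B / c ^ 2)) := by
  have hφC : ∀ x, |x| ≤ c → |φ x| ≤ ℓ * c := fun x hx => by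
    have := hφ x 0 hx (by simpa using (abs_nonneg x).trans hx)
    rw [hφ0, sub_zero, sub_zero] at this
    exact this.trans (mul_le_mul_of_nonneg_left hx hℓ.le)
  set m := signAvg (fun τ => radSup fun j => swapVec τ (a j) (b j)) with hm
  -- If the mean m over the swaps is small, the deviation has mean at most 2ℓm and is unlikely to be
  -- large. If m is large, the Rademacher average is unlikely to be as small as qB/c. The constants
  -- 6 and 29 give both cases the same exponent.
  rcases le_or_gt m (6 * q * B / c) with hcase | hcase
  · let W : (Fin n → ℝ) → ℝ := fun x => ⨆ j, (0 + ∑ t, x t * (φ (b j t) - φ (a j t)))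
    have hbd : ∀ x : Fin n → ℝ,
        BddAbove (Set.range fun j => (0 : ℝ) + ∑ t, x t * (φ (b j t) - φ (a j t))) := fun x => by
      simp only [zero_add]
      exact bddAbove_linear x (fun j t => φ (b j t) - φ (a j t)) (K := ℓ * c + ℓ * c) fun j t =>
        (abs_sub _ _).trans (add_le_add (hφC _ (hb j t)) (hφC _ (ha j t)))
    have hβ : ∀ j, ∑ t, (φ (b j t) - φ (a j t)) ^ 2 ≤ 2 * ℓ ^ 2 * B := fun j => by
      refine le_trans ?_ (mul_le_mul_of_nonneg_left (hab j) (by positivity))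
      rw [Finset.mul_sum]
      refine Finset.sum_le_sum fun t _ => ?_
      have h1 := hφ _ _ (hb j t) (ha j t)
      have h2 : (φ (b j t) - φ (a j t)) ^ 2 ≤ ℓ ^ 2 * (b j t - a j t) ^ 2 := by
        rw [← mul_pow, ← sq_abs, ← sq_abs (ℓ * _), abs_mul, abs_of_pos hℓ]
        exact pow_le_pow_left₀ (abs_nonneg _) h1 2
      nlinarith [mul_nonneg (sq_nonneg ℓ) (sq_nonneg (b j t + a j t))]
    obtain ⟨hconv, hlip⟩ := iSup_affine (fun _ => 0) (fun j t => φ (b j t) - φ (a j t)) hβ hbd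
    have hW0 : ∀ x, 0 ≤ W x := fun x => by
      have := le_ciSup (hbd x) j₀
      simp only [ha0, hb0, Pi.zero_apply, sub_self, mul_zero, Finset.sum_const_zero,
        add_zero] at this
      exact this
    have hEW : signAvg (fun σ : Fin n → Bool => W fun t => sgn (σ t)) ≤ 2 * ℓ * m := by
      have := signAvg_iSup_sub_le a b φ hℓ.le ha hb hφ0 hφ
      simpa only [W, zero_add] using this
    refine (signAvg_upper_tail W hconv hW0 (by positivity) hlip (l := q / (ℓ * c)) (by positivity)
      (29 * q * ℓ * B / c) _ ?_).trans ?_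
    · rintro σ ⟨-, j, hj⟩
      have := le_ciSup (hbd fun t => sgn (σ t)) j
      simp only [W]
      linarith
    -- In units of q²B/c²: 16 from the Lipschitz constant, 12 from the mean, minus 29 from the
    -- threshold.
    · rw [Real.exp_le_exp]
      have h1 : q / (ℓ * c) * signAvg (fun σ : Fin n → Bool => W fun t => sgn (σ t)) ≤
          q / (ℓ * c) * (2 * ℓ * (6 * q * B / c)) := mul_le_mul_of_nonneg_left
        (hEW.trans (mul_le_mul_of_nonneg_left hcase (by positivity))) (by positivity)
      have h2 : 8 * ((q / (ℓ * c)) ^ 2 * (2 * ℓ ^ 2 * B)) + q / (ℓ * c) * (2 * ℓ * (6 * q * B / c))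
          - q / (ℓ * c) * (29 * q * ℓ * B / c) = -(q ^ 2 * B / c ^ 2) := by
        field_simp
        ring
      linarith
  -- A swapped vector is (a + b)/2 + σ(a - b)/2, so for fixed ε this is a supremum of affine
  -- functions of the swap signs, with squared slopes adding up to at most B/2.
  · let f : (Fin n → Bool) → (Fin n → ℝ) → ℝ := fun ε x =>
      ⨆ j, ((∑ t, sgn (ε t) * ((a j t + b j t) / 2)) +
        ∑ t, x t * (sgn (ε t) * ((a j t - b j t) / 2)))
    have hbd : ∀ (ε : Fin n → Bool) (x : Fin n → ℝ),
        BddAbove (Set.range fun j => (∑ t, sgn (ε t) * ((a j t + b j t) / 2)) +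
          ∑ t, x t * (sgn (ε t) * ((a j t - b j t) / 2))) := fun ε x =>
      bddAbove_range_of_abs_le _ fun j => (abs_add_le _ _).trans (add_le_add
        (abs_sum_mul_le _ _ (K := c) fun t => by
          rw [abs_div, abs_two, div_le_iff₀ two_pos]
          linarith [abs_add_le (a j t) (b j t), ha j t, hb j t])
        (abs_sum_mul_le _ _ (K := c) fun t => by
          rw [abs_mul, abs_sgn, one_mul, abs_div, abs_two, div_le_iff₀ two_pos]
          linarith [abs_sub (a j t) (b j t), ha j t, hb j t]))
    have hβ : ∀ (ε : Fin n → Bool) j, ∑ t, (sgn (ε t) * ((a j t - b j t) / 2)) ^ 2 ≤ B / 2 := by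
      intro ε j
      refine le_trans ?_ (div_le_div_of_nonneg_right (hab j) two_pos.le)
      rw [Finset.sum_div]
      refine Finset.sum_le_sum fun t _ => ?_
      rw [mul_pow, ← sq_abs (sgn _), abs_sgn]
      nlinarith [sq_nonneg (a j t + b j t)]
    have hfaff := fun ε => iSup_affine _ _ (hβ ε) (hbd ε)
    let V : (Fin n → ℝ) → ℝ := fun x => signAvg fun ε => f ε x
    have hconv : ConvexOn ℝ (Set.Icc (-1) 1) V := by
      refine ⟨convex_Icc _ _, fun x hx y hy s t hs ht hst => ?_⟩
      simp only [V, smul_eq_mul]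
      rw [← signAvg_const_mul, ← signAvg_const_mul, ← signAvg_add]
      exact signAvg_mono fun ε => (hfaff ε).1.2 hx hy hs ht hst
    have hV0 : ∀ x, 0 ≤ V x := fun x => signAvg_nonneg fun ε => by
      have := le_ciSup (hbd ε x) j₀
      simp only [ha0, hb0, Pi.zero_apply, sub_self, add_zero, zero_div, mul_zero,
        Finset.sum_const_zero] at this
      exact this
    have hlip : ∀ x y, V x - V y ≤ √(B / 2 * ∑ t, (x t - y t) ^ 2) := fun x y => by
      simp only [V]
      rw [← signAvg_sub, ← signAvg_const (n := n) (√_)]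
      exact signAvg_mono fun ε => (hfaff ε).2 x y
    have hVs : ∀ σ : Fin n → Bool, (V fun t => sgn (σ t)) =
        radSup fun j => swapVec σ (a j) (b j) := fun σ => by
      simp only [V, f, radSup, ← Finset.sum_add_distrib]
      congr 1
      funext ε
      congr 1
      funext j
      refine Finset.sum_congr rfl fun t _ => ?_
      cases hσ : σ t <;> cases hε : ε t <;> simp [sgn, swapVec, hσ] <;> ring
    refine (signAvg_lower_tail V hconv hV0 (by positivity) hlip (l := q / c) (by positivity)
      (q * B / c) _ ?_).trans ?_
    · rintro σ ⟨h, -⟩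
      rwa [hVs]
    -- In the same units, 4 - 6 + 1 = -1.
    · rw [Real.exp_le_exp]
      simp only [hVs]
      have h1 : q / c * (6 * q * B / c) ≤ q / c * m :=
        mul_le_mul_of_nonneg_left hcase.le (by positivity)
      have h2 : 8 * ((q / c) ^ 2 * (B / 2)) - q / c * (6 * q * B / c) + q / c * (q * B / c)
          = -(q ^ 2 * B / c ^ 2) := by
        field_simp
        ring
      rw [← hm]
      linarith

end Families


/-! ### Symmetrization with a ghost sample -/

section Symmetrization

variable {Ω : Type*} {n : ℕ}

open scoped Classical in
/-- The values of `g` on the subsample `S` of `D`, if `g` is small on the double sample `(D, D')`,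
and zero otherwise. -/
noncomputable def locVec (S : Finset (Fin n)) (B : ℝ) (D D' : Fin n → Ω) (g : Ω → ℝ) :
    Fin n → ℝ :=
  fun t => if t ∈ S ∧ ∑ s ∈ S, (g (D s) ^ 2 + g (D' s) ^ 2) ≤ B then g (D t) else 0

lemma locVec_of_le {S : Finset (Fin n)} {B : ℝ} {D D' : Fin n → Ω} {g : Ω → ℝ}
    (h : ∑ s ∈ S, (g (D s) ^ 2 + g (D' s) ^ 2) ≤ B) (t : Fin n) :
    locVec S B D D' g t = if t ∈ S then g (D t) else 0 := by
  simp [locVec, h]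

lemma locVec_of_not_le {S : Finset (Fin n)} {B : ℝ} {D D' : Fin n → Ω} {g : Ω → ℝ}
    (h : ¬ ∑ s ∈ S, (g (D s) ^ 2 + g (D' s) ^ 2) ≤ B) : locVec S B D D' g = 0 := by
  funext t
  simp [locVec, h]

lemma sum_swapVec (S : Finset (Fin n)) (σ : Fin n → Bool) (D D' : Fin n → Ω) (g : Ω → ℝ) :
    ∑ s ∈ S, (g (swapVec σ D D' s) ^ 2 + g (swapVec σ D' D s) ^ 2) =
      ∑ s ∈ S, (g (D s) ^ 2 + g (D' s) ^ 2) := by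
  refine Finset.sum_congr rfl fun s _ => ?_
  cases hσ : σ s <;> simp [swapVec, hσ, add_comm]

/-- The localization is imposed on the double sample and is therefore symmetric; this is what makes
truncation commute with swapping. -/
lemma locVec_swapVec (S : Finset (Fin n)) (B : ℝ) (σ : Fin n → Bool) (D D' : Fin n → Ω)
    (g : Ω → ℝ) : locVec S B (swapVec σ D D') (swapVec σ D' D) g =
      swapVec σ (locVec S B D D' g) (locVec S B D' D g) := by
  have hcomm : ∑ s ∈ S, (g (D' s) ^ 2 + g (D s) ^ 2) = ∑ s ∈ S, (g (D s) ^ 2 + g (D' s) ^ 2) :=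
    Finset.sum_congr rfl fun s _ => add_comm _ _
  funext t
  by_cases h : ∑ s ∈ S, (g (D s) ^ 2 + g (D' s) ^ 2) ≤ B
  · rw [locVec_of_le (by rwa [sum_swapVec])]
    unfold swapVec
    rw [locVec_of_le h, locVec_of_le (by rwa [hcomm])]
    split_ifs <;> rfl
  · rw [locVec_of_not_le (by rwa [sum_swapVec])]
    unfold swapVec
    rw [locVec_of_not_le h, locVec_of_not_le (by rwa [hcomm])]
    split_ifs <;> rfl

/-- The event, for a double sample, that the Rademacher average of the first sample is small while
the two samples deviate. -/
def swapEvent (S : Finset (Fin n)) (G : Set (Ω → ℝ)) (Ω₀ : Set Ω) (φ : ℝ → ℝ) (B v w : ℝ) :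
    Set ((Fin n → Ω) × (Fin n → Ω)) :=
  {p | (∀ t, p.1 t ∈ Ω₀ ∧ p.2 t ∈ Ω₀) ∧
    radSup (fun g : G => locVec S B p.1 p.2 g.1) ≤ v ∧
    ∃ g : G, w < ∑ t, (φ (locVec S B p.2 p.1 g.1 t) - φ (locVec S B p.1 p.2 g.1 t))}

/-- With the pair of samples fixed, only the swaps are random and `signAvg_swap_le` applies to the
truncated vectors. A pair that leaves `Ω₀` does so after every swap and contributes nothing. -/
lemma signAvg_swapEvent_le (S : Finset (Fin n)) {G : Set (Ω → ℝ)} (hG0 : (0 : Ω → ℝ) ∈ G)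
    {Ω₀ : Set Ω} {φ : ℝ → ℝ} {ℓ c q B : ℝ} (hℓ : 0 < ℓ) (hc : 0 < c) (hq : 0 < q) (hB : 0 ≤ B)
    (hGc : ∀ g ∈ G, ∀ x ∈ Ω₀, |g x| ≤ c) (hφ0 : φ 0 = 0)
    (hφ : ∀ x y, |x| ≤ c → |y| ≤ c → |φ x - φ y| ≤ ℓ * |x - y|)
    (p : (Fin n → Ω) × (Fin n → Ω)) :
    signAvg (Set.indicator {σ : Fin n → Bool | (swapVec σ p.1 p.2, swapVec σ p.2 p.1) ∈
      swapEvent S G Ω₀ φ B (q * B / c) (29 * q * ℓ * B / c)} fun _ => 1) ≤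
      Real.exp (-(q ^ 2 * B / c ^ 2)) := by
  by_cases hp : ∀ t, p.1 t ∈ Ω₀ ∧ p.2 t ∈ Ω₀
  · have hbd : ∀ (D D' : Fin n → Ω), (∀ t, D t ∈ Ω₀) → ∀ (g : G) t, |locVec S B D D' g.1 t| ≤ c := by
      intro D D' hD g t
      unfold locVec
      split_ifs
      · exact hGc _ g.2 _ (hD t)
      · simpa using hc.le
    have : Nonempty G := ⟨⟨0, hG0⟩⟩
    have hz : ∀ D D' : Fin n → Ω, locVec S B D D' (0 : Ω → ℝ) = 0 := fun D D' => by
      funext t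
      simp [locVec]
    have h := signAvg_swap_le (fun g : G => locVec S B p.1 p.2 g.1)
      (fun g : G => locVec S B p.2 p.1 g.1) φ hℓ hc hq hB (hbd _ _ fun t => (hp t).1)
      (hbd _ _ fun t => (hp t).2) hφ0 hφ (fun g => by
        by_cases hg : ∑ s ∈ S, (g.1 (p.1 s) ^ 2 + g.1 (p.2 s) ^ 2) ≤ B
        · have hg' : ∑ s ∈ S, (g.1 (p.2 s) ^ 2 + g.1 (p.1 s) ^ 2) ≤ B := by
            simpa only [add_comm] using hg
          simp only [locVec_of_le hg, locVec_of_le hg']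
          refine le_trans (le_of_eq ?_) hg
          rw [← Finset.sum_filter_add_sum_filter_not Finset.univ (· ∈ S), add_comm,
            Finset.sum_eq_zero, zero_add, Finset.filter_univ_mem]
          · exact Finset.sum_congr rfl fun t ht => by simp [ht]
          · intro t ht
            simp [(Finset.mem_filter.1 ht).2]
        · have hg' : ¬ ∑ s ∈ S, (g.1 (p.2 s) ^ 2 + g.1 (p.1 s) ^ 2) ≤ B := by
            simpa only [add_comm] using hg
          simp only [locVec_of_not_le hg, locVec_of_not_le hg']
          simpa using hB)
      ⟨0, hG0⟩ (hz _ _) (hz _ _)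
    refine le_trans (signAvg_mono fun σ => ?_) h
    refine Set.indicator_le_indicator_of_subset (fun σ hσ => ?_) (fun _ => zero_le_one) σ
    obtain ⟨-, h1, g, h2⟩ := hσ
    simp only [locVec_swapVec] at h1 h2
    refine ⟨h1, g, h2.trans_le (le_of_eq (Finset.sum_congr rfl fun t _ => ?_))⟩
    cases hσ : σ t <;> simp [swapVec, sgn, hσ]
  · have : {σ : Fin n → Bool | (swapVec σ p.1 p.2, swapVec σ p.2 p.1) ∈
        swapEvent S G Ω₀ φ B (q * B / c) (29 * q * ℓ * B / c)} = ∅ := by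
      refine Set.eq_empty_of_forall_notMem fun σ hσ => hp fun t => ?_
      have := hσ.1 t
      cases hσ : σ t <;> simp [swapVec, hσ] at this <;> tauto
    rw [this, Set.indicator_empty, signAvg_const]
    exact Real.exp_nonneg _

/-- The Rademacher average of the functions of `F` that are small on the subsample `S` of `D`. -/
noncomputable def radClass (S : Finset (Fin n)) (F : Set (Ω → ℝ)) (B : ℝ) (D : Fin n → Ω) : ℝ :=
  signAvg fun ε => ⨆ f : {f : Ω → ℝ // f ∈ F ∧ ∑ t ∈ S, f (D t) ^ 2 ≤ B},
    ∑ t ∈ S, sgn (ε t) * f.1 (D t)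

/-- Smallness on the double sample implies smallness on `D`, and a truncated function counts as the
zero function, which is in `F`. -/
lemma radSup_locVec_le (S : Finset (Fin n)) {F G : Set (Ω → ℝ)} (hGF : G ⊆ F)
    (hF0 : (0 : Ω → ℝ) ∈ F) {Ω₀ : Set Ω} {c B : ℝ} (hB : 0 ≤ B)
    (hFc : ∀ f ∈ F, ∀ x ∈ Ω₀, |f x| ≤ c) (hG0 : G.Nonempty) (D D' : Fin n → Ω)
    (hD : ∀ t, D t ∈ Ω₀) :
    radSup (fun g : G => locVec S B D D' g.1) ≤ radClass S F B D := by
  have : Nonempty G := hG0.to_subtype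
  refine signAvg_mono fun ε => ciSup_le fun g => ?_
  have hbd : BddAbove (Set.range fun f : {f : Ω → ℝ // f ∈ F ∧ ∑ t ∈ S, f (D t) ^ 2 ≤ B} =>
      ∑ t ∈ S, sgn (ε t) * f.1 (D t)) := by
    refine ⟨∑ t ∈ S, c, ?_⟩
    rintro _ ⟨f, rfl⟩
    refine Finset.sum_le_sum fun t _ => (le_abs_self _).trans ?_
    rw [abs_mul, abs_sgn, one_mul]
    exact hFc _ f.2.1 _ (hD t)
  by_cases hg : ∑ s ∈ S, (g.1 (D s) ^ 2 + g.1 (D' s) ^ 2) ≤ B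
  · refine le_trans (le_of_eq ?_) (le_ciSup hbd ⟨g.1, hGF g.2, le_trans
      (Finset.sum_le_sum fun t _ => le_add_of_nonneg_right (sq_nonneg _)) hg⟩)
    simp only [locVec_of_le hg]
    rw [← Finset.sum_subset (Finset.subset_univ S)]
    · exact Finset.sum_congr rfl fun t ht => by simp [ht]
    · intro t _ ht
      simp [ht]
  · refine le_trans (le_of_eq ?_) (le_ciSup hbd ⟨0, hF0, by simpa using hB⟩)
    simp [locVec_of_not_le hg]

variable [MeasurableSpace Ω]

lemma measurable_locVec {α : Type*} [MeasurableSpace α] (S : Finset (Fin n)) (B : ℝ) {g : Ω → ℝ}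
    (hg : Measurable g) {X X' : α → Fin n → Ω} (hX : Measurable X) (hX' : Measurable X')
    (t : Fin n) : Measurable fun p => locVec S B (X p) (X' p) g t := by
  have h1 : ∀ s, Measurable fun p => g (X p s) := fun s =>
    hg.comp ((measurable_pi_apply s).comp hX)
  have h2 : ∀ s, Measurable fun p => g (X' p s) := fun s =>
    hg.comp ((measurable_pi_apply s).comp hX')
  unfold locVec
  refine Measurable.ite ?_ (h1 t) measurable_const
  by_cases ht : t ∈ S
  · simp only [ht, true_and]
    exact measurableSet_le (Finset.measurable_sum _ fun s _ =>
      ((h1 s).pow_const 2).add ((h2 s).pow_const 2)) measurable_const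
  · simp [ht]

lemma measurable_radSup {α : Type*} [MeasurableSpace α] {J : Type*} [Countable J]
    {x : α → J → Fin n → ℝ} (hx : ∀ j t, Measurable fun p => x p j t) :
    Measurable fun p => radSup (x p) := by
  unfold radSup signAvg
  refine Measurable.div_const (Finset.measurable_sum _ fun ε _ => Measurable.iSup fun j =>
    Finset.measurable_sum _ fun t _ => (hx j t).const_mul _) _

lemma measurableSet_swapEvent (S : Finset (Fin n)) {G : Set (Ω → ℝ)} (hG : G.Countable)
    (hGm : ∀ g ∈ G, Measurable g) {Ω₀ : Set Ω} (hΩ₀ : MeasurableSet Ω₀) {φ : ℝ → ℝ}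
    (hφ : Continuous φ) (B v w : ℝ) : MeasurableSet (swapEvent S G Ω₀ φ B v w) := by
  have : Countable G := hG.to_subtype
  have h1 : ∀ (g : G) t, Measurable fun p : (Fin n → Ω) × (Fin n → Ω) =>
      locVec S B p.1 p.2 g.1 t := fun g t => measurable_locVec S B (hGm _ g.2) measurable_fst measurable_snd t
  have h2 : ∀ (g : G) t, Measurable fun p : (Fin n → Ω) × (Fin n → Ω) =>
      locVec S B p.2 p.1 g.1 t := fun g t => measurable_locVec S B (hGm _ g.2) measurable_snd measurable_fst t
  have m1 : MeasurableSet {p : (Fin n → Ω) × (Fin n → Ω) | ∀ t, p.1 t ∈ Ω₀ ∧ p.2 t ∈ Ω₀} := by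
    have : {p : (Fin n → Ω) × (Fin n → Ω) | ∀ t, p.1 t ∈ Ω₀ ∧ p.2 t ∈ Ω₀} =
        ⋂ t, ((fun p : (Fin n → Ω) × (Fin n → Ω) => p.1 t) ⁻¹' Ω₀ ∩
          (fun p : (Fin n → Ω) × (Fin n → Ω) => p.2 t) ⁻¹' Ω₀) := by
      ext p
      simp
    rw [this]
    exact MeasurableSet.iInter fun t => (hΩ₀.preimage (by fun_prop)).inter
      (hΩ₀.preimage (by fun_prop))
  have m2 : MeasurableSet {p : (Fin n → Ω) × (Fin n → Ω) |
      radSup (fun g : G => locVec S B p.1 p.2 g.1) ≤ v} :=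
    measurableSet_le (measurable_radSup h1) measurable_const
  have m3 : MeasurableSet {p : (Fin n → Ω) × (Fin n → Ω) | ∃ g : G, w <
      ∑ t, (φ (locVec S B p.2 p.1 g.1 t) - φ (locVec S B p.1 p.2 g.1 t))} := by
    rw [Set.ofPred_exists]
    refine MeasurableSet.iUnion fun g => measurableSet_lt measurable_const
      (Finset.measurable_sum _ fun t _ => (hφ.measurable.comp (h2 g t)).sub
        (hφ.measurable.comp (h1 g t)))
  exact m1.inter (m2.inter m3)

variable (ν : Fin n → Measure Ω) [∀ t, IsProbabilityMeasure (ν t)]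

lemma measurePreserving_swapVec (σ : Fin n → Bool) :
    MeasurePreserving (fun p : (Fin n → Ω) × (Fin n → Ω) => (swapVec σ p.1 p.2, swapVec σ p.2 p.1))
      ((Measure.pi ν).prod (Measure.pi ν)) ((Measure.pi ν).prod (Measure.pi ν)) := by
  have h := measurePreserving_arrowProdEquivProdArrow Ω Ω (Fin n) ν ν
  have hs := measurePreserving_pi (fun t => (ν t).prod (ν t)) (fun t => (ν t).prod (ν t))
    (f := fun t x => if σ t then x else x.swap) (fun t => by
      cases σ t
      · simpa using Measure.measurePreserving_swap
      · simpa using! MeasurePreserving.id _)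
  have := (h.comp hs).comp h.symm
  convert this using 1
  funext p
  refine Prod.ext ?_ ?_ <;> funext t <;> cases hσ : σ t <;>
    simp [swapVec, hσ, MeasurableEquiv.arrowProdEquivProdArrow, Equiv.arrowProdEquivProdArrow]

/-- The law of the double sample is invariant under each swap, so the probability of the event is
the mean over the samples of its frequency among the swaps. -/
lemma measure_swapEvent_le (S : Finset (Fin n)) {G : Set (Ω → ℝ)} (hG : G.Countable)
    (hGm : ∀ g ∈ G, Measurable g) (hG0 : (0 : Ω → ℝ) ∈ G)
    {Ω₀ : Set Ω} (hΩ₀ : MeasurableSet Ω₀) {φ : ℝ → ℝ} (hφc : Continuous φ) {ℓ c q B : ℝ}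
    (hℓ : 0 < ℓ) (hc : 0 < c) (hq : 0 < q) (hB : 0 ≤ B)
    (hGc : ∀ g ∈ G, ∀ x ∈ Ω₀, |g x| ≤ c) (hφ0 : φ 0 = 0)
    (hφ : ∀ x y, |x| ≤ c → |y| ≤ c → |φ x - φ y| ≤ ℓ * |x - y|) :
    ((Measure.pi ν).prod (Measure.pi ν))
      (swapEvent S G Ω₀ φ B (q * B / c) (29 * q * ℓ * B / c)) ≤
      ENNReal.ofReal (Real.exp (-(q ^ 2 * B / c ^ 2))) := by
  set E := swapEvent S G Ω₀ φ B (q * B / c) (29 * q * ℓ * B / c) with hE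
  have hEm : MeasurableSet E := measurableSet_swapEvent S hG hGm hΩ₀ hφc _ _ _
  set Q := (Measure.pi ν).prod (Measure.pi ν)
  let Φ : (Fin n → Bool) → (Fin n → Ω) × (Fin n → Ω) → (Fin n → Ω) × (Fin n → Ω) :=
    fun σ p => (swapVec σ p.1 p.2, swapVec σ p.2 p.1)
  have hΦ : ∀ σ, MeasurePreserving (Φ σ) Q Q := measurePreserving_swapVec ν
  have h1 : ∑ _σ : Fin n → Bool, Q E = ∫⁻ p, ∑ σ : Fin n → Bool, (Φ σ ⁻¹' E).indicator 1 p ∂Q := by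
    rw [lintegral_finsetSum _ fun σ _ => measurable_one.indicator ((hΦ σ).measurable hEm)]
    refine Finset.sum_congr rfl fun σ _ => ?_
    rw [lintegral_indicator_one ((hΦ σ).measurable hEm),
      (hΦ σ).measure_preimage hEm.nullMeasurableSet]
  have h2 : ∀ p, ∑ σ : Fin n → Bool, (Φ σ ⁻¹' E).indicator (1 : (Fin n → Ω) × (Fin n → Ω) → ℝ≥0∞) p ≤
      ENNReal.ofReal (2 ^ n * Real.exp (-(q ^ 2 * B / c ^ 2))) := by
    intro p
    have h := signAvg_swapEvent_le S hG0 hℓ hc hq hB hGc hφ0 hφ p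
    unfold signAvg at h
    rw [div_le_iff₀ (by positivity), mul_comm (Real.exp _)] at h
    refine le_trans (le_of_eq ?_) (ENNReal.ofReal_le_ofReal h)
    rw [ENNReal.ofReal_sum_of_nonneg fun σ _ => Set.indicator_nonneg (fun _ _ => zero_le_one) _]
    refine Finset.sum_congr rfl fun σ _ => ?_
    by_cases hσ : Φ σ p ∈ E
    · rw [Set.indicator_of_mem (by exact hσ), Set.indicator_of_mem (by exact hσ)]
      simp
    · rw [Set.indicator_of_notMem (by exact hσ), Set.indicator_of_notMem (by exact hσ)]
      simp
  have h3 := h1.le.trans (lintegral_mono h2)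
  rw [lintegral_const, measure_univ, mul_one, Finset.sum_const, Finset.card_univ, nsmul_eq_mul,
    ENNReal.ofReal_mul (by positivity)] at h3
  have h4 : ((Fintype.card (Fin n → Bool) : ℕ) : ℝ≥0∞) = ENNReal.ofReal (2 ^ n) := by
    rw [Fintype.card_fun, Fintype.card_bool, Fintype.card_fin, ← ENNReal.ofReal_natCast]
    norm_num
  rw [h4] at h3
  exact (ENNReal.mul_le_mul_iff_right (by simp) ENNReal.ofReal_ne_top).1 h3

/-- Markov's inequality for the probability of a fibre. `A` may be non-measurable, so it may be
defined by a quantifier over an uncountable class. -/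
lemma measure_le_two_mul_of_half_le {α β : Type*} [MeasurableSpace α] [MeasurableSpace β]
    (μ : Measure α) (ρ : Measure β) [SFinite ρ] {E : Set (α × β)} (hE : MeasurableSet E)
    {A : Set α} (hA : ∀ x ∈ A, 1 / 2 ≤ ρ (Prod.mk x ⁻¹' E)) :
    μ A ≤ 2 * (μ.prod ρ) E := by
  have h1 : μ A ≤ μ {x | 1 / 2 ≤ ρ (Prod.mk x ⁻¹' E)} := measure_mono hA
  have h2 := mul_meas_ge_le_lintegral (μ := μ) (measurable_measure_prodMk_left (ν := ρ) hE) (1 / 2)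
  rw [← Measure.prod_apply hE] at h2
  have h3 := mul_le_mul_right (h2) 2
  rw [← mul_assoc, one_div, ENNReal.mul_inv_cancel two_ne_zero ENNReal.ofNat_ne_top, one_mul] at h3
  rw [one_div] at h1
  exact h1.trans h3

/-- Deviation bound with a ghost sample, for a class with a countable pointwise dense subclass. -/
theorem measure_ghost_le (S : Finset (Fin n)) {F : Set (Ω → ℝ)} (hF : PointwiseSeparable F)
    (hFm : ∀ f ∈ F, Measurable f) (hF0 : (0 : Ω → ℝ) ∈ F)
    {Ω₀ : Set Ω} (hΩ₀ : MeasurableSet Ω₀) {φ : ℝ → ℝ} (hφc : Continuous φ) {ℓ c q B : ℝ}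
    (hℓ : 0 < ℓ) (hc : 0 < c) (hq : 0 < q) (hB : 0 ≤ B)
    (hFc : ∀ f ∈ F, ∀ x ∈ Ω₀, |f x| ≤ c) (hφ0 : φ 0 = 0)
    (hφ : ∀ x y, |x| ≤ c → |y| ≤ c → |φ x - φ y| ≤ ℓ * |x - y|) :
    Measure.pi ν {D | (∀ t, D t ∈ Ω₀) ∧ radClass S F B D ≤ q * B / c ∧
      ∃ f ∈ F, 1 / 2 ≤ Measure.pi ν {D' | (∀ t, D' t ∈ Ω₀) ∧
        ∑ t ∈ S, (f (D t) ^ 2 + f (D' t) ^ 2) < B ∧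
        29 * q * ℓ * B / c < |∑ t ∈ S, (φ (f (D' t)) - φ (f (D t)))|}} ≤
      4 * ENNReal.ofReal (Real.exp (-(q ^ 2 * B / c ^ 2))) := by
  obtain ⟨G₀, hG₀F, hG₀c, hG₀⟩ := hF
  -- The zero function makes the suprema in `signAvg_swap_le` nonnegative.
  set G : Set (Ω → ℝ) := insert 0 G₀ with hG
  have hGF : G ⊆ F := Set.insert_subset hF0 hG₀F
  have hGc : G.Countable := hG₀c.insert 0
  have hG0 : (0 : Ω → ℝ) ∈ G := Set.mem_insert _ _
  set v := q * B / c
  set w := 29 * q * ℓ * B / c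
  have h1 := measure_swapEvent_le ν S hGc (fun g hg => hFm g (hGF hg)) hG0 hΩ₀ hφc hℓ hc hq hB
    (fun g hg => hFc g (hGF hg)) hφ0 hφ
  have h2 := measure_swapEvent_le ν S hGc (fun g hg => hFm g (hGF hg)) hG0 hΩ₀ hφc.neg hℓ hc hq hB
    (fun g hg => hFc g (hGF hg)) (by simpa using hφ0) (fun x y hx hy => by
      rw [Pi.neg_apply, Pi.neg_apply, ← neg_sub', abs_neg]; exact hφ x y hx hy)
  have hE1 := measurableSet_swapEvent S hGc (fun g hg => hFm g (hGF hg)) hΩ₀ hφc B v w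
  have hE2 := measurableSet_swapEvent S hGc (fun g hg => hFm g (hGF hg)) hΩ₀ hφc.neg B v w
  refine (measure_le_two_mul_of_half_le (Measure.pi ν) (Measure.pi ν) (hE1.union hE2) ?_).trans ?_
  · rintro D ⟨hD, hrad, f, hf, hhalf⟩
    refine hhalf.trans (measure_mono ?_)
    rintro D' ⟨hD', hloc, hdev⟩
    -- Both conditions on `D'` are strict, so they hold for a function of the countable subclass far
    -- enough along the approximating sequence.
    obtain ⟨u, huG, hu⟩ := hG₀ f hf
    have hev1 : ∀ᶠ m in atTop, ∑ t ∈ S, (u m (D t) ^ 2 + u m (D' t) ^ 2) < B :=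
      (tendsto_finsetSum _ fun t _ => ((hu (D t)).pow 2).add ((hu (D' t)).pow 2)).eventually_lt_const
        hloc
    have hev2 : ∀ᶠ m in atTop, w < |∑ t ∈ S, (φ (u m (D' t)) - φ (u m (D t)))| :=
      ((tendsto_finsetSum _ fun t _ => ((hφc.tendsto _).comp (hu (D' t))).sub
        ((hφc.tendsto _).comp (hu (D t)))).abs).eventually_const_lt hdev
    obtain ⟨m, hm1, hm2⟩ := (hev1.and hev2).exists
    have hmG : u m ∈ G := Set.mem_insert_of_mem _ (huG m)
    have hr := (radSup_locVec_le S hGF hF0 hB hFc ⟨0, hG0⟩ D D' hD).trans hrad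
    have hm1' : ∑ t ∈ S, (u m (D' t) ^ 2 + u m (D t) ^ 2) ≤ B := by
      simpa only [add_comm] using hm1.le
    have hsum : ∀ ψ : ℝ → ℝ, ψ 0 = 0 → ∑ t, (ψ (locVec S B D' D (u m) t) -
        ψ (locVec S B D D' (u m) t)) = ∑ t ∈ S, (ψ (u m (D' t)) - ψ (u m (D t))) := by
      intro ψ hψ
      simp only [locVec_of_le hm1.le, locVec_of_le hm1']
      rw [← Finset.sum_subset (Finset.subset_univ S)]
      · exact Finset.sum_congr rfl fun t ht => by simp [ht]
      · intro t _ ht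
        simp [ht]
    -- One event for φ and one for -φ; with the factor 2 of the ghost sample this gives the constant
    -- 4.
    rcases lt_abs.1 hm2 with h | h
    · exact Or.inl ⟨fun t => ⟨hD t, hD' t⟩, hr, ⟨u m, hmG⟩, by rwa [hsum φ hφ0]⟩
    · refine Or.inr ⟨fun t => ⟨hD t, hD' t⟩, hr, ⟨u m, hmG⟩, ?_⟩
      rw [hsum (-φ) (by simpa using hφ0)]
      simpa only [Pi.neg_apply, ← neg_sub', Finset.sum_neg_distrib] using h
  · refine (mul_le_mul_right ((measure_union_le _ _).trans (add_le_add h1 h2)) 2).trans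
      (le_of_eq ?_)
    ring

end Symmetrization


/-! ### Uniform concentration over star-shaped classes -/

section Concentration

variable {Ω : Type*} [MeasurableSpace Ω] {n : ℕ}

/-- Chebyshev's inequality on the subsample; coordinates outside `S`, whose laws are arbitrary,
receive the zero function. -/
lemma measure_abs_sum_sub_ge_le (ν : Fin n → Measure Ω) [∀ t, IsProbabilityMeasure (ν t)]
    (S : Finset (Fin n)) (μ : Measure Ω) (hμ : ∀ t ∈ S, ν t = μ) {u : Ω → ℝ} (hu : MemLp u 2 μ)
    (hum : Measurable u) {τ : ℝ} (hτ : 0 < τ) :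
    Measure.pi ν {D | τ ≤ |∑ t ∈ S, u (D t) - S.card * ∫ x, u x ∂μ|} ≤
      ENNReal.ofReal (S.card * (∫ x, u x ^ 2 ∂μ) / τ ^ 2) := by
  classical
  let X : Fin n → Ω → ℝ := fun t => if t ∈ S then u else 0
  have hX : ∀ t, MemLp (X t) 2 (ν t) := fun t => by
    by_cases ht : t ∈ S
    · simpa only [X, ht, if_true, hμ t ht] using hu
    · simp [X, ht]
  have hvar := variance_sum_pi hX
  have hXL : MemLp (∑ t, fun D : Fin n → Ω => X t (D t)) 2 (Measure.pi ν) :=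
    memLp_finsetSum' _ fun t _ => (hX t).comp_measurePreserving (measurePreserving_eval ν t)
  have hsum : (∑ t, fun D : Fin n → Ω => X t (D t)) = fun D => ∑ t ∈ S, u (D t) := by
    funext D
    rw [Finset.sum_apply, ← Finset.sum_subset (Finset.subset_univ S)]
    · exact Finset.sum_congr rfl fun t ht => by simp [X, ht]
    · intro t _ ht
      simp [X, ht]
  rw [hsum] at hvar hXL
  have hE : ∫ D, ∑ t ∈ S, u (D t) ∂(Measure.pi ν) = S.card * ∫ x, u x ∂μ := by
    rw [integral_finsetSum]
    · rw [Finset.sum_congr rfl (g := fun _ => ∫ x, u x ∂μ), Finset.sum_const, nsmul_eq_mul]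
      intro t ht
      have := integral_comp_eval (μ := ν) (i := t) (f := u) hum.aestronglyMeasurable
      rw [this, hμ t ht]
    · intro t ht
      refine (integrable_comp_eval (μ := ν) (i := t) (f := u) ?_)
      have hp : IsProbabilityMeasure μ := hμ t ht ▸ inferInstance
      rw [hμ t ht]
      exact hu.integrable one_le_two
  have h := meas_ge_le_variance_div_sq hXL hτ
  rw [hE] at h
  refine h.trans (ENNReal.ofReal_le_ofReal (div_le_div_of_nonneg_right ?_ (sq_nonneg _)))
  rw [hvar, ← Finset.sum_subset (Finset.subset_univ S)]
  · refine (Finset.sum_le_card_nsmul _ _ (∫ x, u x ^ 2 ∂μ) fun t ht => ?_).trans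
      (le_of_eq (nsmul_eq_mul _ _))
    simp only [X, ht, if_true]
    have := variance_le_expectation_sq (μ := ν t) (X := u) hum.aestronglyMeasurable
    rwa [hμ t ht] at this ⊢
  · intro t _ ht
    simp [X, ht]

lemma half_le_of_compl_le {α : Type*} [MeasurableSpace α] {P : Measure α} [IsProbabilityMeasure P]
    {A : Set α} (h : P Aᶜ ≤ 1 / 2) : 1 / 2 ≤ P A := by
  have h1 : 1 ≤ P A + P Aᶜ := by
    rw [← measure_univ (μ := P), ← Set.union_compl_self A]
    exact measure_union_le _ _
  have h2 : (1 : ℝ≥0∞) ≤ P A + 1 / 2 := h1.trans (by gcongr)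
  by_contra hlt
  have := ENNReal.add_lt_add_right (show (1 / 2 : ℝ≥0∞) ≠ ∞ by simp) (not_le.1 hlt)
  rw [ENNReal.add_halves] at this
  exact absurd h2 (not_le.2 this)

variable (ν : Fin n → Measure Ω) [∀ t, IsProbabilityMeasure (ν t)] (S : Finset (Fin n))
  (μ : Measure Ω) [IsProbabilityMeasure μ]

lemma measure_exists_notMem {Ω₀ : Set Ω} (hΩ₀ν : ∀ t, ν t Ω₀ᶜ = 0) :
    Measure.pi ν {D | ¬ ∀ t, D t ∈ Ω₀} = 0 := by
  have : {D : Fin n → Ω | ¬ ∀ t, D t ∈ Ω₀} = ⋃ t, (Function.eval t) ⁻¹' Ω₀ᶜ := by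
    ext D
    simp
  rw [this]
  exact measure_iUnion_null fun t =>
    (measurePreserving_eval ν t).quasiMeasurePreserving.preimage_null (hΩ₀ν t)

/-- The empirical and the population square norm of the functions in a star-shaped class are
comparable. -/
theorem measure_sq_norm_deviation_le (hμ : ∀ t ∈ S, ν t = μ) {F : Set (Ω → ℝ)}
    (hF : PointwiseSeparable F) (hFm : ∀ f ∈ F, Measurable f) (hF0 : (0 : Ω → ℝ) ∈ F)
    (hFs : StarConvex ℝ 0 F) {Ω₀ : Set Ω} (hΩ₀ : MeasurableSet Ω₀) (hΩ₀ν : ∀ t, ν t Ω₀ᶜ = 0)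
    (hΩ₀μ : μ Ω₀ᶜ = 0) {c q r : ℝ} (hc : 0 < c) (hq : 0 < q) (hq1 : q ≤ 1 / 1400) (hr : 0 < r)
    (hFc : ∀ f ∈ F, ∀ x ∈ Ω₀, |f x| ≤ c) (hN : 144 * c ^ 2 ≤ S.card * r ^ 2) :
    Measure.pi ν {D | (∀ t, D t ∈ Ω₀) ∧
      radClass S F (4 * (S.card * r ^ 2)) D ≤ q * (4 * (S.card * r ^ 2)) / c ∧
      ∃ f ∈ F, S.card * (1 / 2 * ∫ x, f x ^ 2 ∂μ + r ^ 2) <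
        |∑ t ∈ S, f (D t) ^ 2 - S.card * ∫ x, f x ^ 2 ∂μ|} ≤
      4 * ENNReal.ofReal (Real.exp (-(q ^ 2 * (4 * (S.card * r ^ 2)) / c ^ 2))) := by
  set N : ℝ := (S.card : ℝ) with hNdef
  have hNr : 0 < N * r ^ 2 := lt_of_lt_of_le (by positivity) hN
  have hN0 : 0 < N := pos_of_mul_pos_left hNr (sq_nonneg r)
  -- On [-c, c] the square is 2c-Lipschitz. B = 4Nr² exceeds Nr² + (2 + 1/6)Nr², the most that data
  -- and ghost sample contribute for a rescaled function.
  refine le_trans (measure_mono ?_) (measure_ghost_le ν S hF hFm hF0 hΩ₀ (φ := fun x => x ^ 2)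
    (by fun_prop) (ℓ := 2 * c) (by positivity) hc hq (B := 4 * (N * r ^ 2)) (by positivity) hFc
    (by simp) (fun x y hx hy => by
      rw [sq_sub_sq, abs_mul]
      exact mul_le_mul_of_nonneg_right ((abs_add_le x y).trans (by linarith)) (abs_nonneg _)))
  rintro D ⟨hD, hrad, f, hf, hdev⟩
  refine ⟨hD, hrad, ?_⟩
  have hint : ∀ f ∈ F, MemLp f ∞ μ := fun f hf =>
    memLp_top_of_bound (hFm f hf).aestronglyMeasurable c (by
      filter_upwards [compl_mem_ae_iff.2 hΩ₀μ] with x hx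
      exact hFc f hf x (not_not.1 hx))
  have hsq : ∀ f ∈ F, Integrable (fun x => f x ^ 2) μ := fun f hf =>
    ((hint f hf).mono_exponent le_top : MemLp f 2 μ).integrable_sq
  -- it suffices to find a rescaled function with a large deviation
  suffices h : ∃ f ∈ F, ∫ x, f x ^ 2 ∂μ ≤ 2 * r ^ 2 ∧ ∑ t ∈ S, f (D t) ^ 2 ≤ N * r ^ 2 ∧
      N * r ^ 2 / 3 < |∑ t ∈ S, f (D t) ^ 2 - N * ∫ x, f x ^ 2 ∂μ| by
    obtain ⟨f, hf, hw, hs, hdev⟩ := h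
    refine ⟨f, hf, half_le_of_compl_le ?_⟩
    set w := ∫ x, f x ^ 2 ∂μ with hwdef
    have hw0 : 0 ≤ w := integral_nonneg fun x => sq_nonneg _
    have hcheb := measure_abs_sum_sub_ge_le ν S μ hμ (u := fun x => f x ^ 2)
      (((memLp_top_of_bound ((hFm f hf).pow_const 2).aestronglyMeasurable (c ^ 2) (by
        filter_upwards [compl_mem_ae_iff.2 hΩ₀μ] with x hx
        rw [Real.norm_eq_abs, abs_pow]
        exact pow_le_pow_left₀ (abs_nonneg _) (hFc f hf x (not_not.1 hx)) 2)).mono_exponent le_top))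
      ((hFm f hf).pow_const 2) (τ := N * r ^ 2 / 6) (by positivity)
    refine (measure_mono (t := {D' | N * r ^ 2 / 6 ≤
      |∑ t ∈ S, f (D' t) ^ 2 - N * w|} ∪ {D' | ¬ ∀ t, D' t ∈ Ω₀}) ?_).trans
      ((measure_union_le _ _).trans ?_)
    · intro D' hD'
      by_contra hcon
      simp only [Set.mem_union, Set.mem_ofPred_eq, not_or, not_le, not_not] at hcon
      obtain ⟨h1, h2⟩ := hcon
      refine hD' ⟨h2, ?_, ?_⟩
      · rw [Finset.sum_add_distrib]
        have := (abs_lt.1 h1).2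
        nlinarith
      -- The data deviate by more than Nr²/3 and the ghost sample by less than Nr²/6, so they differ
      -- by more than Nr²/6, which exceeds 232qNr² for q ≤ 1/1400.
      · have h3 : 29 * q * (2 * c) * (4 * (N * r ^ 2)) / c = 232 * q * (N * r ^ 2) := by
          field_simp
          ring
        rw [h3, Finset.sum_sub_distrib, abs_sub_comm]
        have h4 : N * r ^ 2 / 3 < |∑ t ∈ S, f (D t) ^ 2 - ∑ t ∈ S, f (D' t) ^ 2| +
            |∑ t ∈ S, f (D' t) ^ 2 - N * w| := hdev.trans_le (abs_sub_le _ _ _)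
        nlinarith
    · rw [measure_exists_notMem ν hΩ₀ν, add_zero]
      refine hcheb.trans ?_
      rw [← ENNReal.ofReal_one, ← ENNReal.ofReal_ofNat 2, ← ENNReal.ofReal_div_of_pos two_pos]
      refine ENNReal.ofReal_le_ofReal ?_
      have h4 : ∫ x, (f x ^ 2) ^ 2 ∂μ ≤ c ^ 2 * w := by
        rw [hwdef, ← integral_const_mul]
        refine integral_mono_of_nonneg (ae_of_all _ fun x => sq_nonneg _) ((hsq f hf).const_mul _) ?_
        filter_upwards [compl_mem_ae_iff.2 hΩ₀μ] with x hx
        have := pow_le_pow_left₀ (abs_nonneg _) (hFc f hf x (not_not.1 hx)) 2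
        rw [sq_abs] at this
        nlinarith [sq_nonneg (f x)]
      -- Chebyshev gives 72c²/(Nr²), at most 1/2 because 144c² ≤ Nr².
      rw [div_le_iff₀ (by positivity)]
      have h5 : N * ∫ x, (f x ^ 2) ^ 2 ∂μ ≤ N * (c ^ 2 * (2 * r ^ 2)) :=
        mul_le_mul_of_nonneg_left (h4.trans (mul_le_mul_of_nonneg_left hw (sq_nonneg c))) hN0.le
      nlinarith [mul_le_mul_of_nonneg_right hN hNr.le]
  set w := ∫ x, f x ^ 2 ∂μ with hwdef
  set s := ∑ t ∈ S, f (D t) ^ 2 with hsdef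
  have hw0 : 0 ≤ w := integral_nonneg fun x => sq_nonneg _
  have hs0 : 0 ≤ s := Finset.sum_nonneg fun t _ => sq_nonneg _
  have hscale : ∀ k : ℝ, 0 ≤ k → k ≤ 1 → (fun x => √k * f x) ∈ F ∧
      ∫ x, (√k * f x) ^ 2 ∂μ = k * w ∧ ∑ t ∈ S, (√k * f (D t)) ^ 2 = k * s := by
    intro k h0 h1
    refine ⟨?_, ?_, ?_⟩
    · have := starConvex_zero_iff.1 hFs hf (Real.sqrt_nonneg k) (Real.sqrt_le_one.2 h1)
      exact this
    · simp_rw [mul_pow, Real.sq_sqrt h0]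
      rw [integral_const_mul]
    · simp_rw [mul_pow, Real.sq_sqrt h0]
      rw [← Finset.mul_sum]
  rcases lt_abs.1 hdev with h | h
  -- Upward deviation: scaling the empirical sum to exactly Nr² brings N times the population square
  -- norm below 2Nr²/3, a gap of Nr²/3.
  · have hs : N * (3 / 2 * w + r ^ 2) < s := by linarith
    have hspos : 0 < s := lt_of_le_of_lt (by positivity) hs
    obtain ⟨h1, h2, h3⟩ := hscale (N * r ^ 2 / s) (by positivity)
      ((div_le_one hspos).2 (by nlinarith [mul_nonneg hN0.le hw0]))
    have hks : N * r ^ 2 / s * s = N * r ^ 2 := div_mul_cancel₀ _ hspos.ne'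
    have hk0 : 0 < N * r ^ 2 / s := by positivity
    have hkw : N * (N * r ^ 2 / s * w) < 2 / 3 * (N * r ^ 2) := by
      have := mul_lt_mul_of_pos_left hs hk0
      rw [hks] at this
      nlinarith [mul_pos hk0 hNr]
    refine ⟨_, h1, ?_, ?_, ?_⟩
    · rw [h2]
      by_contra hcon
      have := mul_lt_mul_of_pos_left (not_le.1 hcon) hN0
      nlinarith
    · rw [h3, hks]
    · rw [h2, h3, hks, lt_abs]
      left
      linarith
  -- Downward deviation: scaling the population square norm to exactly 2r² brings the empirical sum
  -- to at most Nr².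
  · have hs : s < N * (1 / 2 * w - r ^ 2) := by linarith
    have hwr : 2 * r ^ 2 < w := by
      have : 0 < 1 / 2 * w - r ^ 2 := pos_of_mul_pos_right (lt_of_le_of_lt hs0 hs) hN0.le
      linarith
    have hwpos : 0 < w := lt_of_le_of_lt (by positivity) hwr
    obtain ⟨h1, h2, h3⟩ := hscale (2 * r ^ 2 / w) (by positivity)
      ((div_le_one hwpos).2 hwr.le)
    have hkw : 2 * r ^ 2 / w * w = 2 * r ^ 2 := div_mul_cancel₀ _ hwpos.ne'
    have hk0 : 0 < 2 * r ^ 2 / w := by positivity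
    have hks : 2 * r ^ 2 / w * s ≤ N * r ^ 2 := by
      have := mul_lt_mul_of_pos_left hs hk0
      have h5 : 2 * r ^ 2 / w * (N * (1 / 2 * w - r ^ 2)) =
          N * (1 / 2 * (2 * r ^ 2 / w * w)) - 2 * r ^ 2 / w * (N * r ^ 2) := by ring
      rw [h5, hkw] at this
      nlinarith [mul_pos hk0 hNr]
    refine ⟨_, h1, ?_, ?_, ?_⟩
    · rw [h2, hkw]
    · rw [h3]
      exact hks
    · rw [h2, h3, hkw, lt_abs]
      right
      linarith

/-- Deviations of the means of the functions in a star-shaped class, on the event where the square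
norms are comparable. -/
theorem measure_mean_deviation_le (hμ : ∀ t ∈ S, ν t = μ) {F : Set (Ω → ℝ)}
    (hF : PointwiseSeparable F) (hFm : ∀ f ∈ F, Measurable f) (hF0 : (0 : Ω → ℝ) ∈ F)
    (hFs : StarConvex ℝ 0 F) {Ω₀ : Set Ω} (hΩ₀ : MeasurableSet Ω₀) (hΩ₀ν : ∀ t, ν t Ω₀ᶜ = 0)
    (hΩ₀μ : μ Ω₀ᶜ = 0) {c q r : ℝ} (hc : 0 < c) (hq : 0 < q) (hqc : q ≤ c / 300) (hr : 0 < r)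
    (hFc : ∀ f ∈ F, ∀ x ∈ Ω₀, |f x| ≤ c) (hN : 144 * c ^ 2 ≤ S.card * r ^ 2)
    (hN' : 16 ≤ S.card * r ^ 2) :
    Measure.pi ν {D | (∀ t, D t ∈ Ω₀) ∧
      radClass S F (4 * (S.card * r ^ 2)) D ≤ q * (4 * (S.card * r ^ 2)) / c ∧
      (∀ f ∈ F, |∑ t ∈ S, f (D t) ^ 2 - S.card * ∫ x, f x ^ 2 ∂μ| ≤
        S.card * (1 / 2 * ∫ x, f x ^ 2 ∂μ + r ^ 2)) ∧
      ∃ f ∈ F, S.card * (r * (√(∫ x, f x ^ 2 ∂μ) + r)) <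
        |∑ t ∈ S, f (D t) - S.card * ∫ x, f x ∂μ|} ≤
      4 * ENNReal.ofReal (Real.exp (-(q ^ 2 * (4 * (S.card * r ^ 2)) / c ^ 2))) := by
  set N : ℝ := (S.card : ℝ) with hNdef
  have hNr : 0 < N * r ^ 2 := lt_of_lt_of_le (by positivity) hN
  have hN0 : 0 < N := pos_of_mul_pos_left hNr (sq_nonneg r)
  -- For square norm at most r², comparability bounds the data sum by 5Nr²/2, so B = 4Nr² leaves
  -- room for the ghost sample. The threshold 116qNr²/c is at most Nr²/2 since q ≤ c/300.
  refine le_trans (measure_mono ?_) (measure_ghost_le ν S hF hFm hF0 hΩ₀ (φ := fun x => x)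
    (by fun_prop) (ℓ := 1) (by positivity) hc hq (B := 4 * (N * r ^ 2)) (by positivity) hFc
    (by simp) (fun x y hx hy => by simp))
  rintro D ⟨hD, hrad, hsq', f, hf, hdev⟩
  refine ⟨hD, hrad, ?_⟩
  have hint : ∀ f ∈ F, MemLp f ∞ μ := fun f hf =>
    memLp_top_of_bound (hFm f hf).aestronglyMeasurable c (by
      filter_upwards [compl_mem_ae_iff.2 hΩ₀μ] with x hx
      exact hFc f hf x (not_not.1 hx))
  have hint2 : ∀ f ∈ F, MemLp f 2 μ := fun f hf => (hint f hf).mono_exponent le_top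
  have hsq : ∀ f ∈ F, Integrable (fun x => f x ^ 2) μ := fun f hf => (hint2 f hf).integrable_sq
  suffices h : ∃ f ∈ F, ∫ x, f x ^ 2 ∂μ ≤ r ^ 2 ∧
      N * r ^ 2 < |∑ t ∈ S, f (D t) - N * ∫ x, f x ∂μ| by
    obtain ⟨f, hf, hw, hdev⟩ := h
    refine ⟨f, hf, half_le_of_compl_le ?_⟩
    have hs := (abs_le.1 (hsq' f hf)).2
    set w := ∫ x, f x ^ 2 ∂μ with hwdef
    have hw0 : 0 ≤ w := integral_nonneg fun x => sq_nonneg _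
    have hcheb := measure_abs_sum_sub_ge_le ν S μ hμ (u := fun x => f x ^ 2)
      (((memLp_top_of_bound ((hFm f hf).pow_const 2).aestronglyMeasurable (c ^ 2) (by
        filter_upwards [compl_mem_ae_iff.2 hΩ₀μ] with x hx
        rw [Real.norm_eq_abs, abs_pow]
        exact pow_le_pow_left₀ (abs_nonneg _) (hFc f hf x (not_not.1 hx)) 2)).mono_exponent le_top))
      ((hFm f hf).pow_const 2) (τ := N * r ^ 2 / 6) (by positivity)
    have hcheb' := measure_abs_sum_sub_ge_le ν S μ hμ (hint2 f hf) (hFm f hf)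
      (τ := N * r ^ 2 / 2) (by positivity)
    refine (measure_mono (t := ({D' | N * r ^ 2 / 6 ≤
      |∑ t ∈ S, f (D' t) ^ 2 - N * w|} ∪ {D' | N * r ^ 2 / 2 ≤
      |∑ t ∈ S, f (D' t) - N * ∫ x, f x ∂μ|}) ∪ {D' | ¬ ∀ t, D' t ∈ Ω₀}) ?_).trans
      ((measure_union_le _ _).trans ?_)
    · intro D' hD'
      by_contra hcon
      simp only [Set.mem_union, Set.mem_ofPred_eq, not_or, not_le, not_not] at hcon
      obtain ⟨⟨h1, h1'⟩, h2⟩ := hcon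
      refine hD' ⟨h2, ?_, ?_⟩
      · rw [Finset.sum_add_distrib]
        have := (abs_lt.1 h1).2
        nlinarith
      · have h3 : 29 * q * 1 * (4 * (N * r ^ 2)) / c ≤ N * r ^ 2 / 2 := by
          rw [div_le_iff₀ hc]
          nlinarith
        rw [Finset.sum_sub_distrib, abs_sub_comm]
        have h4 : N * r ^ 2 < |∑ t ∈ S, f (D t) - ∑ t ∈ S, f (D' t)| +
            |∑ t ∈ S, f (D' t) - N * ∫ x, f x ∂μ| := hdev.trans_le (abs_sub_le _ _ _)
        linarith
    · rw [measure_exists_notMem ν hΩ₀ν, add_zero]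
      refine (measure_union_le _ _).trans ((add_le_add hcheb hcheb').trans ?_)
      rw [← ENNReal.ofReal_add (by positivity) (by positivity),
        ← ENNReal.ofReal_one, ← ENNReal.ofReal_ofNat 2, ← ENNReal.ofReal_div_of_pos two_pos]
      refine ENNReal.ofReal_le_ofReal ?_
      have h4 : ∫ x, (f x ^ 2) ^ 2 ∂μ ≤ c ^ 2 * w := by
        rw [hwdef, ← integral_const_mul]
        refine integral_mono_of_nonneg (ae_of_all _ fun x => sq_nonneg _) ((hsq f hf).const_mul _) ?_
        filter_upwards [compl_mem_ae_iff.2 hΩ₀μ] with x hx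
        have := pow_le_pow_left₀ (abs_nonneg _) (hFc f hf x (not_not.1 hx)) 2
        rw [sq_abs] at this
        nlinarith [sq_nonneg (f x)]
      have h5 : N * ∫ x, (f x ^ 2) ^ 2 ∂μ ≤ N * (c ^ 2 * r ^ 2) :=
        mul_le_mul_of_nonneg_left (h4.trans (mul_le_mul_of_nonneg_left hw (sq_nonneg c))) hN0.le
      have h6 : N * (∫ x, (f x ^ 2) ^ 2 ∂μ) / (N * r ^ 2 / 6) ^ 2 ≤ 1 / 4 := by
        rw [div_le_iff₀ (by positivity)]
        nlinarith [mul_le_mul_of_nonneg_right hN hNr.le]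
      have h7 : N * w / (N * r ^ 2 / 2) ^ 2 ≤ 1 / 4 := by
        rw [div_le_iff₀ (by positivity)]
        nlinarith [mul_le_mul_of_nonneg_right hN' hNr.le, mul_le_mul_of_nonneg_left hw hN0.le]
      linarith
  set w := ∫ x, f x ^ 2 ∂μ with hwdef
  have hw0 : 0 ≤ w := integral_nonneg fun x => sq_nonneg _
  rcases le_or_gt w (r ^ 2) with hw | hw
  · refine ⟨f, hf, hw, lt_of_le_of_lt ?_ hdev⟩
    nlinarith [mul_nonneg hN0.le (mul_nonneg hr.le (Real.sqrt_nonneg w))]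
  · have hwpos : 0 < √w := Real.sqrt_pos.2 (lt_of_le_of_lt (sq_nonneg r) hw)
    have hrw : r < √w := Real.lt_sqrt_of_sq_lt hw
    -- Scaling to norm exactly r turns the bound Nr(√w + r) into Nr² + kNr², which is still above
    -- Nr².
    set k := r / √w with hk
    have hk0 : 0 < k := by positivity
    have hkw : k * √w = r := div_mul_cancel₀ _ hwpos.ne'
    have hk1 : k ≤ 1 := (div_le_one hwpos).2 hrw.le
    refine ⟨fun x => k * f x, starConvex_zero_iff.1 hFs hf hk0.le hk1, ?_, ?_⟩
    · simp_rw [mul_pow]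
      rw [integral_const_mul, ← hwdef, ← Real.sq_sqrt hw0, ← mul_pow, hkw]
    · rw [integral_const_mul, ← Finset.mul_sum, mul_left_comm, ← mul_sub, abs_mul,
        abs_of_pos hk0]
      refine lt_of_le_of_lt ?_ (mul_lt_mul_of_pos_left hdev hk0)
      have : k * (N * (r * (√w + r))) = N * r * (k * √w) + N * r ^ 2 * k := by ring
      rw [this, hkw]
      nlinarith [mul_pos hNr hk0]

end Concentration


/-! ### Concentration on the subsamples -/

section Subsamples

lemma pi_smul_measure {ι : Type*} [Fintype ι] {Ω : Type*} [MeasurableSpace Ω] (c : ι → ℝ≥0∞)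
    (hc : ∀ i, c i ≠ ∞) (ν : ι → Measure Ω) [∀ i, IsFiniteMeasure (ν i)] :
    Measure.pi (fun i => c i • ν i) = (∏ i, c i) • Measure.pi ν := by
  have : ∀ i, IsFiniteMeasure (c i • ν i) := fun i => Measure.smul_finite _ (hc i)
  refine Measure.pi_eq fun s hs => ?_
  simp only [Measure.smul_apply, Measure.pi_pi, smul_eq_mul, Finset.prod_mul_distrib]

variable {𝒰 𝒳 𝒵 𝒲 𝒜 : Type*}

/-- The set of trials in the `t`-th coordinate whose subsample of the `k`-th equation is `S`. -/
def cellSet {T : ℕ} (k : Fin 4) (S : Finset (Fin T)) (t : Fin T) : Set (Trial 𝒰 𝒳 𝒵 𝒲 𝒜) :=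
  if t ∈ S then pattern k else (pattern k)ᶜ

lemma mem_cell_iff {T : ℕ} (k : Fin 4) (S : Finset (Fin T)) (D : Fin T → Trial 𝒰 𝒳 𝒵 𝒲 𝒜) :
    D ∈ Set.univ.pi (cellSet k S) ↔ subIdx D k = S := by
  simp only [Set.mem_univ_pi, cellSet, subIdx, Finset.ext_iff, Finset.mem_filter, Finset.mem_univ,
    true_and]
  refine forall_congr' fun t => ?_
  split_ifs with h <;> simp [h]

lemma empNorm_le_iff {T : ℕ} (D : Fin T → Trial 𝒰 𝒳 𝒵 𝒲 𝒜) (k : Fin 4)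
    (f : Trial 𝒰 𝒳 𝒵 𝒲 𝒜 → ℝ) {δ : ℝ} (hδ : 0 ≤ δ) (hN : 0 < subSize D k) :
    empNorm D k f ≤ δ ↔ ∑ t ∈ subIdx D k, f (D t) ^ 2 ≤ subSize D k * δ ^ 2 := by
  unfold empNorm empMean
  rw [Real.sqrt_le_left hδ, div_le_iff₀ (by exact_mod_cast hN), mul_comm]

/-- The localized Rademacher complexity of a star-shaped class grows at most linearly. -/
lemma radClass_le_of_isCriticalRadius {T : ℕ} (D : Fin T → Trial 𝒰 𝒳 𝒵 𝒲 𝒜) (k : Fin 4)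
    {F : Set (Trial 𝒰 𝒳 𝒵 𝒲 𝒜 → ℝ)} (hF0 : (0 : Trial 𝒰 𝒳 𝒵 𝒲 𝒜 → ℝ) ∈ F)
    (hFs : StarConvex ℝ 0 F) {c δ ρ : ℝ} (hFc : ∀ f ∈ F, ∀ t, |f (D t)| ≤ c)
    (hN : 0 < subSize D k) (hδ : IsCriticalRadius D k F c δ) (hδρ : δ ≤ ρ) :
    radClass (subIdx D k) F (subSize D k * ρ ^ 2) D ≤ subSize D k * (ρ * δ) / c := by
  obtain ⟨hδ0, hδ1⟩ := hδ
  have hρ : 0 < ρ := hδ0.trans_le hδρ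
  have hN' : (0 : ℝ) < subSize D k := by exact_mod_cast hN
  have hrad : radClass (subIdx D k) F (subSize D k * ρ ^ 2) D ≤
      ρ / δ * subSize D k * rademacher D k F δ := by
    unfold radClass rademacher
    change _ ≤ ρ / δ * subSize D k * signAvg _
    rw [← signAvg_const_mul]
    have : Nonempty {f : Trial 𝒰 𝒳 𝒵 𝒲 𝒜 → ℝ //
        f ∈ F ∧ ∑ t ∈ subIdx D k, f (D t) ^ 2 ≤ subSize D k * ρ ^ 2} :=
      ⟨⟨0, hF0, by simpa using by positivity⟩⟩
    refine signAvg_mono fun ε => ciSup_le fun f => ?_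
    have hbd : BddAbove (Set.range fun f : {f : Trial 𝒰 𝒳 𝒵 𝒲 𝒜 → ℝ // f ∈ F ∧ empNorm D k f ≤ δ} =>
        (∑ t ∈ subIdx D k, (if ε t then (1 : ℝ) else -1) * f.1 (D t)) / (subSize D k : ℝ)) := by
      refine ⟨(∑ t ∈ subIdx D k, c) / subSize D k, ?_⟩
      rintro _ ⟨f, rfl⟩
      refine div_le_div_of_nonneg_right (Finset.sum_le_sum fun t _ => ?_) hN'.le
      refine (le_abs_self _).trans ?_
      rw [abs_mul, show |(if ε t then (1 : ℝ) else -1)| = 1 from abs_sgn (ε t), one_mul]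
      exact hFc _ f.2.1 t
    have hk1 : δ / ρ ≤ 1 := (div_le_one hρ).2 hδρ
    -- Shrinking by δ/ρ moves the ball of radius ρ into that of radius δ without leaving the
    -- star-shaped class.
    have hmem : (fun o => δ / ρ * f.1 o) ∈ F :=
      starConvex_zero_iff.1 hFs f.2.1 (by positivity) hk1
    have hnorm : empNorm D k (fun o => δ / ρ * f.1 o) ≤ δ := by
      rw [empNorm_le_iff D k _ hδ0.le hN]
      simp_rw [mul_pow]
      rw [← Finset.mul_sum]
      refine (mul_le_mul_of_nonneg_left f.2.2 (sq_nonneg _)).trans (le_of_eq ?_)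
      field_simp
    have h := mul_le_mul_of_nonneg_left (le_ciSup hbd ⟨_, hmem, hnorm⟩)
      (show 0 ≤ ρ / δ * subSize D k by positivity)
    refine le_trans (le_of_eq ?_) h
    simp only [mul_left_comm _ (δ / ρ)]
    rw [← Finset.mul_sum]
    unfold sgn
    field_simp
  refine hrad.trans ((mul_le_mul_of_nonneg_left hδ1 (by positivity)).trans (le_of_eq ?_))
  field_simp

variable [MeasurableSpace 𝒰] [MeasurableSpace 𝒳] [MeasurableSpace 𝒵] [MeasurableSpace 𝒲]
  [MeasurableSpace 𝒜]

lemma measurableSet_obsX : MeasurableSet (obsX : Set (Trial 𝒰 𝒳 𝒵 𝒲 𝒜)) :=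
  measurableSet_eq_fun (by fun_prop) measurable_const

lemma measurableSet_obsZ : MeasurableSet (obsZ : Set (Trial 𝒰 𝒳 𝒵 𝒲 𝒜)) :=
  measurableSet_eq_fun (by fun_prop) measurable_const

lemma measurableSet_obsW : MeasurableSet (obsW : Set (Trial 𝒰 𝒳 𝒵 𝒲 𝒜)) :=
  measurableSet_eq_fun (by fun_prop) measurable_const

lemma measurableSet_pattern (k : Fin 4) :
    MeasurableSet (pattern k : Set (Trial 𝒰 𝒳 𝒵 𝒲 𝒜)) := by
  fin_cases k
  · exact measurableSet_obsX.inter measurableSet_obsZ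
  · exact (measurableSet_obsW.inter measurableSet_obsX).inter measurableSet_obsZ
  · exact measurableSet_obsW.inter measurableSet_obsX
  · exact measurableSet_obsX

lemma measurableSet_cellSet {T : ℕ} (k : Fin 4) (S : Finset (Fin T)) (t : Fin T) :
    MeasurableSet (cellSet k S t : Set (Trial 𝒰 𝒳 𝒵 𝒲 𝒜)) := by
  unfold cellSet
  split_ifs
  exacts [measurableSet_pattern k, (measurableSet_pattern k).compl]

/-- A bound that holds, for every fixed subsample index set, under independent draws with the
conditional laws transfers to the law of the data. -/
theorem dataLaw_le_of_forall_cell (M : Model 𝒰 𝒳 𝒵 𝒲 𝒜) {T : ℕ} (k : Fin 4)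
    (Bd : Set (Fin T → Trial 𝒰 𝒳 𝒵 𝒲 𝒜)) (x : ℝ≥0∞)
    (h : ∀ S : Finset (Fin T), (∀ t, M.pOb (cellSet k S t) ≠ 0) →
      Measure.pi (fun t => ProbabilityTheory.cond M.pOb (cellSet k S t))
        (Bd ∩ {D | subIdx D k = S}) ≤ x) :
    M.dataLaw T Bd ≤ x := by
  have hcell : ∀ S : Finset (Fin T), {D : Fin T → Trial 𝒰 𝒳 𝒵 𝒲 𝒜 | subIdx D k = S} =
      Set.univ.pi (cellSet k S) := fun S => by
    ext D
    exact (mem_cell_iff k S D).symm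
  have hmeas : ∀ S : Finset (Fin T),
      MeasurableSet {D : Fin T → Trial 𝒰 𝒳 𝒵 𝒲 𝒜 | subIdx D k = S} := fun S => by
    rw [hcell]
    exact MeasurableSet.univ_pi fun t => measurableSet_cellSet k S t
  have hpart : ∀ S : Finset (Fin T), M.dataLaw T (Bd ∩ {D | subIdx D k = S}) ≤
      x * M.dataLaw T {D | subIdx D k = S} := by
    intro S
    by_cases h0 : ∀ t, M.pOb (cellSet k S t) ≠ 0
    -- Fixing the index set restrains each coordinate separately. The restricted law is thus a
    -- constant times a product law, under which the trials in `S` are independent with law `mu k`.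
    · have hfac : (M.dataLaw T).restrict {D | subIdx D k = S} =
          (∏ t, M.pOb (cellSet k S t)) •
            Measure.pi (fun t => ProbabilityTheory.cond M.pOb (cellSet k S t)) := by
        rw [hcell, Model.dataLaw, Measure.restrict_pi_pi, ← pi_smul_measure]
        · congr 1
          funext t
          rw [ProbabilityTheory.cond, smul_smul, ENNReal.mul_inv_cancel (h0 t) (measure_ne_top _ _),
            one_smul]
        · exact fun t => measure_ne_top _ _
      have hS : M.dataLaw T {D | subIdx D k = S} = ∏ t, M.pOb (cellSet k S t) := by
        rw [hcell, Model.dataLaw, Measure.pi_pi]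
      rw [hS]
      have h1 : M.dataLaw T (Bd ∩ {D | subIdx D k = S}) =
          (M.dataLaw T).restrict {D | subIdx D k = S} (Bd ∩ {D | subIdx D k = S}) := by
        rw [Measure.restrict_apply' (hmeas S), Set.inter_assoc, Set.inter_self]
      rw [h1, hfac, Measure.smul_apply, smul_eq_mul, mul_comm]
      gcongr
      exact h S h0
    · push Not at h0
      obtain ⟨t, ht⟩ := h0
      have : M.dataLaw T {D | subIdx D k = S} = 0 := by
        rw [hcell, Model.dataLaw, Measure.pi_pi]
        exact Finset.prod_eq_zero (Finset.mem_univ t) ht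
      exact (measure_mono_null Set.inter_subset_right this).le.trans zero_le
  have hcover : Bd ⊆ ⋃ S : Finset (Fin T), (Bd ∩ {D | subIdx D k = S}) := fun D hD =>
    Set.mem_iUnion.2 ⟨subIdx D k, hD, rfl⟩
  have hP : IsProbabilityMeasure (M.dataLaw T) := by
    unfold Model.dataLaw
    infer_instance
  have htot : ∑ S : Finset (Fin T), M.dataLaw T {D | subIdx D k = S} = 1 := by
    rw [← measure_biUnion_finset, ← measure_univ (μ := M.dataLaw T)]
    · congr 1
      ext D
      simp
    · intro S _ S' _ hne
      refine Set.disjoint_left.2 fun D h1 h2 => hne ?_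
      exact (show subIdx D k = S from h1).symm.trans h2
    · exact fun S _ => hmeas S
  calc M.dataLaw T Bd ≤ ∑ S : Finset (Fin T), M.dataLaw T (Bd ∩ {D | subIdx D k = S}) :=
        (measure_mono hcover).trans (measure_iUnion_fintype_le _ _)
    _ ≤ ∑ S : Finset (Fin T), x * M.dataLaw T {D | subIdx D k = S} :=
        Finset.sum_le_sum fun S _ => hpart S
    _ = x := by rw [← Finset.mul_sum, htot, mul_one]

/-- On the data `D`, empirical means and square norms over `F` are close to the population ones. -/
def UniformlyClose (M : Model 𝒰 𝒳 𝒵 𝒲 𝒜) {T : ℕ} (D : Fin T → Trial 𝒰 𝒳 𝒵 𝒲 𝒜) (k : Fin 4)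
    (F : Set (Trial 𝒰 𝒳 𝒵 𝒲 𝒜 → ℝ)) (r : ℝ) : Prop :=
  (∀ f ∈ F, |empMean D k (fun o => f o ^ 2) - ∫ o, f o ^ 2 ∂(M.mu k)| ≤
    1 / 2 * ∫ o, f o ^ 2 ∂(M.mu k) + r ^ 2) ∧
  ∀ f ∈ F, |empMean D k f - ∫ o, f o ∂(M.mu k)| ≤ r * (√(∫ o, f o ^ 2 ∂(M.mu k)) + r)

lemma mu_eq_cond_cellSet (M : Model 𝒰 𝒳 𝒵 𝒲 𝒜) {T : ℕ} (k : Fin 4) {S : Finset (Fin T)}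
    {t : Fin T} (ht : t ∈ S) : ProbabilityTheory.cond M.pOb (cellSet k S t) = M.mu k := by
  simp [cellSet, ht, Model.mu]

/-- With high probability, empirical and population quantities are close on a scale that dominates
a critical radius. -/
theorem dataLaw_not_uniformlyClose_le (M : Model 𝒰 𝒳 𝒵 𝒲 𝒜) (T : ℕ) (k : Fin 4)
    {F : Set (Trial 𝒰 𝒳 𝒵 𝒲 𝒜 → ℝ)} (hF : PointwiseSeparable F) (hFm : ∀ f ∈ F, Measurable f)
    (hF0 : (0 : Trial 𝒰 𝒳 𝒵 𝒲 𝒜 → ℝ) ∈ F) (hFs : StarConvex ℝ 0 F)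
    {Ω₀ : Set (Trial 𝒰 𝒳 𝒵 𝒲 𝒜)} (hΩ₀ : MeasurableSet Ω₀) (hΩ₀p : M.pOb Ω₀ᶜ = 0)
    {c q κ ξ η : ℝ} (hc : 0 < c) (hFc : ∀ f ∈ F, ∀ o ∈ Ω₀, |f o| ≤ c) (hq : 0 < q)
    (hq1 : q ≤ 1 / 1400) (hqc : q ≤ c / 300) (hκ1 : 1 / q ≤ κ) (hκc : c / q ≤ κ) (hξ : 0 < ξ)
    (hξ1 : ξ < 1) :
    M.dataLaw T {D | 0 < subSize D k ∧ (∃ δ, IsCriticalRadius D k F c δ ∧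
        κ * (δ + √(Real.log (16 / ξ) / (subSize D k : ℝ))) ≤ η) ∧
        ¬ UniformlyClose M D k F (η / 2)} ≤ ENNReal.ofReal (ξ / 2) := by
  refine dataLaw_le_of_forall_cell M k _ _ fun S hS => ?_
  have hprob : ∀ t, IsProbabilityMeasure (ProbabilityTheory.cond M.pOb (cellSet k S t)) := fun t =>
    cond_isProbabilityMeasure (hS t)
  set ν : Fin T → Measure (Trial 𝒰 𝒳 𝒵 𝒲 𝒜) :=
    fun t => ProbabilityTheory.cond M.pOb (cellSet k S t) with hν
  have hνΩ : ∀ t, ν t Ω₀ᶜ = 0 := fun t => cond_absolutelyContinuous hΩ₀p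
  have hL : 1 ≤ Real.log (16 / ξ) := by
    rw [Real.le_log_iff_exp_le (by positivity), le_div_iff₀ hξ]
    nlinarith [Real.exp_one_lt_d9]
  -- trivial cases: the empty subsample, or no critical radius below the bound
  rcases Set.eq_empty_or_nonempty ({D : Fin T → Trial 𝒰 𝒳 𝒵 𝒲 𝒜 | 0 < subSize D k ∧
      (∃ δ, IsCriticalRadius D k F c δ ∧
        κ * (δ + √(Real.log (16 / ξ) / (subSize D k : ℝ))) ≤ η) ∧
        ¬ UniformlyClose M D k F (η / 2)} ∩ {D | subIdx D k = S}) with hemp | ⟨D₀, hD₀, hD₀S⟩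
  · rw [hemp, measure_empty]
    exact zero_le
  -- The subsample size is constant on the cell, so a single element of the event yields the
  -- deterministic lower bound on Nη².
  obtain ⟨hN0, ⟨δ₀, hδ₀, hκη₀⟩, -⟩ := hD₀
  have hsz : ∀ D : Fin T → Trial 𝒰 𝒳 𝒵 𝒲 𝒜, subIdx D k = S → subSize D k = S.card :=
    fun D hD => by rw [subSize, hD]
  rw [hsz D₀ hD₀S] at hN0 hκη₀
  set N : ℝ := (S.card : ℝ) with hNdef
  have hN : 0 < N := by rw [hNdef]; exact_mod_cast hN0
  have hκ0 : 0 < κ := lt_of_lt_of_le (by positivity) hκ1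
  have hκbig : 1400 ≤ κ := le_trans (by rw [le_div_iff₀ hq]; linarith) hκ1
  have hκq : 1 ≤ κ * q := by rwa [div_le_iff₀ hq] at hκ1
  have hκqc : c ≤ κ * q := by rwa [div_le_iff₀ hq] at hκc
  have hη0 : 0 < η := lt_of_lt_of_le (mul_pos hκ0 (add_pos_of_pos_of_nonneg hδ₀.1
    (Real.sqrt_nonneg _))) hκη₀
  have hNη : κ ^ 2 * Real.log (16 / ξ) ≤ N * η ^ 2 := by
    have h1 : κ * √(Real.log (16 / ξ) / N) ≤ η :=
      le_trans (mul_le_mul_of_nonneg_left (le_add_of_nonneg_left hδ₀.1.le) hκ0.le) hκη₀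
    have h2 := pow_le_pow_left₀ (by positivity) h1 2
    rw [mul_pow, Real.sq_sqrt (by positivity)] at h2
    calc κ ^ 2 * Real.log (16 / ξ) = N * (κ ^ 2 * (Real.log (16 / ξ) / N)) := by field_simp
      _ ≤ N * η ^ 2 := mul_le_mul_of_nonneg_left h2 hN.le
  have hNη' : κ ^ 2 ≤ N * η ^ 2 := le_trans (le_mul_of_one_le_right (sq_nonneg κ) hL) hNη
  have hNc : 144 * c ^ 2 ≤ N * (η / 2) ^ 2 := by
    have hκc' : 24 * c ≤ κ := by nlinarith
    nlinarith
  have hN16 : 16 ≤ N * (η / 2) ^ 2 := by nlinarith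
  -- With r = η/2 the localization level B of the deviation bounds is Nη², that is, empirical norm
  -- η.
  have h4 : 4 * (N * (η / 2) ^ 2) = N * η ^ 2 := by ring
  -- As κq ≥ c, the exponent is at least log(16/ξ) in size. Each deviation bound becomes 4 · ξ/16,
  -- and the two add up to ξ/2.
  have hexp : Real.exp (-(q ^ 2 * (4 * (N * (η / 2) ^ 2)) / c ^ 2)) ≤ ξ / 16 := by
    have : ξ / 16 = Real.exp (-Real.log (16 / ξ)) := by
      rw [Real.exp_neg, Real.exp_log (by positivity), inv_div]
    rw [this, Real.exp_le_exp, neg_le_neg_iff, h4, le_div_iff₀ (by positivity)]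
    calc Real.log (16 / ξ) * c ^ 2 ≤ Real.log (16 / ξ) * (κ * q) ^ 2 := by gcongr
      _ = q ^ 2 * (κ ^ 2 * Real.log (16 / ξ)) := by ring
      _ ≤ q ^ 2 * (N * η ^ 2) := by gcongr
  have hne : S.Nonempty := Finset.card_pos.1 hN0
  obtain ⟨t₀, ht₀⟩ := hne
  have hμP : IsProbabilityMeasure (M.mu k) := by
    rw [← mu_eq_cond_cellSet M k ht₀]
    exact hprob t₀
  have hμΩ : M.mu k Ω₀ᶜ = 0 := cond_absolutelyContinuous hΩ₀p
  have b1 := measure_sq_norm_deviation_le ν S (M.mu k) (fun t ht => mu_eq_cond_cellSet M k ht) hF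
    hFm hF0 hFs hΩ₀ hνΩ hμΩ hc hq hq1 (half_pos hη0) hFc hNc
  have b2 := measure_mean_deviation_le ν S (M.mu k) (fun t ht => mu_eq_cond_cellSet M k ht) hF
    hFm hF0 hFs hΩ₀ hνΩ hμΩ hc hq hqc (half_pos hη0) hFc hNc hN16
  have b0 := measure_exists_notMem ν hνΩ
  refine (measure_mono (fun D hD => ?_)).trans ((measure_union_le _ _).trans
    ((add_le_add (measure_union_le _ _) le_rfl).trans
      ((add_le_add (add_le_add b1 b2) b0.le).trans ?_)))
  · obtain ⟨⟨-, ⟨δ, hδ, hκη⟩, hnot⟩, hDS⟩ := hD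
    have hDS' : subIdx D k = S := hDS
    by_contra hcon
    simp only [Set.mem_union, not_or] at hcon
    obtain ⟨⟨hc1, hc2⟩, hc3⟩ := hcon
    have hDΩ : ∀ t, D t ∈ Ω₀ := not_not.1 hc3
    have hδη : δ ≤ q * η := by
      have h1 : κ * δ ≤ η :=
        le_trans (mul_le_mul_of_nonneg_left (le_add_of_nonneg_right (Real.sqrt_nonneg _)) hκ0.le) hκη
      nlinarith [mul_le_mul_of_nonneg_left h1 hq.le, hδ.1]
    have hrad := radClass_le_of_isCriticalRadius D k hF0 hFs (fun f hf t => hFc f hf _ (hDΩ t))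
      (by rw [hsz D hDS']; exact hN0) hδ (ρ := η) (by nlinarith)
    rw [hDS', hsz D hDS', ← hNdef] at hrad
    have hrad' : radClass S F (4 * (N * (η / 2) ^ 2)) D ≤ q * (4 * (N * (η / 2) ^ 2)) / c := by
      rw [h4]
      refine hrad.trans (div_le_div_of_nonneg_right ?_ hc.le)
      nlinarith [mul_le_mul_of_nonneg_left hδη (mul_nonneg hN.le hη0.le)]
    have hi : ∀ f ∈ F, |∑ t ∈ S, f (D t) ^ 2 - N * ∫ o, f o ^ 2 ∂(M.mu k)| ≤
        N * (1 / 2 * ∫ o, f o ^ 2 ∂(M.mu k) + (η / 2) ^ 2) := fun f hf => by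
      by_contra h
      exact hc1 ⟨hDΩ, hrad', f, hf, not_le.1 h⟩
    have hii : ∀ f ∈ F, |∑ t ∈ S, f (D t) - N * ∫ o, f o ∂(M.mu k)| ≤
        N * (η / 2 * (√(∫ o, f o ^ 2 ∂(M.mu k)) + η / 2)) := fun f hf => by
      by_contra h
      exact hc2 ⟨hDΩ, hrad', hi, f, hf, not_le.1 h⟩
    have hconv : ∀ a b C : ℝ, |a - N * b| ≤ N * C → |a / N - b| ≤ C := fun a b C h => by
      have : a / N - b = (a - N * b) / N := by field_simp
      rw [this, abs_div, abs_of_pos hN, div_le_iff₀ hN, mul_comm C]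
      exact h
    refine hnot ⟨fun f hf => ?_, fun f hf => ?_⟩
    · rw [empMean, hDS', hsz D hDS']
      exact hconv _ _ _ (hi f hf)
    · rw [empMean, hDS', hsz D hDS']
      exact hconv _ _ _ (hii f hf)
  · rw [add_zero, ← add_mul]
    refine (mul_le_mul_right (ENNReal.ofReal_le_ofReal hexp) _).trans (le_of_eq ?_)
    have : (4 + 4 : ℝ≥0∞) = ENNReal.ofReal 8 := by
      rw [ENNReal.ofReal_ofNat]
      norm_num
    rw [this, ← ENNReal.ofReal_mul (by norm_num)]
    congr 1
    ring

end Subsamples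


/-! ### Changes of measure -/

section ChangeOfMeasure

lemma map_withDensity_comp {E S : Type*} [MeasurableSpace E] [MeasurableSpace S] (μ : Measure E)
    {V : E → S} (hV : Measurable V) {f : S → ℝ≥0∞} (hf : Measurable f) :
    (μ.withDensity fun e => f (V e)).map V = (μ.map V).withDensity f := by
  ext s hs
  rw [Measure.map_apply hV hs, withDensity_apply _ (hV hs), withDensity_apply _ hs,
    setLIntegral_map hs hf hV]

lemma withDensity_compProd {E S : Type*} [MeasurableSpace E] [MeasurableSpace S] (μ : Measure E)
    [SFinite μ] (κ : Kernel E S) [IsSFiniteKernel κ] {f : E → ℝ≥0∞} (hf : Measurable f)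
    [SFinite (μ.withDensity f)] :
    (μ.withDensity f) ⊗ₘ κ = (μ ⊗ₘ κ).withDensity fun p => f p.1 := by
  ext s hs
  have hfs : Measurable fun p : E × S => f p.1 := hf.comp measurable_fst
  rw [Measure.compProd_apply hs, withDensity_apply _ hs,
    lintegral_withDensity_eq_lintegral_mul _ hf (Kernel.measurable_kernel_prodMk_left hs),
    ← lintegral_indicator hs, Measure.lintegral_compProd (hfs.indicator hs)]
  refine lintegral_congr fun x => ?_
  have : (fun y => s.indicator (fun p : E × S => f p.1) (x, y)) =
      (Prod.mk x ⁻¹' s).indicator fun _ => f x := by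
    funext y
    simp only [Set.indicator]
    rfl
  rw [this, lintegral_indicator (measurable_prodMk_left hs), setLIntegral_const, Pi.mul_apply]

/-- Reweighting by the ratio of the laws of `V` undoes a density that is a function of `V`. -/
lemma withDensity_rnDeriv_comp {E S : Type*} [MeasurableSpace E] [MeasurableSpace S]
    (ν ν' : Measure E) [IsFiniteMeasure ν] [IsFiniteMeasure ν'] {V : E → S} (hV : Measurable V)
    {D β : S → ℝ≥0∞} (hD : Measurable D) (hβ : Measurable β)
    (hν' : ν' = ν.withDensity fun e => D (V e)) (ρ : Measure S) [IsFiniteMeasure ρ]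
    (hρ : ρ = (ν.map V).withDensity β) (hac : ρ ≪ ν'.map V) :
    ν'.withDensity (fun e => ρ.rnDeriv (ν'.map V) (V e)) = ν.withDensity fun e => β (V e) := by
  set r := ρ.rnDeriv (ν'.map V) with hr
  have hrm : Measurable r := Measure.measurable_rnDeriv _ _
  have h1 : ν'.map V = (ν.map V).withDensity D := by rw [hν', map_withDensity_comp ν hV hD]
  have h2 : (ν.map V).withDensity (D * r) = (ν.map V).withDensity β := by
    rw [withDensity_mul _ hD hrm, ← h1, Measure.withDensity_rnDeriv_eq _ _ hac, hρ]
  -- Equal weighted measures have almost everywhere equal densities because `ρ` is finite.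
  have h3 : D * r =ᵐ[ν.map V] β := by
    refine (withDensity_eq_iff (hD.mul hrm).aemeasurable hβ.aemeasurable ?_).1 h2
    rw [← setLIntegral_univ, ← withDensity_apply _ MeasurableSet.univ, h2, ← hρ]
    exact measure_ne_top _ _
  have h4 : (ν.withDensity fun e => D (V e)).withDensity (fun e => r (V e)) =
      ν.withDensity fun e => β (V e) :=
    (withDensity_mul ν (hD.comp hV) (hrm.comp hV)).symm.trans
      (withDensity_congr_ae (ae_of_ae_map hV.aemeasurable h3))
  rw [← h4, ← hν']

lemma map_fst_restrict_compProd {E S : Type*} [MeasurableSpace E] [MeasurableSpace S]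
    (ν : Measure E) [SFinite ν] (κ : Kernel E S) [IsSFiniteKernel κ] {s : Set S}
    (hs : MeasurableSet s) :
    ((ν ⊗ₘ κ).restrict (Prod.snd ⁻¹' s)).map Prod.fst = ν.withDensity fun q => κ q s := by
  ext t ht
  rw [Measure.map_apply measurable_fst ht, Measure.restrict_apply (measurable_fst ht),
    withDensity_apply _ ht, ← Set.prod_eq, Measure.compProd_apply_prod ht hs]

/-- The tower property for a regular conditional distribution. -/
lemma integral_condDistrib_tower {Ω K β : Type*} [MeasurableSpace Ω] [MeasurableSpace K]
    [MeasurableSpace β] [StandardBorelSpace β] [Nonempty β] (P : Measure Ω) [IsFiniteMeasure P]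
    {k : Ω → K} {f : Ω → β} (hk : Measurable k) (hf : Measurable f) {F : K × β → ℝ}
    (hFm : Measurable F) (hF : Integrable (fun ω => F (k ω, f ω)) P) :
    Integrable (fun ω => ∫ z, F (k ω, z) ∂(condDistrib f k P (k ω))) P ∧
    ∫ ω, F (k ω, f ω) ∂P = ∫ ω, ∫ z, F (k ω, z) ∂(condDistrib f k P (k ω)) ∂P := by
  have hmap : (P.map k) ⊗ₘ condDistrib f k P = P.map fun ω => (k ω, f ω) :=
    compProd_map_condDistrib hf.aemeasurable
  have hFi : Integrable F ((P.map k) ⊗ₘ condDistrib f k P) := by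
    rw [hmap]
    exact (integrable_map_measure hFm.aestronglyMeasurable (hk.prodMk hf).aemeasurable).2 hF
  have hm : StronglyMeasurable fun c => ∫ z, F (c, z) ∂(condDistrib f k P c) :=
    hFm.stronglyMeasurable.integral_kernel_prod_right'
  have hFi' : Integrable F ((Kernel.const Unit (P.map k) ⊗ₖ
    Kernel.prodMkLeft Unit (condDistrib f k P)) ()) := hFi
  refine ⟨(integrable_map_measure hm.aestronglyMeasurable hk.aemeasurable).1
    hFi'.integral_compProd, ?_⟩
  rw [← integral_map hk.aemeasurable hm.aestronglyMeasurable, ← Measure.integral_compProd hFi, hmap,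
    integral_map (hk.prodMk hf).aemeasurable hFm.aestronglyMeasurable]

/-- The tower property under conditional independence: the conditional distribution of `f` given
`k` and `g` only depends on `k`. -/
lemma integral_condDistrib_tower_of_condIndepFun {Ω K β γ : Type*} [MeasurableSpace Ω]
    [StandardBorelSpace Ω] [MeasurableSpace K] [MeasurableSpace β] [StandardBorelSpace β]
    [Nonempty β] [MeasurableSpace γ] [StandardBorelSpace γ] [Nonempty γ]
    (P : Measure Ω) [IsFiniteMeasure P] {k : Ω → K} {f : Ω → β} {g : Ω → γ} (hk : Measurable k)
    (hf : Measurable f) (hg : Measurable g)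
    (hci : CondIndepFun (MeasurableSpace.comap k inferInstance) hk.comap_le f g P)
    {F : (K × γ) × β → ℝ} (hFm : Measurable F)
    (hF : Integrable (fun ω => F ((k ω, g ω), f ω)) P) :
    ∫ ω, F ((k ω, g ω), f ω) ∂P =
      ∫ ω, ∫ z, F ((k ω, g ω), z) ∂(condDistrib f k P (k ω)) ∂P := by
  have h := (condIndepFun_iff_condDistrib_prod_ae_eq_prodMkRight hf hg hk).1 hci.symm
  rw [(integral_condDistrib_tower P (hk.prodMk hg) hf hFm hF).2]
  refine integral_congr_ae ?_
  filter_upwards [ae_of_ae_map (hk.prodMk hg).aemeasurable h] with ω hω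
  simp only [hω, Kernel.prodMkRight_apply]

end ChangeOfMeasure

/-! ### The conditional laws of the observed variables -/

section Laws

variable {𝒰 𝒳 𝒵 𝒲 𝒜 : Type*} [MeasurableSpace 𝒰] [MeasurableSpace 𝒳] [MeasurableSpace 𝒵]
  [MeasurableSpace 𝒲] [MeasurableSpace 𝒜]

/-- The observational law of `((X, (U, Z, W)), A)`. -/
noncomputable def Model.actLaw (M : Model 𝒰 𝒳 𝒵 𝒲 𝒜) : Measure ((𝒳 × (𝒰 × 𝒵 × 𝒲)) × 𝒜) :=
  (M.pX ⊗ₘ M.kO) ⊗ₘ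
      M.piOb.comap (fun q : 𝒳 × (𝒰 × 𝒵 × 𝒲) => (q.2.1, q.1, q.2.2.1)) (by fun_prop)

/-- The mechanism of the reward. -/
noncomputable def Model.rewKernel (M : Model 𝒰 𝒳 𝒵 𝒲 𝒜) :
    Kernel ((𝒳 × (𝒰 × 𝒵 × 𝒲)) × 𝒜) ℝ :=
  M.kY.comap (fun q : (𝒳 × (𝒰 × 𝒵 × 𝒲)) × 𝒜 => (q.1.2.1, q.1.1, q.1.2.2.2, q.2))
        (by fun_prop)

/-- The mechanism of the missingness indicators. -/
noncomputable def Model.missKernel (M : Model 𝒰 𝒳 𝒵 𝒲 𝒜) :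
    Kernel (((𝒳 × (𝒰 × 𝒵 × 𝒲)) × 𝒜) × ℝ) (Bool × Bool × Bool) :=
  ((M.rX.comap (fun q : ((𝒳 × (𝒰 × 𝒵 × 𝒲)) × 𝒜) × ℝ => q.1.1.1) (by fun_prop)) ×ₖ
      ((M.rZ.comap (fun q : ((𝒳 × (𝒰 × 𝒵 × 𝒲)) × 𝒜) × ℝ =>
          (q.1.1.2.2.1, q.1.1.2.1, q.1.2, q.1.1.1)) (by fun_prop)) ×ₖ
        (M.rW.comap (fun q : ((𝒳 × (𝒰 × 𝒵 × 𝒲)) × 𝒜) × ℝ =>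
          (q.1.1.2.2.2, q.1.1.1, q.1.2)) (by fun_prop))))

variable (M : Model 𝒰 𝒳 𝒵 𝒲 𝒜)

instance : IsProbabilityMeasure M.actLaw := by unfold Model.actLaw; infer_instance

instance : IsMarkovKernel M.rewKernel := by unfold Model.rewKernel; infer_instance

instance : IsMarkovKernel M.missKernel := by unfold Model.missKernel; infer_instance

lemma pOb_eq : M.pOb = (M.actLaw ⊗ₘ M.rewKernel) ⊗ₘ M.missKernel := rfl

lemma map_fst_pOb : M.pOb.map Prod.fst = M.actLaw ⊗ₘ M.rewKernel := by
  rw [pOb_eq]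
  exact Measure.fst_compProd _ _

lemma map_ctx_triple_pOb :
    M.pOb.map (fun o : Trial 𝒰 𝒳 𝒵 𝒲 𝒜 => o.1.1.1) = M.pX ⊗ₘ M.kO := by
  have h1 : (M.actLaw ⊗ₘ M.rewKernel).map Prod.fst = M.actLaw := Measure.fst_compProd _ _
  have h2 : M.actLaw.map Prod.fst = M.pX ⊗ₘ M.kO := Measure.fst_compProd _ _
  have h3 : M.pOb.map (fun o : Trial 𝒰 𝒳 𝒵 𝒲 𝒜 => o.1.1.1) =
      ((M.pOb.map Prod.fst).map Prod.fst).map Prod.fst := by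
    rw [Measure.map_map measurable_fst measurable_fst,
      Measure.map_map (measurable_fst.comp measurable_fst) measurable_fst]
    rfl
  rw [h3, map_fst_pOb, h1, h2]

/-- The probabilities of observing `X`, `Z` and `W` given a trial. -/
noncomputable def Model.obsProb (k : Fin 4) (q : ((𝒳 × (𝒰 × 𝒵 × 𝒲)) × 𝒜) × ℝ) : ℝ≥0∞ :=
  match k with
  | 0 => M.rX q.1.1.1 {true} * M.rZ (q.1.1.2.2.1, q.1.1.2.1, q.1.2, q.1.1.1) {true}
  | 1 => M.rX q.1.1.1 {true} * M.rZ (q.1.1.2.2.1, q.1.1.2.1, q.1.2, q.1.1.1) {true} *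
      M.rW (q.1.1.2.2.2, q.1.1.1, q.1.2) {true}
  | 2 => M.rX q.1.1.1 {true} * M.rW (q.1.1.2.2.2, q.1.1.1, q.1.2) {true}
  | 3 => M.rX q.1.1.1 {true}

lemma measurable_obsProb (k : Fin 4) : Measurable (M.obsProb k) := by
  have hX : Measurable fun q : ((𝒳 × (𝒰 × 𝒵 × 𝒲)) × 𝒜) × ℝ => M.rX q.1.1.1 {true} :=
    (M.rX.measurable_coe (by measurability)).comp (by fun_prop)
  have hZ : Measurable fun q : ((𝒳 × (𝒰 × 𝒵 × 𝒲)) × 𝒜) × ℝ =>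
      M.rZ (q.1.1.2.2.1, q.1.1.2.1, q.1.2, q.1.1.1) {true} :=
    (M.rZ.measurable_coe (by measurability)).comp (by fun_prop)
  have hW : Measurable fun q : ((𝒳 × (𝒰 × 𝒵 × 𝒲)) × 𝒜) × ℝ =>
      M.rW (q.1.1.2.2.2, q.1.1.1, q.1.2) {true} :=
    (M.rW.measurable_coe (by measurability)).comp (by fun_prop)
  fin_cases k
  exacts [hX.mul hZ, (hX.mul hZ).mul hW, hX.mul hW, hX]

lemma obsProb_le_one (k : Fin 4) (q : ((𝒳 × (𝒰 × 𝒵 × 𝒲)) × 𝒜) × ℝ) : M.obsProb k q ≤ 1 := by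
  have hX : M.rX q.1.1.1 {true} ≤ 1 := prob_le_one
  have hZ : M.rZ (q.1.1.2.2.1, q.1.1.2.1, q.1.2, q.1.1.1) {true} ≤ 1 := prob_le_one
  have hW : M.rW (q.1.1.2.2.2, q.1.1.1, q.1.2) {true} ≤ 1 := prob_le_one
  fin_cases k
  exacts [mul_le_one' hX hZ, mul_le_one' (mul_le_one' hX hZ) hW, mul_le_one' hX hW, hX]

lemma map_fst_mu (k : Fin 4) : (M.mu k).map Prod.fst =
    (M.pOb (pattern k))⁻¹ • (M.actLaw ⊗ₘ M.rewKernel).withDensity (M.obsProb k) := by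
  have key : ∀ s : Set (Bool × Bool × Bool), (pattern k : Set (Trial 𝒰 𝒳 𝒵 𝒲 𝒜)) = Prod.snd ⁻¹' s →
      (∀ q, M.missKernel q s = M.obsProb k q) → (M.mu k).map Prod.fst =
        (M.pOb (pattern k))⁻¹ • (M.actLaw ⊗ₘ M.rewKernel).withDensity (M.obsProb k) := by
    intro s hs hq
    rw [Model.mu, ProbabilityTheory.cond, Measure.map_smul]
    congr 1
    rw [hs, pOb_eq, map_fst_restrict_compProd _ _ (by measurability)]
    congr 1
    funext q
    exact hq q
  match k with
  | 0 =>
    refine key ({true} ×ˢ ({true} ×ˢ Set.univ)) ?_ fun q => ?_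
    · ext o
      change (o.2.1 = true ∧ o.2.2.1 = true) ↔ (o.2.1 = true ∧ o.2.2.1 = true ∧ True)
      tauto
    · rw [Model.missKernel, Kernel.prod_apply_prod, Kernel.prod_apply_prod]
      simp only [Kernel.comap_apply, measure_univ, mul_one]
      rfl
  | 1 =>
    refine key ({true} ×ˢ ({true} ×ˢ {true})) ?_ fun q => ?_
    · ext o
      change ((o.2.2.2 = true ∧ o.2.1 = true) ∧ o.2.2.1 = true) ↔
        (o.2.1 = true ∧ o.2.2.1 = true ∧ o.2.2.2 = true)
      tauto
    · rw [Model.missKernel, Kernel.prod_apply_prod, Kernel.prod_apply_prod]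
      simp only [Kernel.comap_apply, ← mul_assoc]
      rfl
  | 2 =>
    refine key ({true} ×ˢ (Set.univ ×ˢ {true})) ?_ fun q => ?_
    · ext o
      change (o.2.2.2 = true ∧ o.2.1 = true) ↔ (o.2.1 = true ∧ True ∧ o.2.2.2 = true)
      tauto
    · rw [Model.missKernel, Kernel.prod_apply_prod, Kernel.prod_apply_prod]
      simp only [Kernel.comap_apply, measure_univ, one_mul]
      rfl
  | 3 =>
    refine key ({true} ×ˢ (Set.univ ×ˢ Set.univ)) ?_ fun q => ?_
    · ext o
      change (o.2.1 = true) ↔ (o.2.1 = true ∧ True ∧ True)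
      tauto
    · rw [Model.missKernel, Kernel.prod_apply_prod, Kernel.prod_apply_prod]
      simp only [Kernel.comap_apply, measure_univ, mul_one]
      rfl

/-- The law of a trial with all three patterns is obtained from the law with the pattern of `X` and
`Z` by a density in `(A, W, X)`. -/
lemma map_fst_mu_eq_withDensity {k l : Fin 4} (hkl : (k = 0 ∧ l = 1) ∨ (k = 3 ∧ l = 2))
    (hk : M.pOb (pattern k) ≠ 0) :
    (M.mu l).map Prod.fst = ((M.mu k).map Prod.fst).withDensity fun q =>
      M.pOb (pattern k) * (M.pOb (pattern l))⁻¹ * M.rW (q.1.1.2.2.2, q.1.1.1, q.1.2) {true} := by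
  have hW : Measurable fun q : ((𝒳 × (𝒰 × 𝒵 × 𝒲)) × 𝒜) × ℝ =>
      M.rW (q.1.1.2.2.2, q.1.1.1, q.1.2) {true} :=
    (M.rW.measurable_coe (by measurability)).comp (by fun_prop)
  have hmul : M.obsProb l = M.obsProb k * fun q => M.rW (q.1.1.2.2.2, q.1.1.1, q.1.2) {true} := by
    rcases hkl with ⟨rfl, rfl⟩ | ⟨rfl, rfl⟩ <;> rfl
  have hc : (fun q : ((𝒳 × (𝒰 × 𝒵 × 𝒲)) × 𝒜) × ℝ => M.pOb (pattern k) * (M.pOb (pattern l))⁻¹ *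
      M.rW (q.1.1.2.2.2, q.1.1.1, q.1.2) {true}) = (M.pOb (pattern k) * (M.pOb (pattern l))⁻¹) •
        fun q => M.rW (q.1.1.2.2.2, q.1.1.1, q.1.2) {true} := rfl
  rw [map_fst_mu, map_fst_mu, hc, withDensity_smul _ hW, withDensity_smul_measure, hmul,
    withDensity_mul _ (measurable_obsProb M k) hW, smul_smul]
  congr 1
  rw [mul_comm, ← mul_assoc, ENNReal.inv_mul_cancel hk (measure_ne_top _ _), one_mul]

end Laws


/-! ### The weights b₂, b₃, b₄ as changes of measure -/

section Reweighting

variable {𝒰 𝒳 𝒵 𝒲 𝒜 : Type*} [MeasurableSpace 𝒰] [MeasurableSpace 𝒳] [MeasurableSpace 𝒵]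
  [MeasurableSpace 𝒲] [MeasurableSpace 𝒜]

/-- The trial with given variables and all variables recorded. -/
def fullTrial (q : ((𝒳 × (𝒰 × 𝒵 × 𝒲)) × 𝒜) × ℝ) : Trial 𝒰 𝒳 𝒵 𝒲 𝒜 := (q, true, true, true)

@[fun_prop] lemma measurable_fullTrial : Measurable (fullTrial (𝒰 := 𝒰) (𝒳 := 𝒳) (𝒵 := 𝒵)
    (𝒲 := 𝒲) (𝒜 := 𝒜)) := by
  unfold fullTrial; fun_prop

variable (M : Model 𝒰 𝒳 𝒵 𝒲 𝒜)

lemma integral_eq_integral_map_fst (μ : Measure (Trial 𝒰 𝒳 𝒵 𝒲 𝒜))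
    {f : Trial 𝒰 𝒳 𝒵 𝒲 𝒜 → ℝ} (hf : Measurable f) (hfst : ∀ o, f o = f (fullTrial o.1)) :
    ∫ o, f o ∂μ = ∫ q, f (fullTrial q) ∂(μ.map Prod.fst) := by
  exact (integral_congr_ae (ae_of_all _ hfst)).trans
    (integral_map (f := fun q => f (fullTrial q)) measurable_fst.aemeasurable
      (hf.comp measurable_fullTrial).aestronglyMeasurable).symm

lemma map_fst_lawGiven {S : Type*} [MeasurableSpace S] (k : Fin 4) {V : Trial 𝒰 𝒳 𝒵 𝒲 𝒜 → S}
    (hV : Measurable V) (hfst : ∀ o, V o = V (fullTrial o.1)) :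
    M.lawGiven V (pattern k) = ((M.mu k).map Prod.fst).map fun q => V (fullTrial q) := by
  exact (Measure.map_congr (ae_of_all _ hfst)).trans
    (Measure.map_map (g := fun q => V (fullTrial q)) (hV.comp measurable_fullTrial)
      measurable_fst).symm

/-- Conditioning on a null event gives the zero measure, and no nonzero measure is absolutely
continuous with respect to it. -/
lemma pOb_pattern_ne_zero {S : Type*} [MeasurableSpace S] (k : Fin 4)
    {V : Trial 𝒰 𝒳 𝒵 𝒲 𝒜 → S} {ρ : Measure S} (hρ : ρ ≠ 0)
    (hac : ρ ≪ M.lawGiven V (pattern k)) : M.pOb (pattern k) ≠ 0 := by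
  intro h0
  apply hρ
  have h : M.lawGiven V (pattern k) = 0 := by
    rw [Model.lawGiven, ProbabilityTheory.cond_eq_zero_of_meas_eq_zero h0, Measure.map_zero]
  rw [h] at hac
  exact Measure.absolutelyContinuous_zero_iff.1 hac

lemma ae_abs_rew_le {LY : ℝ} (hY : ∀ q, ∀ᵐ y ∂(M.kY q), |y| ≤ LY) :
    ∀ᵐ o ∂M.pOb, |rew o| ≤ LY := by
  have h : ∀ᵐ q ∂(M.actLaw ⊗ₘ M.rewKernel), |q.2| ≤ LY :=
    Measure.ae_compProd_of_ae_ae (measurableSet_le (by fun_prop) (by fun_prop))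
      (ae_of_all _ fun q => hY _)
  rw [← map_fst_pOb] at h
  exact ae_of_ae_map measurable_fst.aemeasurable h

lemma mu_absolutelyContinuous (k : Fin 4) : M.mu k ≪ M.pOb := cond_absolutelyContinuous

lemma integral_withDensity_rnDeriv {E S : Type*} [MeasurableSpace E] [MeasurableSpace S]
    (ν : Measure E) [IsFiniteMeasure ν] (ρ : Measure S) [IsFiniteMeasure ρ] {V : E → S}
    (hV : Measurable V) (f : E → ℝ) :
    ∫ e, f e ∂(ν.withDensity fun e => ρ.rnDeriv (ν.map V) (V e)) =
      ∫ e, ratio ρ (ν.map V) (V e) * f e ∂ν := by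
  have := integral_withDensity_eq_integral_toReal_smul
    ((Measure.measurable_rnDeriv ρ (ν.map V)).comp hV)
    (ae_of_ae_map hV.aemeasurable (Measure.rnDeriv_lt_top ρ (ν.map V))) f
  exact this

/-- A density in the first coordinate changes its marginal and keeps the kernel. Thus selection by
R_X, which is caused by X alone, preserves p(u, z, w | x). -/
lemma map_smul_withDensity_eq_compProd {E S S' : Type*} [MeasurableSpace E] [MeasurableSpace S]
    [MeasurableSpace S'] (ν : Measure E) {t : E → S × S'} (ht : Measurable t) (p : Measure S)
    [IsFiniteMeasure p] (κ : Kernel S S') [IsMarkovKernel κ] (hν : ν.map t = p ⊗ₘ κ) {r : S → ℝ≥0∞}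
    (hr : Measurable r) (hr1 : ∀ x, r x ≤ 1) (c : ℝ≥0∞) :
    (c • ν.withDensity fun e => r (t e).1).map t =
      ((c • ν.withDensity fun e => r (t e).1).map fun e => (t e).1) ⊗ₘ κ := by
  have : IsFiniteMeasure (p.withDensity r) :=
    isFiniteMeasure_withDensity (ne_of_lt ((lintegral_mono hr1).trans_lt (by simp)))
  have h1 : (c • ν.withDensity fun e => r (t e).1).map t = (c • p.withDensity r) ⊗ₘ κ := by
    rw [Measure.map_smul, map_withDensity_comp ν ht (f := fun q => r q.1) (hr.comp measurable_fst),
      hν, Measure.compProd_smul_left, withDensity_compProd _ _ hr]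
  have h2 : ((c • ν.withDensity fun e => r (t e).1).map fun e => (t e).1) =
      ((c • ν.withDensity fun e => r (t e).1).map t).map Prod.fst :=
    (Measure.map_map measurable_fst ht).symm
  rw [h2, h1]
  congr 1
  rw [Measure.compProd_smul_left, Measure.map_smul]
  exact (congrArg (c • ·) (Measure.fst_compProd _ _)).symm

lemma map_triple_actLaw_compProd :
    (M.actLaw ⊗ₘ M.rewKernel).map (fun q => q.1.1) = M.pX ⊗ₘ M.kO := by
  rw [← map_ctx_triple_pOb, ← map_fst_pOb]
  exact Measure.map_map (by fun_prop) measurable_fst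

lemma map_triple_mu_three : ((M.mu 3).map Prod.fst).map (fun q => q.1.1) =
    (M.lawGiven ctx obsX) ⊗ₘ M.kO := by
  have h := map_smul_withDensity_eq_compProd (M.actLaw ⊗ₘ M.rewKernel) (t := fun q => q.1.1)
    (by fun_prop) M.pX M.kO (map_triple_actLaw_compProd M) (r := fun x => M.rX x {true})
    (M.rX.measurable_coe (by measurability)) (fun x => prob_le_one) (M.pOb (pattern 3))⁻¹
  have h1 := map_fst_mu M 3
  have h2 : M.lawGiven ctx obsX = ((M.mu 3).map Prod.fst).map fun q => q.1.1.1 :=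
    map_fst_lawGiven M 3 measurable_ctx fun o => rfl
  rw [h2, h1]
  exact h

lemma pTilde_absolutelyContinuous_pX (h : M.pTilde ≪ M.lawGiven ctx obsX) : M.pTilde ≪ M.pX := by
  refine h.trans ?_
  have h1 : M.lawGiven ctx obsX ≪ M.pOb.map ctx :=
    (mu_absolutelyContinuous M 3).map measurable_ctx
  have h2 : M.pOb.map ctx = M.pX := by
    have h3 : M.pOb.map ctx = (M.pOb.map fun o : Trial 𝒰 𝒳 𝒵 𝒲 𝒜 => o.1.1.1).map Prod.fst := by
      rw [Measure.map_map measurable_fst (by fun_prop)]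
      rfl
    rw [h3, map_ctx_triple_pOb]
    exact Measure.fst_compProd _ _
  rwa [h2] at h1

/-- The measure under which the context has law `p̃` and the other variables have their
observational mechanisms. -/
noncomputable def Model.shiftedLaw (M : Model 𝒰 𝒳 𝒵 𝒲 𝒜) :
    Measure (((𝒳 × (𝒰 × 𝒵 × 𝒲)) × 𝒜) × ℝ) :=
  ((M.mu 3).map Prod.fst).withDensity fun q =>
    M.pTilde.rnDeriv (M.lawGiven ctx obsX) (ctx (fullTrial q))

lemma shiftedLaw_eq : M.shiftedLaw = ((M.mu 3).map Prod.fst).withDensity fun q =>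
    M.pTilde.rnDeriv (((M.mu 3).map Prod.fst).map fun q => ctx (fullTrial q))
      (ctx (fullTrial q)) := by
  rw [Model.shiftedLaw, ← map_fst_lawGiven M 3 measurable_ctx fun o => rfl]
  rfl

lemma map_shiftedLaw (h : M.pTilde ≪ M.lawGiven ctx obsX) :
    M.shiftedLaw.map (fun q => q.1.1) = M.pTilde ⊗ₘ M.kO := by
  have hm : Measurable (M.pTilde.rnDeriv (M.lawGiven ctx obsX)) := Measure.measurable_rnDeriv _ _
  have : IsFiniteMeasure (M.lawGiven ctx obsX : Measure 𝒳) := by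
    unfold Model.lawGiven; infer_instance
  have h1 : (M.lawGiven ctx obsX).withDensity (M.pTilde.rnDeriv (M.lawGiven ctx obsX)) =
      M.pTilde := Measure.withDensity_rnDeriv_eq _ _ h
  have h2 := map_withDensity_comp ((M.mu 3).map Prod.fst)
    (V := fun q : ((𝒳 × (𝒰 × 𝒵 × 𝒲)) × 𝒜) × ℝ => q.1.1) (by fun_prop)
    (f := fun p => M.pTilde.rnDeriv (M.lawGiven ctx obsX) p.1) (hm.comp measurable_fst)
  have : SFinite ((M.lawGiven ctx obsX).withDensity
      (M.pTilde.rnDeriv (M.lawGiven ctx obsX))) := by rw [h1]; infer_instance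
  have h3 := withDensity_compProd (M.lawGiven ctx obsX) M.kO hm
  rw [h1] at h3
  rw [map_triple_mu_three] at h2
  exact h2.trans h3.symm

lemma isProbabilityMeasure_shiftedLaw (h : M.pTilde ≪ M.lawGiven ctx obsX) :
    IsProbabilityMeasure M.shiftedLaw := by
  constructor
  have h1 := congrArg (fun ν => ν Set.univ) (map_shiftedLaw M h)
  rw [Measure.map_apply (by fun_prop) MeasurableSet.univ, Set.preimage_univ] at h1
  rw [h1, measure_univ]

lemma integral_mul_ratio_three {f : Trial 𝒰 𝒳 𝒵 𝒲 𝒜 → ℝ} (hf : Measurable f)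
    (hfst : ∀ o, f o = f (fullTrial o.1)) :
    ∫ o, ratio M.pTilde (M.lawGiven ctx obsX) (ctx o) * f o ∂(M.mu 3) =
      ∫ q, f (fullTrial q) ∂M.shiftedLaw := by
  have hm : Measurable (ratio M.pTilde (M.lawGiven ctx obsX)) :=
    (Measure.measurable_rnDeriv _ _).ennreal_toReal
  rw [shiftedLaw_eq, integral_withDensity_rnDeriv _ _ (by fun_prop),
    ← map_fst_lawGiven M 3 measurable_ctx fun o => rfl]
  refine integral_eq_integral_map_fst (M.mu 3)
    (f := fun o => ratio M.pTilde (M.lawGiven ctx obsX) (ctx o) * f o)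
    ((hm.comp measurable_ctx).mul hf) fun o => ?_
  rw [hfst o]
  rfl

variable [StandardBorelSpace 𝒲] [StandardBorelSpace 𝒜] [Nonempty 𝒲] [Nonempty 𝒜]

lemma isFiniteMeasure_awMeasure : IsFiniteMeasure M.awMeasure := by
  unfold Model.awMeasure; infer_instance

/-- `awMeasure` is the marginal of `shiftedLaw` in (X, A, W), and `mu 2` has a density in these
variables with respect to `mu 3`. The ratio therefore undoes the selection by R_W and installs p̃ at
the same time. -/
lemma integral_mul_ratio_two (hO : M.Overlap) {f : Trial 𝒰 𝒳 𝒵 𝒲 𝒜 → ℝ} (hf : Measurable f)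
    (hfst : ∀ o, f o = f (fullTrial o.1)) :
    ∫ o, ratio M.awMeasure (M.lawGiven (fun o => (ctx o, (act o, oprox o))) (obsW ∩ obsX))
        (ctx o, (act o, oprox o)) * f o ∂(M.mu 2) =
      ∫ q, f (fullTrial q) ∂M.shiftedLaw := by
  obtain ⟨-, hO2, hO3⟩ := hO
  have := isFiniteMeasure_awMeasure M
  have hV : Measurable fun o : Trial 𝒰 𝒳 𝒵 𝒲 𝒜 => (ctx o, (act o, oprox o)) := by fun_prop
  set R := ratio M.awMeasure (M.lawGiven (fun o : Trial 𝒰 𝒳 𝒵 𝒲 𝒜 => (ctx o, (act o, oprox o)))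
    (obsW ∩ obsX)) with hR
  have hm : Measurable R := (Measure.measurable_rnDeriv _ _).ennreal_toReal
  have hb : Measurable (M.pTilde.rnDeriv (M.lawGiven ctx obsX)) := Measure.measurable_rnDeriv _ _
  have hlaw2 : M.lawGiven (fun o : Trial 𝒰 𝒳 𝒵 𝒲 𝒜 => (ctx o, (act o, oprox o))) (obsW ∩ obsX) =
      ((M.mu 2).map Prod.fst).map fun q =>
        (ctx (fullTrial q), (act (fullTrial q), oprox (fullTrial q))) :=
    map_fst_lawGiven M 2 hV fun o => rfl
  have hp3 : M.pOb (pattern 3) ≠ 0 :=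
    pOb_pattern_ne_zero M 3 (V := ctx) (ρ := M.pTilde) (IsProbabilityMeasure.ne_zero _) hO3
  have hW : Measurable fun p : 𝒳 × (𝒜 × 𝒲) => M.pOb (pattern 3) * (M.pOb (pattern 2))⁻¹ *
      M.rW (p.2.2, p.1, p.2.1) {true} := by
    refine Measurable.const_mul ?_ _
    exact (M.rW.measurable_coe (by measurability)).comp
      (g := fun s => M.rW s {true})
      (f := fun p : 𝒳 × (𝒜 × 𝒲) => (p.2.2, p.1, p.2.1)) (by fun_prop)
  have haw : M.awMeasure = (((M.mu 3).map Prod.fst).map fun q =>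
      (ctx (fullTrial q), (act (fullTrial q), oprox (fullTrial q)))).withDensity
        fun p => M.pTilde.rnDeriv (M.lawGiven ctx obsX) p.1 := by
    have : IsFiniteMeasure (M.lawGiven ctx obsX : Measure 𝒳) := by
      unfold Model.lawGiven; infer_instance
    have h1 : (M.lawGiven ctx obsX).withDensity (M.pTilde.rnDeriv (M.lawGiven ctx obsX)) =
        M.pTilde := Measure.withDensity_rnDeriv_eq _ _ hO3
    have h3 := withDensity_compProd (M.lawGiven ctx obsX)
      (condDistrib (fun o : Trial 𝒰 𝒳 𝒵 𝒲 𝒜 => (act o, oprox o)) ctx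
        (ProbabilityTheory.cond M.pOb obsX)) hb
    rw [h1] at h3
    have h4 : (M.lawGiven ctx obsX) ⊗ₘ
        condDistrib (fun o : Trial 𝒰 𝒳 𝒵 𝒲 𝒜 => (act o, oprox o)) ctx
          (ProbabilityTheory.cond M.pOb obsX) =
        M.lawGiven (fun o => (ctx o, (act o, oprox o))) (pattern 3) :=
      compProd_map_condDistrib (by fun_prop)
    rw [h4, map_fst_lawGiven M 3 hV fun o => rfl] at h3
    exact h3
  have key := withDensity_rnDeriv_comp ((M.mu 3).map Prod.fst) ((M.mu 2).map Prod.fst)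
    (V := fun q => (ctx (fullTrial q), (act (fullTrial q), oprox (fullTrial q)))) (by fun_prop)
    hW (hb.comp measurable_fst)
    (map_fst_mu_eq_withDensity M (Or.inr ⟨rfl, rfl⟩) hp3) M.awMeasure haw (by
      rw [← hlaw2]; exact hO2)
  have h5 := integral_eq_integral_map_fst (M.mu 2)
    (f := fun o => R (ctx o, (act o, oprox o)) * f o)
    ((hm.comp hV).mul hf) (fun o => by rw [hfst o]; rfl)
  rw [h5, hR, hlaw2, ← integral_withDensity_rnDeriv _ _ (by fun_prop), key]
  rfl

/-- `mu 1` is `mu 0` further selected by R_W, a density in (A, W, X), so correcting the marginal of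
these three variables restores integrals of all functions that ignore the indicators. -/
lemma integral_mul_ratio_one (hO : M.Overlap) (hp0 : M.pOb (pattern 0) ≠ 0)
    {f : Trial 𝒰 𝒳 𝒵 𝒲 𝒜 → ℝ} (hf : Measurable f) (hfst : ∀ o, f o = f (fullTrial o.1)) :
    ∫ o, ratio (M.lawGiven (fun o => (act o, oprox o, ctx o)) (obsX ∩ obsZ))
        (M.lawGiven (fun o => (act o, oprox o, ctx o)) (obsW ∩ obsX ∩ obsZ))
        (act o, oprox o, ctx o) * f o ∂(M.mu 1) = ∫ o, f o ∂(M.mu 0) := by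
  obtain ⟨hO1, -, -⟩ := hO
  have hV : Measurable fun o : Trial 𝒰 𝒳 𝒵 𝒲 𝒜 => (act o, oprox o, ctx o) := by fun_prop
  have hlaw0 : M.lawGiven (fun o : Trial 𝒰 𝒳 𝒵 𝒲 𝒜 => (act o, oprox o, ctx o)) (obsX ∩ obsZ) =
      ((M.mu 0).map Prod.fst).map fun q =>
        (act (fullTrial q), oprox (fullTrial q), ctx (fullTrial q)) :=
    map_fst_lawGiven M 0 hV fun o => rfl
  have hlaw1 : M.lawGiven (fun o : Trial 𝒰 𝒳 𝒵 𝒲 𝒜 => (act o, oprox o, ctx o))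
      (obsW ∩ obsX ∩ obsZ) = ((M.mu 1).map Prod.fst).map fun q =>
        (act (fullTrial q), oprox (fullTrial q), ctx (fullTrial q)) :=
    map_fst_lawGiven M 1 hV fun o => rfl
  rw [hlaw0, hlaw1] at hO1 ⊢
  have hm : Measurable (ratio (((M.mu 0).map Prod.fst).map fun q =>
        (act (fullTrial q), oprox (fullTrial q), ctx (fullTrial q)))
      (((M.mu 1).map Prod.fst).map fun q =>
        (act (fullTrial q), oprox (fullTrial q), ctx (fullTrial q)))) :=
    (Measure.measurable_rnDeriv _ _).ennreal_toReal
  have hW : Measurable fun p : 𝒜 × 𝒲 × 𝒳 => M.pOb (pattern 0) * (M.pOb (pattern 1))⁻¹ *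
      M.rW (p.2.1, p.2.2, p.1) {true} := by
    refine Measurable.const_mul ?_ _
    exact (M.rW.measurable_coe (by measurability)).comp
      (g := fun s => M.rW s {true})
      (f := fun p : 𝒜 × 𝒲 × 𝒳 => (p.2.1, p.2.2, p.1)) (by fun_prop)
  have key := withDensity_rnDeriv_comp ((M.mu 0).map Prod.fst) ((M.mu 1).map Prod.fst)
    (V := fun q => (act (fullTrial q), oprox (fullTrial q), ctx (fullTrial q))) (by fun_prop)
    hW (β := 1) measurable_const
    (map_fst_mu_eq_withDensity M (Or.inl ⟨rfl, rfl⟩) hp0) _ (by rw [withDensity_one]) hO1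
  have h5 := integral_eq_integral_map_fst (M.mu 1)
    (f := fun o => ratio (((M.mu 0).map Prod.fst).map fun q =>
        (act (fullTrial q), oprox (fullTrial q), ctx (fullTrial q)))
      (((M.mu 1).map Prod.fst).map fun q =>
        (act (fullTrial q), oprox (fullTrial q), ctx (fullTrial q)))
        (act o, oprox o, ctx o) * f o)
    ((hm.comp hV).mul hf) (fun o => by rw [hfst o]; rfl)
  have h6 : ((M.mu 0).map Prod.fst).withDensity
      (fun q => (1 : 𝒜 × 𝒲 × 𝒳 → ℝ≥0∞) (act (fullTrial q), oprox (fullTrial q),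
        ctx (fullTrial q))) = (M.mu 0).map Prod.fst := withDensity_one
  rw [h5, integral_eq_integral_map_fst (M.mu 0) hf hfst,
    ← integral_withDensity_rnDeriv _ _ (by fun_prop), key, h6]

end Reweighting


/-! ### The weight b₁ and the treatment proxy -/

section Shift

variable {𝒰 𝒳 𝒵 𝒲 𝒜 : Type*} [MeasurableSpace 𝒰] [MeasurableSpace 𝒳] [MeasurableSpace 𝒵]
  [MeasurableSpace 𝒲] [MeasurableSpace 𝒜] (M : Model 𝒰 𝒳 𝒵 𝒲 𝒜)

/-- The probability of the pattern of `X` and `Z` given a trial, as a real number. -/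
noncomputable def Model.obsXZ (c : 𝒜 × 𝒳 × 𝒰) (z : 𝒵) : ℝ :=
  (M.rX c.2.1 {true} * M.rZ (z, c.2.2, c.1, c.2.1) {true}).toReal

lemma measurable_obsXZ : Measurable fun p : (𝒜 × 𝒳 × 𝒰) × 𝒵 => M.obsXZ p.1 p.2 := by
  refine Measurable.ennreal_toReal (Measurable.mul ?_ ?_)
  · exact (M.rX.measurable_coe (by measurability)).comp (g := fun s => M.rX s {true})
      (f := fun p : (𝒜 × 𝒳 × 𝒰) × 𝒵 => p.1.2.1) (by fun_prop)
  · exact (M.rZ.measurable_coe (by measurability)).comp (g := fun s => M.rZ s {true})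
      (f := fun p : (𝒜 × 𝒳 × 𝒰) × 𝒵 => (p.2, p.1.2.2, p.1.1, p.1.2.1)) (by fun_prop)

lemma map_fst_mu_zero : (M.mu 0).map Prod.fst = (M.pOb (pattern 0))⁻¹ •
    (M.pOb.map Prod.fst).withDensity (M.obsProb 0) := by
  rw [map_fst_mu M 0, map_fst_pOb]

lemma integral_mu_zero {f : Trial 𝒰 𝒳 𝒵 𝒲 𝒜 → ℝ} (hf : Measurable f)
    (hfst : ∀ o, f o = f (fullTrial o.1)) :
    ∫ o, f o ∂(M.mu 0) = (M.pOb (pattern 0))⁻¹.toReal *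
      ∫ o, M.obsXZ (act o, ctx o, conf o) (tprox o) * f o ∂M.pOb := by
  rw [integral_eq_integral_map_fst (M.mu 0) hf hfst, map_fst_mu_zero, integral_smul_measure,
    integral_withDensity_eq_integral_toReal_smul (measurable_obsProb M 0)
      (ae_of_all _ fun q => (obsProb_le_one M 0 q).trans_lt (by simp)), smul_eq_mul,
    integral_eq_integral_map_fst M.pOb
      (f := fun o => M.obsXZ (act o, ctx o, conf o) (tprox o) * f o)
      (((measurable_obsXZ M).comp (f := fun o => ((act o, ctx o, conf o), tprox o))
        (by fun_prop)).mul hf) (fun o => by rw [hfst o]; rfl)]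
  rfl

lemma integrable_iff_integrable_map_fst (μ : Measure (Trial 𝒰 𝒳 𝒵 𝒲 𝒜))
    {f : Trial 𝒰 𝒳 𝒵 𝒲 𝒜 → ℝ} (hf : Measurable f) (hfst : ∀ o, f o = f (fullTrial o.1)) :
    Integrable f μ ↔ Integrable (fun q => f (fullTrial q)) (μ.map Prod.fst) :=
  (integrable_congr (ae_of_all _ hfst)).trans
    (integrable_map_measure (g := fun q => f (fullTrial q))
      (hf.comp measurable_fullTrial).aestronglyMeasurable measurable_fst.aemeasurable).symm

lemma integrable_mu_zero_iff (hp0 : M.pOb (pattern 0) ≠ 0) {f : Trial 𝒰 𝒳 𝒵 𝒲 𝒜 → ℝ}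
    (hf : Measurable f) (hfst : ∀ o, f o = f (fullTrial o.1)) :
    Integrable f (M.mu 0) ↔
      Integrable (fun o => M.obsXZ (act o, ctx o, conf o) (tprox o) * f o) M.pOb := by
  have h1 : Integrable f (M.mu 0) ↔
      Integrable (fun q => f (fullTrial q)) ((M.mu 0).map Prod.fst) :=
    integrable_iff_integrable_map_fst (M.mu 0) hf hfst
  have hG : Measurable fun o => M.obsXZ (act o, ctx o, conf o) (tprox o) * f o :=
    ((measurable_obsXZ M).comp (f := fun o => ((act o, ctx o, conf o), tprox o))
        (by fun_prop)).mul hf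
  have h2 : Integrable (fun o => M.obsXZ (act o, ctx o, conf o) (tprox o) * f o) M.pOb ↔
      Integrable (fun q => M.obsXZ (act (fullTrial q), ctx (fullTrial q), conf (fullTrial q))
        (tprox (fullTrial q)) * f (fullTrial q)) (M.pOb.map Prod.fst) :=
    integrable_iff_integrable_map_fst M.pOb hG fun o => by rw [hfst o]; rfl
  rw [h1, h2, map_fst_mu_zero, integrable_smul_measure (by simp [measure_ne_top]) (by simpa using hp0),
    integrable_withDensity_iff_integrable_smul' (measurable_obsProb M 0)
      (ae_of_all _ fun q => (obsProb_le_one M 0 q).trans_lt (by simp))]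
  rfl

/-- Replacing the reward (and a function of it) by its conditional mean given the other variables. -/
lemma integral_mul_eq_integral_mul_rewKernel {f : (𝒳 × (𝒰 × 𝒵 × 𝒲)) × 𝒜 → ℝ}
    (hf : Measurable f) (hfi : Integrable (fun o : Trial 𝒰 𝒳 𝒵 𝒲 𝒜 => f o.1.1) M.pOb)
    {G : ((𝒳 × (𝒰 × 𝒵 × 𝒲)) × 𝒜) × ℝ → ℝ} (hG : Measurable G) {L : ℝ}
    (hGL : ∀ q, ∀ᵐ y ∂(M.rewKernel q), |G (q, y)| ≤ L) :
    ∫ o, f o.1.1 * G o.1 ∂M.pOb =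
      ∫ o : Trial 𝒰 𝒳 𝒵 𝒲 𝒜, f o.1.1 * ∫ y, G (o.1.1, y) ∂(M.rewKernel o.1.1) ∂M.pOb := by
  have hGa : ∀ᵐ q ∂(M.actLaw ⊗ₘ M.rewKernel), ‖G q‖ ≤ L :=
    Measure.ae_compProd_of_ae_ae (measurableSet_le (by fun_prop) (by fun_prop)) (ae_of_all _ hGL)
  have hfi' : Integrable (fun q : ((𝒳 × (𝒰 × 𝒵 × 𝒲)) × 𝒜) × ℝ => f q.1)
      (M.actLaw ⊗ₘ M.rewKernel) := by
    rw [← map_fst_pOb]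
    exact (integrable_map_measure
      (g := fun q : ((𝒳 × (𝒰 × 𝒵 × 𝒲)) × 𝒜) × ℝ => f q.1)
      (hf.comp measurable_fst).aestronglyMeasurable measurable_fst.aemeasurable).2 hfi
  have hint : Integrable (fun q => f q.1 * G q) (M.actLaw ⊗ₘ M.rewKernel) :=
    hfi'.mul_bdd hG.aestronglyMeasurable hGa
  have hm : Measurable fun q => ∫ y, G (q, y) ∂(M.rewKernel q) :=
    (hG.stronglyMeasurable.integral_kernel_prod_right').measurable
  have h1 : ∫ o, f o.1.1 * G o.1 ∂M.pOb = ∫ q, f q.1 * G q ∂(M.actLaw ⊗ₘ M.rewKernel) := by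
    rw [← map_fst_pOb, integral_map measurable_fst.aemeasurable (by
      exact ((hf.comp measurable_fst).mul hG).aestronglyMeasurable)]
  have h2 : ∫ o : Trial 𝒰 𝒳 𝒵 𝒲 𝒜, f o.1.1 * ∫ y, G (o.1.1, y) ∂(M.rewKernel o.1.1) ∂M.pOb =
      ∫ q, f q * ∫ y, G (q, y) ∂(M.rewKernel q) ∂M.actLaw := by
    have h3 : M.actLaw = (M.pOb.map Prod.fst).map Prod.fst := by
      rw [map_fst_pOb]
      exact (Measure.fst_compProd _ _).symm
    rw [h3, Measure.map_map measurable_fst measurable_fst]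
    exact (integral_map (f := fun q => f q * ∫ y, G (q, y) ∂(M.rewKernel q))
      (measurable_fst.comp measurable_fst).aemeasurable (hf.mul hm).aestronglyMeasurable).symm
  rw [h1, h2, Measure.integral_compProd hint]
  simp only [integral_const_mul]

/-- The integral over the law `p̃(x) p(u, z, w | x)` as a weighted observational integral. -/
lemma integral_pTilde_compProd (hac : M.pTilde ≪ M.pX) {f : 𝒳 × (𝒰 × 𝒵 × 𝒲) → ℝ}
    (hf : Measurable f) :
    ∫ p, f p ∂(M.pTilde ⊗ₘ M.kO) =
      ∫ o : Trial 𝒰 𝒳 𝒵 𝒲 𝒜, ratio M.pTilde M.pX (ctx o) * f o.1.1.1 ∂M.pOb := by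
  have hm : Measurable (M.pTilde.rnDeriv M.pX) := Measure.measurable_rnDeriv _ _
  have h1 : M.pX.withDensity (M.pTilde.rnDeriv M.pX) = M.pTilde :=
    Measure.withDensity_rnDeriv_eq _ _ hac
  have : SFinite (M.pX.withDensity (M.pTilde.rnDeriv M.pX)) := by rw [h1]; infer_instance
  have h2 := withDensity_compProd M.pX M.kO hm
  rw [h1] at h2
  have hlt : ∀ᵐ p ∂(M.pX ⊗ₘ M.kO), M.pTilde.rnDeriv M.pX p.1 < ∞ := by
    have h3 : (M.pX ⊗ₘ M.kO).map Prod.fst = M.pX := Measure.fst_compProd _ _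
    have h4 : ∀ᵐ x ∂((M.pX ⊗ₘ M.kO).map Prod.fst), M.pTilde.rnDeriv M.pX x < ∞ := by
      rw [h3]
      exact Measure.rnDeriv_lt_top _ _
    exact ae_of_ae_map measurable_fst.aemeasurable h4
  have hm' : Measurable fun p : 𝒳 × (𝒰 × 𝒵 × 𝒲) => M.pTilde.rnDeriv M.pX p.1 :=
    hm.comp measurable_fst
  rw [h2, integral_withDensity_eq_integral_toReal_smul hm' hlt, ← map_ctx_triple_pOb]
  exact integral_map (by fun_prop) (hm'.ennreal_toReal.smul hf).aestronglyMeasurable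

lemma integrable_ratio_pTilde_pX :
    Integrable (fun o : Trial 𝒰 𝒳 𝒵 𝒲 𝒜 => ratio M.pTilde M.pX (ctx o)) M.pOb := by
  have h : Integrable (ratio M.pTilde M.pX) M.pX := Measure.integrable_toReal_rnDeriv
  have h2 : M.pOb.map ctx = M.pX := by
    have h3 : M.pOb.map ctx = (M.pOb.map fun o : Trial 𝒰 𝒳 𝒵 𝒲 𝒜 => o.1.1.1).map Prod.fst :=
      (Measure.map_map measurable_fst (by fun_prop)).symm
    rw [h3, map_ctx_triple_pOb]
    exact Measure.fst_compProd _ _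
  have h4 : Integrable (ratio M.pTilde M.pX) (M.pOb.map ctx) := by rw [h2]; exact h
  exact (integrable_map_measure h4.aestronglyMeasurable measurable_ctx.aemeasurable).1 h4

lemma pOb_pattern_zero_ne_zero [Fintype 𝒜] [Nonempty 𝒜] {b₁ : 𝒳 × 𝒜 × 𝒵 → ℝ} (hb : M.IsShift b₁) :
    M.pOb (pattern 0) ≠ 0 := by
  refine pOb_pattern_ne_zero M 0 (V := fun o => ((ctx o, conf o), act o)) (ρ := M.shiftMeasure)
    ?_ hb.2.2.1
  intro h0
  have h1 : M.shiftMeasure Set.univ = 0 := by rw [h0]; rfl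
  rw [Model.shiftMeasure, ← Set.univ_prod_univ, Measure.prod_prod, measure_univ, one_mul,
    Measure.count_univ] at h1
  simp at h1

variable [Fintype 𝒜] [MeasurableSingletonClass 𝒜]

/-- Integrating the shift function: a function of `(A, X, U)` is integrated with respect to
`p(u | x) p̃(x)` and the counting measure in `a`. -/
lemma integral_shift_mul {b₁ : 𝒳 × 𝒜 × 𝒵 → ℝ} (hb : M.IsShift b₁)
    {f : (𝒳 × 𝒰) × 𝒜 → ℝ} (hf : Measurable f) {L : ℝ} (hL : ∀ c, |f c| ≤ L) :
    ∫ o, b₁ (ctx o, act o, tprox o) * f ((ctx o, conf o), act o) ∂(M.mu 0) =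
      ∫ p, ∑ a, f ((p.1, p.2.1), a) ∂(M.pTilde ⊗ₘ M.kO) := by
  obtain ⟨hbm, hbi, hac, hce⟩ := hb
  set C : Trial 𝒰 𝒳 𝒵 𝒲 𝒜 → (𝒳 × 𝒰) × 𝒜 := fun o => ((ctx o, conf o), act o) with hC
  have hCm : Measurable C := by fun_prop
  have hle : MeasurableSpace.comap C inferInstance ≤
    (inferInstance : MeasurableSpace (Trial 𝒰 𝒳 𝒵 𝒲 𝒜)) := hCm.comap_le
  have hfC : AEStronglyMeasurable[MeasurableSpace.comap C inferInstance] (fun o => f (C o))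
      (M.mu 0) := (hf.comp (comap_measurable C)).aestronglyMeasurable
  have hint : Integrable (fun o => b₁ (ctx o, act o, tprox o) * f (C o)) (M.mu 0) :=
    hbi.mul_bdd (hf.comp hCm).aestronglyMeasurable (ae_of_all _ fun o => hL _)
  have h1 := condExp_mul_of_aestronglyMeasurable_right hfC hint hbi
  have hfin : IsFiniteMeasure M.shiftMeasure := by unfold Model.shiftMeasure; infer_instance
  calc ∫ o, b₁ (ctx o, act o, tprox o) * f (C o) ∂(M.mu 0)
      = ∫ o, (M.mu 0)[(fun o => b₁ (ctx o, act o, tprox o)) * (fun o => f (C o)) |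
          MeasurableSpace.comap C inferInstance] o ∂(M.mu 0) := (integral_condExp hle).symm
    _ = ∫ o, ratio M.shiftMeasure (M.lawGiven C (obsX ∩ obsZ)) (C o) * f (C o) ∂(M.mu 0) := by
        refine integral_congr_ae ?_
        filter_upwards [h1, hce] with o h2 h3
        rw [h2, Pi.mul_apply, h3]
    _ = ∫ c, ratio M.shiftMeasure (M.lawGiven C (obsX ∩ obsZ)) c * f c
          ∂(M.lawGiven C (obsX ∩ obsZ)) := by
        refine (integral_map (f := fun c => ratio M.shiftMeasure (M.lawGiven C (obsX ∩ obsZ)) c *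
          f c) hCm.aemeasurable ?_).symm
        exact ((Measure.measurable_rnDeriv _ _).ennreal_toReal.mul hf).aestronglyMeasurable
    _ = ∫ c, f c ∂M.shiftMeasure := by
        have : IsFiniteMeasure (M.lawGiven C (obsX ∩ obsZ)) := by
          unfold Model.lawGiven; infer_instance
        exact integral_rnDeriv_smul (E := ℝ) hac
    _ = ∫ p, ∑ a, f (p, a) ∂(M.pTilde ⊗ₘ Kernel.fst M.kO) := by
        rw [Model.shiftMeasure, integral_prod]
        · simp only [integral_count]
        · exact Integrable.of_bound hf.aestronglyMeasurable L (ae_of_all _ hL)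
    _ = _ := by
        rw [Kernel.fst_eq, Measure.compProd_map measurable_fst, integral_map (by fun_prop)]
        · rfl
        · refine Measurable.aestronglyMeasurable (Finset.measurable_sum _ fun a _ => ?_)
          exact hf.comp (by fun_prop)

variable [StandardBorelSpace 𝒰] [StandardBorelSpace 𝒳] [StandardBorelSpace 𝒵]
  [StandardBorelSpace 𝒲] [Nonempty 𝒲] [Nonempty 𝒜]

/-- The identification step for the treatment proxy: reweighting by `b₁` turns the observational
mean of a function of `(A, X, U, Y, W)` into an integral with respect to the mechanisms of the
interventional process, summed over the treatments. -/
lemma integral_shift_mul_eq (hPV : M.PVIndependence) {b₁ : 𝒳 × 𝒜 × 𝒵 → ℝ} (hb : M.IsShift b₁)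
    (hac : M.pTilde ≪ M.pX) {G : (𝒜 × 𝒳 × 𝒰) × (ℝ × 𝒲) → ℝ} (hG : Measurable G) {L : ℝ}
    (hGL : ∀ c w, ∀ᵐ y ∂(M.kY (c.2.2, c.2.1, w, c.1)), |G (c, (y, w))| ≤ L) :
    ∫ o, b₁ (ctx o, act o, tprox o) * G ((act o, ctx o, conf o), (rew o, oprox o)) ∂(M.mu 0) =
      ∫ p, ∑ a, ∫ y, G ((a, p.1, p.2.1), (y, p.2.2.2)) ∂(M.kY (p.2.1, p.1, p.2.2.2, a))
        ∂(M.pTilde ⊗ₘ M.kO) := by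
  have hp0 : M.pOb (pattern 0) ≠ 0 := pOb_pattern_zero_ne_zero M hb
  have hne : Nonempty 𝒵 := by
    obtain ⟨o⟩ : Nonempty (Trial 𝒰 𝒳 𝒵 𝒲 𝒜) := nonempty_of_isProbabilityMeasure M.pOb
    exact ⟨tprox o⟩
  obtain ⟨hPV1, hPV2⟩ := hPV
  obtain ⟨hbm, hbi, -⟩ := id hb
  set C : Trial 𝒰 𝒳 𝒵 𝒲 𝒜 → 𝒜 × 𝒳 × 𝒰 := fun o => (act o, ctx o, conf o) with hC
  have hCm : Measurable C := by fun_prop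
  set F : (𝒜 × 𝒳 × 𝒰) × 𝒵 → ℝ := fun p => M.obsXZ p.1 p.2 * b₁ (p.1.2.1, p.1.1, p.2) with hF
  have hFm : Measurable F := (measurable_obsXZ M).mul (hbm.comp (by fun_prop))
  have hFi : Integrable (fun o => F (C o, tprox o)) M.pOb :=
    (integrable_mu_zero_iff M hp0 (f := fun o => b₁ (ctx o, act o, tprox o))
      (hbm.comp (by fun_prop)) fun o => rfl).1 hbi
  have htower := integral_condDistrib_tower M.pOb hCm measurable_tprox hFm hFi
  set f₁ : 𝒜 × 𝒳 × 𝒰 → ℝ := fun c => ∫ z, F (c, z) ∂(condDistrib tprox C M.pOb c) with hf₁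
  have hf₁m : Measurable f₁ := hFm.stronglyMeasurable.integral_kernel_prod_right'.measurable
  have hf₁i : Integrable (fun o => f₁ (C o)) M.pOb := htower.1
  let κY : Kernel ((𝒜 × 𝒳 × 𝒰) × 𝒲) ℝ :=
    M.kY.comap (fun p => (p.1.2.2, p.1.2.1, p.2, p.1.1)) (by fun_prop)
  set R : (𝒜 × 𝒳 × 𝒰) × 𝒲 → ℝ := fun p => ∫ y, G (p.1, (y, p.2)) ∂(κY p) with hR
  have hRm : Measurable R := by
    have h : Measurable fun p : ((𝒜 × 𝒳 × 𝒰) × 𝒲) × ℝ => G (p.1.1, (p.2, p.1.2)) :=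
      hG.comp (by fun_prop)
    exact h.stronglyMeasurable.integral_kernel_prod_right'.measurable
  have hRL : ∀ p, |R p| ≤ L := fun p => by
    have h := norm_integral_le_of_norm_le_const (μ := κY p) (f := fun y => G (p.1, (y, p.2)))
      (C := L) (hGL p.1 p.2)
    simpa using h
  let κW : Kernel (𝒜 × 𝒳 × 𝒰) 𝒲 :=
    (condDistrib oprox (fun o => (conf o, ctx o)) M.pOb).comap (fun c => (c.2.2, c.2.1))
      (by fun_prop)
  set Ψ : 𝒜 × 𝒳 × 𝒰 → ℝ := fun c => ∫ w, R (c, w) ∂(κW c) with hΨ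
  have hΨm : Measurable Ψ := hRm.stronglyMeasurable.integral_kernel_prod_right'.measurable
  have hΨL : ∀ c, |Ψ c| ≤ L := fun c => by
    have h := norm_integral_le_of_norm_le_const (μ := κW c) (f := fun w => R (c, w))
      (C := L) (ae_of_all _ fun w => hRL (c, w))
    simpa using h
  have hGo : ∀ᵐ o ∂M.pOb, ‖G (C o, (rew o, oprox o))‖ ≤ L := by
    have h : ∀ᵐ q ∂(M.actLaw ⊗ₘ M.rewKernel),
        ‖G ((q.1.2, q.1.1.1, q.1.1.2.1), (q.2, q.1.1.2.2.2))‖ ≤ L :=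
      Measure.ae_compProd_of_ae_ae
        (measurableSet_le (hG.comp (by fun_prop)).norm measurable_const)
        (ae_of_all _ fun q => hGL (q.2, q.1.1, q.1.2.1) q.1.2.2.2)
    rw [← map_fst_pOb] at h
    exact ae_of_ae_map measurable_fst.aemeasurable h
  have hGm : Measurable fun o : Trial 𝒰 𝒳 𝒵 𝒲 𝒜 => G (C o, (rew o, oprox o)) :=
    hG.comp (by fun_prop)
  -- Conditional independence is assumed under `pOb`. Passing to that law puts the selection
  -- probability of (R_X, R_Z) into the weight `F`, still a function of (A, X, U) and Z.
  have s1 : ∫ o, b₁ (ctx o, act o, tprox o) * G (C o, (rew o, oprox o)) ∂(M.mu 0) =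
      (M.pOb (pattern 0))⁻¹.toReal *
        ∫ o, F (C o, tprox o) * G (C o, (rew o, oprox o)) ∂M.pOb := by
    rw [integral_mu_zero M (f := fun o => b₁ (ctx o, act o, tprox o) * G (C o, (rew o, oprox o)))
      ((hbm.comp (by fun_prop)).mul hGm) fun o => rfl]
    simp only [hF, mul_assoc]
    rfl
  -- As Z is independent of (Y, W) given (A, X, U), only the conditional mean `f₁` of the weight
  -- matters.
  have s2 : ∫ o, F (C o, tprox o) * G (C o, (rew o, oprox o)) ∂M.pOb =
      ∫ o, f₁ (C o) * G (C o, (rew o, oprox o)) ∂M.pOb := by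
    have h := integral_condDistrib_tower_of_condIndepFun M.pOb hCm measurable_tprox
      (g := fun o => (rew o, oprox o)) (by fun_prop) hPV2
      (F := fun p => F (p.1.1, p.2) * G (p.1.1, p.1.2))
      ((hFm.comp (by fun_prop)).mul (hG.comp (by fun_prop)))
      (hFi.mul_bdd hGm.aestronglyMeasurable hGo)
    rw [h]
    simp only [integral_mul_const, hf₁]
  have s3 : ∫ o, f₁ (C o) * G (C o, (rew o, oprox o)) ∂M.pOb =
      ∫ o, f₁ (C o) * R (C o, oprox o) ∂M.pOb :=
    integral_mul_eq_integral_mul_rewKernel M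
      (f := fun q => f₁ (q.2, q.1.1, q.1.2.1)) (hf₁m.comp (by fun_prop)) hf₁i
      (G := fun q => G ((q.1.2, q.1.1.1, q.1.1.2.1), (q.2, q.1.1.2.2.2)))
      (hG.comp (by fun_prop)) (L := L) fun q => hGL (q.2, q.1.1, q.1.2.1) q.1.2.2.2
  -- As W is independent of A given (U, X), it is integrated against a law that does not depend on
  -- the action.
  have s4 : ∫ o, f₁ (C o) * R (C o, oprox o) ∂M.pOb = ∫ o, f₁ (C o) * Ψ (C o) ∂M.pOb := by
    have h := integral_condDistrib_tower_of_condIndepFun M.pOb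
      (k := fun o : Trial 𝒰 𝒳 𝒵 𝒲 𝒜 => (conf o, ctx o)) (by fun_prop) measurable_oprox
      (g := act) measurable_act hPV1
      (F := fun p => f₁ (p.1.2, p.1.1.2, p.1.1.1) * R ((p.1.2, p.1.1.2, p.1.1.1), p.2))
      ((hf₁m.comp (by fun_prop)).mul (hRm.comp (by fun_prop)))
      (hf₁i.mul_bdd (hRm.comp (f := fun o => (C o, oprox o)) (by fun_prop)).aestronglyMeasurable
        (ae_of_all _ fun o => hRL _))
    rw [show ∫ o, f₁ (C o) * R (C o, oprox o) ∂M.pOb = _ from h]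
    simp only [integral_const_mul]
    rfl
  -- The averaging over Z is undone, since `Ψ` depends on (A, X, U) only; back under `mu 0`, the
  -- defining equation of b₁ applies.
  have s5 : ∫ o, F (C o, tprox o) * Ψ (C o) ∂M.pOb = ∫ o, f₁ (C o) * Ψ (C o) ∂M.pOb := by
    have h := (integral_condDistrib_tower M.pOb hCm measurable_tprox
      (F := fun p => F p * Ψ p.1) (hFm.mul (hΨm.comp (by fun_prop)))
      (hFi.mul_bdd (hΨm.comp hCm).aestronglyMeasurable (ae_of_all _ fun o => hΨL _))).2
    rw [h]
    simp only [integral_mul_const, hf₁]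
  have s6 : ∫ o, b₁ (ctx o, act o, tprox o) * Ψ (C o) ∂(M.mu 0) =
      (M.pOb (pattern 0))⁻¹.toReal * ∫ o, F (C o, tprox o) * Ψ (C o) ∂M.pOb := by
    rw [integral_mu_zero M (f := fun o => b₁ (ctx o, act o, tprox o) * Ψ (C o))
      ((hbm.comp (by fun_prop)).mul (hΨm.comp hCm)) fun o => rfl]
    simp only [hF, mul_assoc]
    rfl
  have s7 : ∫ o, b₁ (ctx o, act o, tprox o) * Ψ (C o) ∂(M.mu 0) =
      ∫ p, ∑ a, Ψ (a, p.1, p.2.1) ∂(M.pTilde ⊗ₘ M.kO) :=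
    integral_shift_mul M hb (f := fun c => Ψ (c.2, c.1.1, c.1.2)) (hΨm.comp (by fun_prop))
      fun c => hΨL _
  have hsR : Measurable fun p : 𝒳 × (𝒰 × 𝒵 × 𝒲) => ∑ a, R ((a, p.1, p.2.1), p.2.2.2) :=
    Finset.measurable_sum _ fun a _ => hRm.comp (by fun_prop)
  have hsΨ : Measurable fun p : 𝒳 × (𝒰 × 𝒵 × 𝒲) => ∑ a, Ψ (a, p.1, p.2.1) :=
    Finset.measurable_sum _ fun a _ => hΨm.comp (by fun_prop)
  -- The law of W given (U, X) is unchanged when the context has law p̃, because this is a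
  -- reweighting by a function of X.
  have s8 : ∫ p, ∑ a, R ((a, p.1, p.2.1), p.2.2.2) ∂(M.pTilde ⊗ₘ M.kO) =
      ∫ p, ∑ a, Ψ (a, p.1, p.2.1) ∂(M.pTilde ⊗ₘ M.kO) := by
    rw [integral_pTilde_compProd M hac hsR, integral_pTilde_compProd M hac hsΨ]
    have hrm : Measurable (ratio M.pTilde M.pX) :=
      (Measure.measurable_rnDeriv _ _).ennreal_toReal
    have hFsum : Measurable fun p : (𝒰 × 𝒳) × 𝒲 => ∑ a, R ((a, p.1.2, p.1.1), p.2) :=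
      Finset.measurable_sum _ fun a _ => hRm.comp (by fun_prop)
    have h := (integral_condDistrib_tower M.pOb
      (k := fun o : Trial 𝒰 𝒳 𝒵 𝒲 𝒜 => (conf o, ctx o)) (by fun_prop) measurable_oprox
      (F := fun p => ratio M.pTilde M.pX p.1.2 * ∑ a, R ((a, p.1.2, p.1.1), p.2))
      ((hrm.comp (by fun_prop)).mul hFsum)
      ((integrable_ratio_pTilde_pX M).mul_bdd (c := ∑ _a : 𝒜, L)
        (hFsum.comp (f := fun o : Trial 𝒰 𝒳 𝒵 𝒲 𝒜 => ((conf o, ctx o), oprox o))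
          (by fun_prop)).aestronglyMeasurable
        (ae_of_all _ fun o => (norm_sum_le _ _).trans (Finset.sum_le_sum fun a _ => hRL _)))).2
    refine Eq.trans h (integral_congr_ae (ae_of_all _ fun o => ?_))
    simp only [integral_const_mul]
    congr 1
    rw [integral_finsetSum]
    · rfl
    · intro a _
      exact Integrable.of_bound (hRm.comp (by fun_prop)).aestronglyMeasurable L
        (ae_of_all _ fun w => hRL _)
  rw [s1, s2, s3, s4, ← s5, ← s6, s7, ← s8]
  rfl

end Shift


/-! ### Identification of the value -/

section Alpha

variable {𝒰 𝒳 𝒵 𝒲 𝒜 : Type*} [MeasurableSpace 𝒳] [MeasurableSpace 𝒲] [MeasurableSpace 𝒜]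

lemma policy_prob_mem (π : Policy 𝒳 𝒲 𝒜) (p : 𝒳 × 𝒲) (a : 𝒜) :
    0 ≤ (π.kernel p).real {a} ∧ (π.kernel p).real {a} ≤ 1 :=
  ⟨measureReal_nonneg, measureReal_le_one⟩

/-- The missingness indicators act through the conditioning alone, which reduces integrals to the
law of the other variables. -/
lemma alpha_fullTrial [Fintype 𝒜] (k : Fin 4) (π : Policy 𝒳 𝒲 𝒜) (h : Bridge 𝒳 𝒵 𝒲 𝒜)
    (o : Trial 𝒰 𝒳 𝒵 𝒲 𝒜) : alpha k π h o = alpha k π h (fullTrial o.1) := by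
  match k with
  | 0 => rfl
  | 1 => rfl
  | 2 => rfl
  | 3 => rfl

end Alpha

section Identification

variable {𝒰 𝒳 𝒵 𝒲 𝒜 : Type*} [MeasurableSpace 𝒰] [MeasurableSpace 𝒳] [MeasurableSpace 𝒵]
  [MeasurableSpace 𝒲] [MeasurableSpace 𝒜] [Fintype 𝒜] [MeasurableSingletonClass 𝒜]
  (M : Model 𝒰 𝒳 𝒵 𝒲 𝒜)

lemma measurable_policy_prob (π : Policy 𝒳 𝒲 𝒜) :
    Measurable fun p : (𝒳 × 𝒲) × 𝒜 => (π.kernel p.1).real {p.2} :=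
  measurable_from_prod_countable_left fun a =>
    (π.kernel.measurable_coe (measurableSet_singleton a)).ennreal_toReal

lemma measurable_alpha (k : Fin 4) (π : Policy 𝒳 𝒲 𝒜) {h : Bridge 𝒳 𝒵 𝒲 𝒜}
    (hm : h.IsMeasurable) : Measurable (alpha k π h : Trial 𝒰 𝒳 𝒵 𝒲 𝒜 → ℝ) := by
  obtain ⟨m1, m2, m3, m4⟩ := hm
  have e1 : Measurable fun o : Trial 𝒰 𝒳 𝒵 𝒲 𝒜 => h.h₁ (rew o, act o, ctx o, tprox o) :=
    m1.comp (by fun_prop)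
  have e3 : Measurable fun o : Trial 𝒰 𝒳 𝒵 𝒲 𝒜 => h.h₃ (rew o, act o, ctx o) :=
    m3.comp (by fun_prop)
  match k with
  | 0 => exact e1
  | 1 =>
    exact ((m2.comp (by fun_prop)).sub e1).sub (measurable_rew.mul
      ((measurable_policy_prob π).comp (f := fun o => ((ctx o, oprox o), act o)) (by fun_prop)))
  | 2 => exact e3.sub (Finset.measurable_sum _ fun a _ => m2.comp (by fun_prop))
  | 3 => exact (m4.comp (by fun_prop)).sub e3

lemma value_eq {LY : ℝ} (hY : ∀ q, ∀ᵐ y ∂(M.kY q), |y| ≤ LY) (π : Policy 𝒳 𝒲 𝒜) :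
    Integrable (fun p : 𝒳 × (𝒰 × 𝒵 × 𝒲) => ∑ a, (∫ y, y ∂(M.kY (p.2.1, p.1, p.2.2.2, a))) *
      (π.kernel (p.1, p.2.2.2)).real {a}) (M.pTilde ⊗ₘ M.kO) ∧
    M.value π = ∫ p, ∑ a, (∫ y, y ∂(M.kY (p.2.1, p.1, p.2.2.2, a))) *
      (π.kernel (p.1, p.2.2.2)).real {a} ∂(M.pTilde ⊗ₘ M.kO) := by
  have hYb : ∀ q, |∫ y, y ∂(M.kY q)| ≤ LY := fun q => by
    have h := norm_integral_le_of_norm_le_const (μ := M.kY q) (f := fun y => y) (C := LY) (hY q)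
    simpa using h
  have hYm : Measurable fun q => ∫ y, y ∂(M.kY q) :=
    (stronglyMeasurable_id.integral_kernel (κ := M.kY)).measurable
  constructor
  · refine Integrable.of_bound (C := ∑ _a : 𝒜, LY)
      (Finset.measurable_sum _ fun a _ => ?_).aestronglyMeasurable (ae_of_all _ fun p => ?_)
    · exact (hYm.comp (f := fun p : 𝒳 × (𝒰 × 𝒵 × 𝒲) => (p.2.1, p.1, p.2.2.2, a))
        (by fun_prop)).mul ((measurable_policy_prob π).comp
          (f := fun p : 𝒳 × (𝒰 × 𝒵 × 𝒲) => ((p.1, p.2.2.2), a)) (by fun_prop))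
    · refine (norm_sum_le _ _).trans (Finset.sum_le_sum fun a _ => ?_)
      rw [norm_mul, Real.norm_eq_abs, Real.norm_eq_abs,
        abs_of_nonneg (policy_prob_mem π (p.1, p.2.2.2) a).1]
      exact (mul_le_of_le_one_right (abs_nonneg _) (policy_prob_mem π (p.1, p.2.2.2) a).2).trans
        (hYb _)
  · have : IsFiniteMeasure (M.pIn π) := by unfold Model.pIn; infer_instance
    have hint : Integrable (fun q : ((𝒳 × (𝒰 × 𝒵 × 𝒲)) × 𝒜) × ℝ => q.2) (M.pIn π) := by
      refine Integrable.of_bound measurable_snd.aestronglyMeasurable LY ?_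
      exact Measure.ae_compProd_of_ae_ae (measurableSet_le (by fun_prop) (by fun_prop))
        (ae_of_all _ fun q => hY _)
    rw [Model.value, Model.pIn, Measure.integral_compProd hint, Measure.integral_compProd]
    · refine integral_congr_ae (ae_of_all _ fun p => ?_)
      simp only [Kernel.comap_apply]
      rw [integral_fintype (Integrable.of_finite)]
      refine Finset.sum_congr rfl fun a _ => ?_
      rw [smul_eq_mul, mul_comm]
    · refine Integrable.of_bound (C := LY) (Measurable.aestronglyMeasurable ?_)
        (ae_of_all _ fun q => hYb _)
      exact hYm.comp (f := fun q : (𝒳 × (𝒰 × 𝒵 × 𝒲)) × 𝒜 => (q.1.2.1, q.1.1, q.1.2.2.2, q.2))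
        (by fun_prop)

variable [StandardBorelSpace 𝒲] [Nonempty 𝒲] [Nonempty 𝒜]

/-- Both weighted laws are `shiftedLaw`, so h₃ cancels; the rest depends on (X, W), whose law comes
from p̃ and `kO`. -/
lemma integral_shiftFun_two_add_three (b₁ : 𝒳 × 𝒜 × 𝒵 → ℝ) (hO : M.Overlap) {LY Lh Lα : ℝ}
    (hY : ∀ q, ∀ᵐ y ∂(M.kY q), |y| ≤ LY) {h : Bridge 𝒳 𝒵 𝒲 𝒜} (hm : h.IsMeasurable)
    (hbd : h.IsBoundedBy LY Lh) (π : Policy 𝒳 𝒲 𝒜)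
    (hα : ∀ k, ∀ o : Trial 𝒰 𝒳 𝒵 𝒲 𝒜, |rew o| ≤ LY → |alpha k π h o| ≤ Lα) :
    (∫ o, M.shiftFun b₁ 2 o * alpha 2 π h o ∂(M.mu 2)) +
      (∫ o, M.shiftFun b₁ 3 o * alpha 3 π h o ∂(M.mu 3)) =
      (∫ x, h.g x ∂M.pTilde) - ∫ p, ∑ a, h.h₂ (a, p.2.2.2, p.1) ∂(M.pTilde ⊗ₘ M.kO) := by
  have := isProbabilityMeasure_shiftedLaw M hO.2.2
  have hrew : ∀ᵐ q ∂M.shiftedLaw, |rew (fullTrial q : Trial 𝒰 𝒳 𝒵 𝒲 𝒜)| ≤ LY := by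
    refine (withDensity_absolutelyContinuous _ _) ?_
    refine (ae_map_iff measurable_fst.aemeasurable ?_).2
      ((mu_absolutelyContinuous M 3) (ae_abs_rew_le M hY))
    exact measurableSet_le (measurable_rew.comp measurable_fullTrial).norm measurable_const
  have hint : ∀ k, Integrable (fun q => alpha k π h (fullTrial q : Trial 𝒰 𝒳 𝒵 𝒲 𝒜))
      M.shiftedLaw := fun k =>
    Integrable.of_bound ((measurable_alpha k π hm).comp measurable_fullTrial).aestronglyMeasurable
      Lα (by filter_upwards [hrew] with q hq using hα k _ hq)
  have h2 : ∫ o, M.shiftFun b₁ 2 o * alpha 2 π h o ∂(M.mu 2) =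
      ∫ q, alpha 2 π h (fullTrial q) ∂M.shiftedLaw :=
    integral_mul_ratio_two M hO (measurable_alpha 2 π hm) (alpha_fullTrial 2 π h)
  have h3 : ∫ o, M.shiftFun b₁ 3 o * alpha 3 π h o ∂(M.mu 3) =
      ∫ q, alpha 3 π h (fullTrial q) ∂M.shiftedLaw :=
    integral_mul_ratio_three M (measurable_alpha 3 π hm) (alpha_fullTrial 3 π h)
  have hg : ∫ x, h.g x ∂M.pTilde = ∫ p, h.g p.1 ∂(M.pTilde ⊗ₘ M.kO) := by
    have hf : M.pTilde = (M.pTilde ⊗ₘ M.kO).map Prod.fst := (Measure.fst_compProd _ _).symm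
    conv_lhs => rw [hf]
    exact integral_map measurable_fst.aemeasurable hm.2.2.2.aestronglyMeasurable
  have hgm : Measurable fun p : 𝒳 × (𝒰 × 𝒵 × 𝒲) => h.g p.1 := hm.2.2.2.comp measurable_fst
  have hsm : Measurable fun p : 𝒳 × (𝒰 × 𝒵 × 𝒲) => ∑ a, h.h₂ (a, p.2.2.2, p.1) :=
    Finset.measurable_sum _ fun a _ => hm.2.1.comp (by fun_prop)
  rw [h2, h3, ← integral_add (hint 2) (hint 3), hg, ← integral_sub, ← map_shiftedLaw M hO.2.2]
  · refine Eq.trans (integral_congr_ae (ae_of_all _ fun q => ?_))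
      (integral_map (f := fun p : 𝒳 × (𝒰 × 𝒵 × 𝒲) => h.g p.1 - ∑ a, h.h₂ (a, p.2.2.2, p.1))
        (by fun_prop) (hgm.sub hsm).aestronglyMeasurable).symm
    simp only [alpha]
    change _ - _ + (_ - _) = h.g (ctx (fullTrial q : Trial 𝒰 𝒳 𝒵 𝒲 𝒜)) -
      ∑ a, h.h₂ (a, oprox (fullTrial q : Trial 𝒰 𝒳 𝒵 𝒲 𝒜), ctx (fullTrial q : Trial 𝒰 𝒳 𝒵 𝒲 𝒜))
    ring
  · exact Integrable.of_bound hgm.aestronglyMeasurable Lh (ae_of_all _ fun p => hbd.2.2.2 _)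
  · refine Integrable.of_bound (C := ∑ _a : 𝒜, Lh) hsm.aestronglyMeasurable
      (ae_of_all _ fun p => ?_)
    exact (norm_sum_le _ _).trans (Finset.sum_le_sum fun a _ => hbd.2.1 _ _ _)

variable [StandardBorelSpace 𝒰] [StandardBorelSpace 𝒳] [StandardBorelSpace 𝒵]

/-- Once b₂ is traded for b₁ under `mu 0`, the terms h₁ cancel. What remains, h₂ - Yπ, does not
involve Z, as `integral_shift_mul_eq` requires. -/
lemma integral_shiftFun_zero_add_one (hPV : M.PVIndependence) {b₁ : 𝒳 × 𝒜 × 𝒵 → ℝ}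
    (hb : M.IsShift b₁) (hO : M.Overlap) {LY Lh Lα : ℝ} (hY : ∀ q, ∀ᵐ y ∂(M.kY q), |y| ≤ LY)
    {h : Bridge 𝒳 𝒵 𝒲 𝒜} (hm : h.IsMeasurable) (hbd : h.IsBoundedBy LY Lh) (π : Policy 𝒳 𝒲 𝒜)
    (hα : ∀ k, ∀ o : Trial 𝒰 𝒳 𝒵 𝒲 𝒜, |rew o| ≤ LY → |alpha k π h o| ≤ Lα) :
    (∫ o, M.shiftFun b₁ 0 o * alpha 0 π h o ∂(M.mu 0)) +
      (∫ o, M.shiftFun b₁ 1 o * alpha 1 π h o ∂(M.mu 1)) =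
      (∫ p, ∑ a, h.h₂ (a, p.2.2.2, p.1) ∂(M.pTilde ⊗ₘ M.kO)) - M.value π := by
  have hp0 : M.pOb (pattern 0) ≠ 0 := pOb_pattern_zero_ne_zero M hb
  obtain ⟨hbm, hbi, -⟩ := id hb
  have hb1 : Measurable fun o : Trial 𝒰 𝒳 𝒵 𝒲 𝒜 => b₁ (ctx o, act o, tprox o) :=
    hbm.comp (by fun_prop)
  have hrew : ∀ᵐ o ∂(M.mu 0), |rew o| ≤ LY := (mu_absolutelyContinuous M 0) (ae_abs_rew_le M hY)
  have hint : ∀ k, Integrable (fun o => b₁ (ctx o, act o, tprox o) * alpha k π h o) (M.mu 0) :=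
    fun k => hbi.mul_bdd (c := Lα) (measurable_alpha k π hm).aestronglyMeasurable
      (by filter_upwards [hrew] with o ho using hα k o ho)
  have h1 : ∫ o, M.shiftFun b₁ 1 o * alpha 1 π h o ∂(M.mu 1) =
      ∫ o, b₁ (ctx o, act o, tprox o) * alpha 1 π h o ∂(M.mu 0) := by
    refine Eq.trans (integral_congr_ae (ae_of_all _ fun o => ?_))
      (integral_mul_ratio_one M hO hp0
        (f := fun o => b₁ (ctx o, act o, tprox o) * alpha 1 π h o)
        (hb1.mul (measurable_alpha 1 π hm)) fun o => by rw [alpha_fullTrial]; rfl)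
    simp only [Model.shiftFun]
    ring
  have h2 := integral_shift_mul_eq M hPV hb (pTilde_absolutelyContinuous_pX M hO.2.2)
    (G := fun p => h.h₂ (p.1.1, p.2.2, p.1.2.1) -
      p.2.1 * (π.kernel (p.1.2.1, p.2.2)).real {p.1.1})
    (L := Lh + LY) ((hm.2.1.comp (by fun_prop)).sub (Measurable.mul (by fun_prop)
      ((measurable_policy_prob π).comp
        (f := fun p : (𝒜 × 𝒳 × 𝒰) × (ℝ × 𝒲) => ((p.1.2.1, p.2.2), p.1.1)) (by fun_prop)))) (by
      intro c w
      filter_upwards [hY (c.2.2, c.2.1, w, c.1)] with y hy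
      obtain ⟨h0, h1⟩ := policy_prob_mem π (c.2.1, w) c.1
      refine (abs_sub _ _).trans (add_le_add (hbd.2.1 _ _ _) ?_)
      rw [abs_mul, abs_of_nonneg h0]
      exact (mul_le_of_le_one_right (abs_nonneg _) h1).trans hy)
  have h3 : (∫ o, M.shiftFun b₁ 0 o * alpha 0 π h o ∂(M.mu 0)) +
      (∫ o, M.shiftFun b₁ 1 o * alpha 1 π h o ∂(M.mu 1)) =
      ∫ o, b₁ (ctx o, act o, tprox o) * (h.h₂ (act o, oprox o, ctx o) -
        rew o * (π.kernel (ctx o, oprox o)).real {act o}) ∂(M.mu 0) := by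
    rw [h1]
    refine Eq.trans (integral_add (hint 0) (hint 1)).symm
      (integral_congr_ae (ae_of_all _ fun o => ?_))
    simp only [alpha]
    ring
  obtain ⟨hvi, hv⟩ := value_eq M hY π
  rw [h3, hv, ← integral_sub _ hvi]
  · refine Eq.trans h2 (integral_congr_ae (ae_of_all _ fun p => ?_))
    simp only [← Finset.sum_sub_distrib]
    refine Finset.sum_congr rfl fun a _ => ?_
    have hyi : Integrable (fun y : ℝ => y) (M.kY (p.2.1, p.1, p.2.2.2, a)) :=
      Integrable.of_bound measurable_id.aestronglyMeasurable LY (hY _)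
    rw [integral_sub (integrable_const _) (hyi.mul_const _), integral_mul_const]
    simp
  · refine Integrable.of_bound (C := ∑ _a : 𝒜, Lh)
      (Finset.measurable_sum _ fun a _ => ?_).aestronglyMeasurable (ae_of_all _ fun p => ?_)
    · exact hm.2.1.comp (by fun_prop)
    · exact (norm_sum_le _ _).trans (Finset.sum_le_sum fun a _ => hbd.2.1 _ _ _)

/-- The error of a bounded candidate as an average of the residuals of the four equations. -/
theorem integral_g_sub_value (hPV : M.PVIndependence) {b₁ : 𝒳 × 𝒜 × 𝒵 → ℝ} (hb : M.IsShift b₁)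
    (hO : M.Overlap) {LY Lh Lα : ℝ} (hY : ∀ q, ∀ᵐ y ∂(M.kY q), |y| ≤ LY)
    {h : Bridge 𝒳 𝒵 𝒲 𝒜} (hm : h.IsMeasurable) (hbd : h.IsBoundedBy LY Lh) (π : Policy 𝒳 𝒲 𝒜)
    (hα : ∀ k, ∀ o : Trial 𝒰 𝒳 𝒵 𝒲 𝒜, |rew o| ≤ LY → |alpha k π h o| ≤ Lα) :
    (∫ x, h.g x ∂M.pTilde) - M.value π =
      ∑ k, ∫ o, M.shiftFun b₁ k o * alpha k π h o ∂(M.mu k) := by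
  rw [Fin.sum_univ_four, integral_shiftFun_zero_add_one M hPV hb hO hY hm hbd π hα, add_assoc,
    integral_shiftFun_two_add_three M b₁ hO hY hm hbd π hα]
  ring

end Identification


/-! ### Square integrable functions -/

section SquareIntegrable

variable {S : Type*} [MeasurableSpace S] {μ : Measure S} {f g : S → ℝ}

lemma eLpNorm_two_eq_ofReal_sqrt (hf : MemLp f 2 μ) :
    eLpNorm f 2 μ = ENNReal.ofReal √(∫ s, f s ^ 2 ∂μ) := by
  rw [hf.eLpNorm_eq_integral_rpow_norm (by norm_num) (by norm_num), Real.sqrt_eq_rpow]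
  congr 2
  · refine integral_congr_ae (ae_of_all _ fun s => ?_)
    simp
  · norm_num

lemma enorm_integral_mul_le (hf : AEStronglyMeasurable f μ) (hg : AEStronglyMeasurable g μ) :
    ‖∫ s, f s * g s ∂μ‖ₑ ≤ eLpNorm f 2 μ * eLpNorm g 2 μ := by
  refine (enorm_integral_le_lintegral_enorm _).trans ?_
  have h := eLpNorm_smul_le_mul_eLpNorm (p := 2) (q := 2) (r := 1) hg hf
  rwa [eLpNorm_one_eq_lintegral_enorm] at h

lemma abs_integral_mul_le (hf : MemLp f 2 μ) (hg : MemLp g 2 μ) :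
    |∫ s, f s * g s ∂μ| ≤ √(∫ s, f s ^ 2 ∂μ) * √(∫ s, g s ^ 2 ∂μ) := by
  have h := enorm_integral_mul_le hf.aestronglyMeasurable hg.aestronglyMeasurable
  rw [eLpNorm_two_eq_ofReal_sqrt hf, eLpNorm_two_eq_ofReal_sqrt hg,
    ← ENNReal.ofReal_mul (Real.sqrt_nonneg _), Real.enorm_eq_ofReal_abs] at h
  exact (ENNReal.ofReal_le_ofReal_iff (by positivity)).1 h

/-- If `g` is at distance at most `ε` of `f`, then `⟪g, f⟫` and `‖g‖` are close to `‖f‖²` and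
`‖f‖`. -/
lemma integral_mul_and_norm_of_dist_le (hf : MemLp f 2 μ) (hg : MemLp g 2 μ) {ε : ℝ}
    (h : √(∫ s, (g s - f s) ^ 2 ∂μ) ≤ ε) :
    √(∫ s, f s ^ 2 ∂μ) ^ 2 - √(∫ s, f s ^ 2 ∂μ) * ε ≤ ∫ s, g s * f s ∂μ ∧
      √(∫ s, g s ^ 2 ∂μ) ≤ √(∫ s, f s ^ 2 ∂μ) + ε := by
  have hd : MemLp (fun s => g s - f s) 2 μ := hg.sub hf
  have hdf : Integrable (fun s => (g s - f s) * f s) μ := hd.integrable_mul hf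
  have h0 : 0 ≤ ∫ s, f s ^ 2 ∂μ := integral_nonneg fun s => sq_nonneg _
  have h1 := abs_le.1 (abs_integral_mul_le hd hf)
  have hε := (Real.sqrt_nonneg _).trans h
  have h2 : √(∫ s, (g s - f s) ^ 2 ∂μ) * √(∫ s, f s ^ 2 ∂μ) ≤ √(∫ s, f s ^ 2 ∂μ) * ε := by
    rw [mul_comm]
    exact mul_le_mul_of_nonneg_left h (Real.sqrt_nonneg _)
  have e1 : ∫ s, g s * f s ∂μ = (∫ s, (g s - f s) * f s ∂μ) + ∫ s, f s ^ 2 ∂μ := by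
    rw [← integral_add hdf hf.integrable_sq]
    exact integral_congr_ae (ae_of_all _ fun s => by ring)
  have e2 : ∫ s, g s ^ 2 ∂μ =
      (∫ s, (g s - f s) ^ 2 ∂μ) + (2 * ∫ s, (g s - f s) * f s ∂μ) + ∫ s, f s ^ 2 ∂μ := by
    have hi : Integrable (fun s => (g s - f s) ^ 2 + 2 * ((g s - f s) * f s)) μ :=
      hd.integrable_sq.add (hdf.const_mul 2)
    rw [← integral_const_mul, ← integral_add hd.integrable_sq (hdf.const_mul 2),
      ← integral_add hi hf.integrable_sq]
    exact integral_congr_ae (ae_of_all _ fun s => by ring)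
  have h3 : ∫ s, (g s - f s) ^ 2 ∂μ ≤ ε ^ 2 := by
    rw [← Real.sq_sqrt (integral_nonneg fun s => sq_nonneg (g s - f s))]
    exact pow_le_pow_left₀ (Real.sqrt_nonneg _) h 2
  have h4 := Real.sq_sqrt h0
  refine ⟨by rw [e1, h4]; linarith, ?_⟩
  rw [Real.sqrt_le_left (by positivity)]
  nlinarith

end SquareIntegrable

/-! ### Conditional residuals -/

section Residuals

variable {𝒰 𝒳 𝒵 𝒲 𝒜 : Type*} [MeasurableSpace 𝒰] [MeasurableSpace 𝒳] [MeasurableSpace 𝒵]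
  [MeasurableSpace 𝒲] [MeasurableSpace 𝒜]

lemma condSigma_le (k : Fin 4) : (condSigma k : MeasurableSpace (Trial 𝒰 𝒳 𝒵 𝒲 𝒜)) ≤
    Prod.instMeasurableSpace := by
  match k with
  | 0 => exact Measurable.comap_le (by fun_prop)
  | 1 => exact Measurable.comap_le (by fun_prop)
  | 2 => exact Measurable.comap_le (by fun_prop)
  | 3 => exact Measurable.comap_le (by fun_prop)

lemma measurable_shiftFun [StandardBorelSpace 𝒲] [StandardBorelSpace 𝒜] [Nonempty 𝒲] [Nonempty 𝒜]
    (M : Model 𝒰 𝒳 𝒵 𝒲 𝒜) {b₁ : 𝒳 × 𝒜 × 𝒵 → ℝ} (hb : Measurable b₁) (k : Fin 4) :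
    Measurable[condSigma k] (M.shiftFun b₁ k) := by
  match k with
  | 0 =>
    exact (hb.comp (f := fun c : 𝒜 × 𝒳 × 𝒵 => (c.2.1, c.1, c.2.2)) (by fun_prop)).comp
      (comap_measurable fun o : Trial 𝒰 𝒳 𝒵 𝒲 𝒜 => (act o, ctx o, tprox o))
  | 1 =>
    exact ((hb.comp (f := fun c : 𝒜 × 𝒲 × 𝒳 × 𝒵 => (c.2.2.1, c.1, c.2.2.2)) (by fun_prop)).mul
      ((Measure.measurable_rnDeriv _ _).ennreal_toReal.comp
        (f := fun c : 𝒜 × 𝒲 × 𝒳 × 𝒵 => (c.1, c.2.1, c.2.2.1)) (by fun_prop))).comp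
      (comap_measurable fun o : Trial 𝒰 𝒳 𝒵 𝒲 𝒜 => (act o, oprox o, ctx o, tprox o))
  | 2 =>
    exact ((Measure.measurable_rnDeriv _ _).ennreal_toReal.comp
        (f := fun c : 𝒜 × 𝒲 × 𝒳 => (c.2.2, (c.1, c.2.1))) (by fun_prop)).comp
      (comap_measurable fun o : Trial 𝒰 𝒳 𝒵 𝒲 𝒜 => (act o, oprox o, ctx o))
  | 3 =>
    exact (Measure.measurable_rnDeriv _ _).ennreal_toReal.comp
      (comap_measurable fun o : Trial 𝒰 𝒳 𝒵 𝒲 𝒜 => ctx o)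

variable [Fintype 𝒜] (M : Model 𝒰 𝒳 𝒵 𝒲 𝒜) {k : Fin 4} {π : Policy 𝒳 𝒲 𝒜}
  {h : Bridge 𝒳 𝒵 𝒲 𝒜} {Lα : ℝ}

/-- `b` is a function of the conditioning variables and passes through the conditional expectation.
It will be a weight bₖ or a test function. -/
lemma integral_mul_alpha_eq
    (hm : Measurable (alpha k π h : Trial 𝒰 𝒳 𝒵 𝒲 𝒜 → ℝ))
    (hα : ∀ᵐ o ∂(M.mu k), |alpha k π h o| ≤ Lα)
    {b : Trial 𝒰 𝒳 𝒵 𝒲 𝒜 → ℝ} (hb : Measurable[condSigma k] b) (hbi : Integrable b (M.mu k)) :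
    ∫ o, b o * alpha k π h o ∂(M.mu k) = ∫ o, b o * M.opT k π h o ∂(M.mu k) := by
  have hαi : Integrable (alpha k π h) (M.mu k) :=
    Integrable.of_bound hm.aestronglyMeasurable Lα hα
  have h1 := condExp_mul_of_stronglyMeasurable_left (μ := M.mu k) hb.stronglyMeasurable
    (hbi.mul_bdd hm.aestronglyMeasurable hα) hαi
  rw [← integral_condExp (condSigma_le k)]
  exact integral_congr_ae h1

lemma memLp_opT (hα : ∀ᵐ o ∂(M.mu k), |alpha k π h o| ≤ Lα) : MemLp (M.opT k π h) 2 (M.mu k) := by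
  refine MemLp.of_bound ?_ Lα (ae_bdd_abs_condExp_of_ae_bdd_abs hα)
  exact (stronglyMeasurable_condExp.mono (condSigma_le k)).aestronglyMeasurable

lemma eLpNorm_opT_le_of_rmse_le (hα : ∀ k, ∀ᵐ o ∂(M.mu k), |alpha k π h o| ≤ Lα) {ε : ℝ}
    (hε : M.rmse π h ≤ ε) (k : Fin 4) :
    eLpNorm (M.opT k π h) 2 (M.mu k) ≤ ENNReal.ofReal ε := by
  rw [eLpNorm_two_eq_ofReal_sqrt (memLp_opT M (hα k))]
  refine ENNReal.ofReal_le_ofReal (le_trans (Real.sqrt_le_sqrt ?_) hε)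
  exact Finset.single_le_sum (f := fun k => ∫ o, (M.opT k π h o) ^ 2 ∂(M.mu k))
    (fun k _ => integral_nonneg fun o => sq_nonneg _) (Finset.mem_univ k)

end Residuals

/-! ### The empirical loss on data with uniformly close means -/

section EmpiricalLoss

/-- Here s is the norm of a test function, τ that of the residual, m and n the empirical mean and
square norm. Closeness leaves (τ + rL)s - s²/4 + 3r²/2, and completing the square gives (τ + rL)² +
3r²/2. -/
lemma loss_le_of_close {m n I s τ L r : ℝ} (hm : |m - I| ≤ r * (L * s + r))
    (hn : |n - s ^ 2| ≤ 1 / 2 * s ^ 2 + r ^ 2) (hI : I ≤ τ * s) :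
    m - 1 / 2 * n ≤ 2 * τ ^ 2 + (2 * L ^ 2 + 3 / 2) * r ^ 2 := by
  have h1 := (abs_le.1 hm).2
  have h2 := (abs_le.1 hn).1
  nlinarith [sq_nonneg (s / 2 - (τ + r * L)), sq_nonneg (τ - r * L)]

/-- Meant for half of a test function near the residual. Up to lower order its gain is τ²/2, while
its cost is 3/4 · (τ/2)² because the empirical square norm may be 3/2 of the true one. The surplus
5τ²/16 must stay below multiples of B² and τB. -/
lemma residual_le_of_loss_le {m n I s τ L r ε B : ℝ} (hL : 0 ≤ L) (hr : 0 ≤ r) (hτ : 0 ≤ τ)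
    (hs : 0 ≤ s) (hB : 0 < B) (hm : |m - I| ≤ r * (L * s + r))
    (hn : |n - s ^ 2| ≤ 1 / 2 * s ^ 2 + r ^ 2) (hI : (τ ^ 2 - τ * ε) / 2 ≤ I)
    (hsτ : s ≤ (τ + ε) / 2) (hloss : m - 1 / 2 * n ≤ 2 * B ^ 2) (hε : ε ≤ B) (hrB : r ≤ B / 2) :
    τ ≤ (8 + 2 * L) * B := by
  have h1 := (abs_le.1 hm).1
  have h2 := (abs_le.1 hn).2
  have hs' : s ≤ (τ + B) / 2 := by linarith
  have hrs : r * (L * s + r) ≤ B / 2 * (L * ((τ + B) / 2) + B / 2) := by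
    gcongr
  have hr2 : r ^ 2 ≤ (B / 2) ^ 2 := pow_le_pow_left₀ hr hrB 2
  have hs2 : s ^ 2 ≤ ((τ + B) / 2) ^ 2 := pow_le_pow_left₀ hs hs' 2
  have hτε : τ * ε ≤ τ * B := mul_le_mul_of_nonneg_left hε hτ
  have key : 5 / 16 * τ ^ 2 ≤ τ * B * (7 / 8 + L / 4) + B ^ 2 * (3 + L / 4) := by nlinarith
  by_contra! hlt
  have h3 : (8 + 2 * L) * B * τ ≤ τ * τ := mul_le_mul_of_nonneg_right hlt.le hτ
  have h4 : 0 ≤ L * B := mul_nonneg hL hB.le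
  have h5 : 8 * B * B ≤ τ * B := mul_le_mul_of_nonneg_right (by nlinarith) hB.le
  have h6 : 8 * B * B * L ≤ τ * B * L := mul_le_mul_of_nonneg_right h5 hL
  nlinarith [mul_pos hB hB]

variable {𝒰 𝒳 𝒵 𝒲 𝒜 : Type*}

lemma sq_empNorm {T : ℕ} (D : Fin T → Trial 𝒰 𝒳 𝒵 𝒲 𝒜) (k : Fin 4)
    (f : Trial 𝒰 𝒳 𝒵 𝒲 𝒜 → ℝ) : empNorm D k f ^ 2 = empMean D k fun o => f o ^ 2 :=
  Real.sq_sqrt (div_nonneg (Finset.sum_nonneg fun _ _ => sq_nonneg _) (Nat.cast_nonneg _))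

lemma empMean_zero {T : ℕ} (D : Fin T → Trial 𝒰 𝒳 𝒵 𝒲 𝒜) (k : Fin 4) :
    empMean D k (fun _ => 0) = 0 := by
  simp [empMean]

variable [MeasurableSpace 𝒰] [MeasurableSpace 𝒳] [MeasurableSpace 𝒵]
  [MeasurableSpace 𝒲] [MeasurableSpace 𝒜]

variable [Fintype 𝒜] (M : Model 𝒰 𝒳 𝒵 𝒲 𝒜) {Pol : Set (Policy 𝒳 𝒲 𝒜)}
  {H : Set (Bridge 𝒳 𝒵 𝒲 𝒜)} {Θ : Fin 4 → Set (Trial 𝒰 𝒳 𝒵 𝒲 𝒜 → ℝ)} {LY Lh Lα Lθ : ℝ}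

/-- On the data `D`, empirical means are uniformly close to the population ones, for the classes of
all four equations. -/
def GoodData {T : ℕ} (Pol : Set (Policy 𝒳 𝒲 𝒜)) (H : Set (Bridge 𝒳 𝒵 𝒲 𝒜))
    (Θ : Fin 4 → Set (Trial 𝒰 𝒳 𝒵 𝒲 𝒜 → ℝ)) (η : Fin 4 → ℝ)
    (D : Fin T → Trial 𝒰 𝒳 𝒵 𝒲 𝒜) : Prop :=
  ∀ k, 0 ≤ η k ∧ UniformlyClose M D k (Θ k) (η k / 2) ∧
    UniformlyClose M D k (classQ Pol H Θ k) (η k / 2)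

lemma ae_mu_abs_alpha_le (hR : M.Regular Pol H Θ LY Lh Lα Lθ) {π : Policy 𝒳 𝒲 𝒜} (hπ : π ∈ Pol)
    {h : Bridge 𝒳 𝒵 𝒲 𝒜} (hh : h ∈ H) (k : Fin 4) :
    ∀ᵐ o ∂(M.mu k), |alpha k π h o| ≤ Lα := by
  filter_upwards [(mu_absolutelyContinuous M k) (ae_abs_rew_le M hR.1)] with o ho
  exact hR.2.2.1 π hπ h hh k o ho

lemma memLp_test (hR : M.Regular Pol H Θ LY Lh Lα Lθ) {k : Fin 4}
    {θ : Trial 𝒰 𝒳 𝒵 𝒲 𝒜 → ℝ} (hθ : θ ∈ Θ k) : MemLp θ 2 (M.mu k) :=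
  MemLp.of_bound ((hR.2.2.2 k θ hθ).1.mono (condSigma_le k) le_rfl).aestronglyMeasurable Lθ
    (ae_of_all _ (hR.2.2.2 k θ hθ).2)

variable [MeasurableSingletonClass 𝒜] {T : ℕ} {D : Fin T → Trial 𝒰 𝒳 𝒵 𝒲 𝒜} {η : Fin 4 → ℝ}
  {π : Policy 𝒳 𝒲 𝒜} {h : Bridge 𝒳 𝒵 𝒲 𝒜}

lemma GoodData.close (hD : GoodData M Pol H Θ η D) (hR : M.Regular Pol H Θ LY Lh Lα Lθ)
    (hLα : 0 ≤ Lα) (hπ : π ∈ Pol) (hh : h ∈ H) {k : Fin 4} {θ : Trial 𝒰 𝒳 𝒵 𝒲 𝒜 → ℝ}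
    (hθ : θ ∈ Θ k) :
    |empMean D k (fun o => alpha k π h o * θ o) - ∫ o, θ o * M.opT k π h o ∂(M.mu k)| ≤
      η k / 2 * (Lα * √(∫ o, θ o ^ 2 ∂(M.mu k)) + η k / 2) ∧
    |empNorm D k θ ^ 2 - √(∫ o, θ o ^ 2 ∂(M.mu k)) ^ 2| ≤
      1 / 2 * √(∫ o, θ o ^ 2 ∂(M.mu k)) ^ 2 + (η k / 2) ^ 2 := by
  obtain ⟨hη, hΘ, hQ⟩ := hD k
  have hα := ae_mu_abs_alpha_le M hR hπ hh k
  have hm := measurable_alpha (𝒰 := 𝒰) k π (hR.2.1 h hh).1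
  have hθ2 := memLp_test M hR hθ
  constructor
  · have h1 := hQ.2 (fun o => alpha k π h o * θ o) ⟨π, hπ, h, hh, θ, hθ, rfl⟩
    have h2 : ∫ o, alpha k π h o * θ o ∂(M.mu k) = ∫ o, θ o * M.opT k π h o ∂(M.mu k) := by
      rw [← integral_mul_alpha_eq M hm hα (hR.2.2.2 k θ hθ).1 (hθ2.integrable (by norm_num))]
      exact integral_congr_ae (ae_of_all _ fun o => mul_comm _ _)
    have h3 : √(∫ o, (alpha k π h o * θ o) ^ 2 ∂(M.mu k)) ≤
        Lα * √(∫ o, θ o ^ 2 ∂(M.mu k)) := by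
      rw [← Real.sqrt_sq hLα, ← Real.sqrt_mul (sq_nonneg _), ← integral_const_mul]
      refine Real.sqrt_le_sqrt (integral_mono_of_nonneg (ae_of_all _ fun o => sq_nonneg _)
        (hθ2.integrable_sq.const_mul _) ?_)
      filter_upwards [hα] with o ho
      rw [mul_pow]
      refine mul_le_mul_of_nonneg_right ?_ (sq_nonneg _)
      rw [← sq_abs]
      exact pow_le_pow_left₀ (abs_nonneg _) ho 2
    rw [h2] at h1
    refine h1.trans ?_
    gcongr
  · rw [sq_empNorm, Real.sq_sqrt (integral_nonneg fun o => sq_nonneg _)]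
    exact hΘ.1 θ hθ

lemma GoodData.loss_le (hD : GoodData M Pol H Θ η D) (hR : M.Regular Pol H Θ LY Lh Lα Lθ)
    (hLα : 0 ≤ Lα) (hπ : π ∈ Pol) (hh : h ∈ H) {k : Fin 4} {θ : Trial 𝒰 𝒳 𝒵 𝒲 𝒜 → ℝ}
    (hθ : θ ∈ Θ k) :
    empMean D k (fun o => alpha k π h o * θ o) - 1 / 2 * empNorm D k θ ^ 2 ≤
      2 * (∫ o, (M.opT k π h o) ^ 2 ∂(M.mu k)) + (2 * Lα ^ 2 + 5 / 4) * η k ^ 2 := by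
  obtain ⟨h1, h2⟩ := hD.close M hR hLα hπ hh hθ
  have hT := memLp_opT M (ae_mu_abs_alpha_le M hR hπ hh k)
  have h3 := loss_le_of_close h1 h2 (τ := √(∫ o, (M.opT k π h o) ^ 2 ∂(M.mu k))) (by
    rw [mul_comm]
    exact (le_abs_self _).trans (abs_integral_mul_le (memLp_test M hR hθ) hT))
  rw [Real.sq_sqrt (integral_nonneg fun o => sq_nonneg _)] at h3
  -- The scale is ηₖ/2, and (2Lα² + 3/2)/4 ≤ 2Lα² + 5/4.
  nlinarith [sq_nonneg (η k), sq_nonneg (Lα * η k)]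

lemma GoodData.bddAbove (hD : GoodData M Pol H Θ η D) (hR : M.Regular Pol H Θ LY Lh Lα Lθ)
    (hLα : 0 ≤ Lα) (hπ : π ∈ Pol) (hh : h ∈ H) (k : Fin 4) :
    BddAbove (Set.range fun θ : Θ k =>
      empMean D k (fun o => alpha k π h o * θ.1 o) - 1 / 2 * empNorm D k θ.1 ^ 2) :=
  ⟨_, by rintro _ ⟨θ, rfl⟩; exact hD.loss_le M hR hLα hπ hh θ.2⟩

/-- Witnessed by the zero test function; it lets the total loss dominate each of its four terms. -/
lemma GoodData.sup_nonneg (hD : GoodData M Pol H Θ η D) (hR : M.Regular Pol H Θ LY Lh Lα Lθ)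
    (hLα : 0 ≤ Lα) (hΘ0 : ∀ k, (0 : Trial 𝒰 𝒳 𝒵 𝒲 𝒜 → ℝ) ∈ Θ k) (hπ : π ∈ Pol) (hh : h ∈ H)
    (k : Fin 4) :
    0 ≤ ⨆ θ : Θ k,
      (empMean D k (fun o => alpha k π h o * θ.1 o) - 1 / 2 * empNorm D k θ.1 ^ 2) := by
  refine le_trans (le_of_eq ?_) (le_ciSup (hD.bddAbove M hR hLα hπ hh k) ⟨0, hΘ0 k⟩)
  simp [sq_empNorm, empMean_zero]

lemma GoodData.empLoss_nonneg (hD : GoodData M Pol H Θ η D) (hR : M.Regular Pol H Θ LY Lh Lα Lθ)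
    (hLα : 0 ≤ Lα) (hΘ0 : ∀ k, (0 : Trial 𝒰 𝒳 𝒵 𝒲 𝒜 → ℝ) ∈ Θ k) (hπ : π ∈ Pol) (hh : h ∈ H) :
    0 ≤ empLoss Θ D π h :=
  Finset.sum_nonneg fun k _ => hD.sup_nonneg M hR hLα hΘ0 hπ hh k

lemma GoodData.empLoss_le (hD : GoodData M Pol H Θ η D) (hR : M.Regular Pol H Θ LY Lh Lα Lθ)
    (hLα : 0 ≤ Lα) (hΘ0 : ∀ k, (0 : Trial 𝒰 𝒳 𝒵 𝒲 𝒜 → ℝ) ∈ Θ k) (hπ : π ∈ Pol) (hh : h ∈ H)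
    {εH : ℝ} (hε : M.rmse π h ≤ εH) :
    empLoss Θ D π h ≤ 2 * εH ^ 2 + (2 * Lα ^ 2 + 5 / 4) * ∑ k, η k ^ 2 := by
  have h1 : ∑ k, ∫ o, (M.opT k π h o) ^ 2 ∂(M.mu k) ≤ εH ^ 2 := by
    rw [← Real.sq_sqrt (Finset.sum_nonneg fun k _ => integral_nonneg fun o => sq_nonneg
      (M.opT k π h o) : 0 ≤ ∑ k, ∫ o, (M.opT k π h o) ^ 2 ∂(M.mu k))]
    exact pow_le_pow_left₀ (Real.sqrt_nonneg _) hε 2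
  have h2 : empLoss Θ D π h ≤ ∑ k, (2 * (∫ o, (M.opT k π h o) ^ 2 ∂(M.mu k)) +
      (2 * Lα ^ 2 + 5 / 4) * η k ^ 2) := by
    refine Finset.sum_le_sum fun k _ => ?_
    have : Nonempty (Θ k) := ⟨⟨0, hΘ0 k⟩⟩
    exact ciSup_le fun θ => hD.loss_le M hR hLα hπ hh θ.2
  rw [Finset.sum_add_distrib, ← Finset.mul_sum, ← Finset.mul_sum] at h2
  linarith

/-- A small empirical loss forces small conditional residuals. -/
lemma GoodData.eLpNorm_opT_le (hD : GoodData M Pol H Θ η D) (hR : M.Regular Pol H Θ LY Lh Lα Lθ)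
    (hLα : 0 ≤ Lα) (hΘ0 : ∀ k, (0 : Trial 𝒰 𝒳 𝒵 𝒲 𝒜 → ℝ) ∈ Θ k)
    (hstar : ∀ k, StarConvex ℝ 0 (Θ k)) {εΘ : ℝ} (hεΘ : 0 ≤ εΘ) (hC : M.Compatible Pol H Θ εΘ)
    (hπ : π ∈ Pol) (hh : h ∈ H) {e : ℝ} (he : 0 < e) (hloss : empLoss Θ D π h ≤ 2 * e)
    (k : Fin 4) : eLpNorm (M.opT k π h) 2 (M.mu k) ≤
      ENNReal.ofReal ((8 + 2 * Lα) * (εΘ + √e + √(∑ k, η k ^ 2))) := by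
  have hT := memLp_opT M (ae_mu_abs_alpha_le M hR hπ hh k)
  have hse : 0 < √e := Real.sqrt_pos.2 he
  -- The infimum in `Compatible` need not be attained; √e > 0 provides the slack.
  obtain ⟨θ, hθ, hθε⟩ : ∃ θ ∈ Θ k, eLpNorm (fun o => θ o - M.opT k π h o) 2 (M.mu k) <
      ENNReal.ofReal (εΘ + √e) := by
    have h1 := (hC π hπ h hh k).trans_lt
      ((ENNReal.ofReal_lt_ofReal_iff (by positivity)).2 (lt_add_of_pos_right εΘ hse))
    simpa only [iInf_lt_iff, exists_prop] using h1
  have hθ2 := memLp_test M hR hθ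
  have hdist : √(∫ o, (θ o - M.opT k π h o) ^ 2 ∂(M.mu k)) ≤ εΘ + √e := by
    rw [eLpNorm_two_eq_ofReal_sqrt (f := fun o => θ o - M.opT k π h o) (hθ2.sub hT)] at hθε
    exact ((ENNReal.ofReal_lt_ofReal_iff (by positivity)).1 hθε).le
  obtain ⟨hin, hno⟩ := integral_mul_and_norm_of_dist_le hT hθ2 hdist
  have hhalf : (fun o => 1 / 2 * θ o) ∈ Θ k := by
    have h1 := hstar k hθ (a := 1 / 2) (b := 1 / 2) (by norm_num) (by norm_num) (by norm_num)
    convert h1 using 1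
    funext o
    simp
  obtain ⟨hm, hn⟩ := hD.close M hR hLα hπ hh hhalf
  have hI : ∫ o, 1 / 2 * θ o * M.opT k π h o ∂(M.mu k) =
      1 / 2 * ∫ o, θ o * M.opT k π h o ∂(M.mu k) := by
    simp only [mul_assoc]
    exact integral_const_mul _ _
  have hs : √(∫ o, (1 / 2 * θ o) ^ 2 ∂(M.mu k)) = 1 / 2 * √(∫ o, θ o ^ 2 ∂(M.mu k)) := by
    simp only [mul_pow]
    rw [integral_const_mul, Real.sqrt_mul (by positivity), Real.sqrt_sq (by norm_num)]
  rw [hI, hs] at hm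
  rw [hs] at hn
  have hηk : η k ≤ √(∑ k, η k ^ 2) := Real.le_sqrt_of_sq_le
    (Finset.single_le_sum (f := fun k => η k ^ 2) (fun k _ => sq_nonneg _) (Finset.mem_univ k))
  have hη := (hD k).1
  have hterm : empMean D k (fun o => alpha k π h o * (1 / 2 * θ o)) -
      1 / 2 * empNorm D k (fun o => 1 / 2 * θ o) ^ 2 ≤ 2 * (εΘ + √e + √(∑ k, η k ^ 2)) ^ 2 := by
    have h1 := le_ciSup (hD.bddAbove M hR hLα hπ hh k) ⟨_, hhalf⟩
    have h2 := Finset.single_le_sum (f := fun k => ⨆ θ : Θ k,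
      (empMean D k (fun o => alpha k π h o * θ.1 o) - 1 / 2 * empNorm D k θ.1 ^ 2))
      (fun k _ => hD.sup_nonneg M hR hLα hΘ0 hπ hh k) (Finset.mem_univ k)
    have h3 : e ≤ (εΘ + √e + √(∑ k, η k ^ 2)) ^ 2 := by
      rw [← Real.sq_sqrt he.le]
      refine pow_le_pow_left₀ hse.le ?_ 2
      rw [Real.sq_sqrt he.le]
      linarith [Real.sqrt_nonneg (∑ k, η k ^ 2)]
    exact h1.trans (h2.trans (hloss.trans (by linarith)))
  rw [eLpNorm_two_eq_ofReal_sqrt hT]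
  refine ENNReal.ofReal_le_ofReal ?_
  refine residual_le_of_loss_le (ε := εΘ + √e) hLα (by linarith) (Real.sqrt_nonneg _)
    (by positivity) (by positivity) hm hn ?_ ?_ hterm ?_ ?_
  · linarith
  · linarith
  · linarith [Real.sqrt_nonneg (∑ k, η k ^ 2)]
  · linarith

end EmpiricalLoss


/-! ### Star-shaped classes and the probability of good data -/

section Star

variable {𝒰 𝒳 𝒵 𝒲 𝒜 : Type*} [MeasurableSpace 𝒳] [MeasurableSpace 𝒲] [MeasurableSpace 𝒜]
  [Fintype 𝒜] {Pol : Set (Policy 𝒳 𝒲 𝒜)} {H : Set (Bridge 𝒳 𝒵 𝒲 𝒜)}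
  {Θ : Fin 4 → Set (Trial 𝒰 𝒳 𝒵 𝒲 𝒜 → ℝ)}

lemma zero_mem_classQ (h0 : ∀ k, (0 : Trial 𝒰 𝒳 𝒵 𝒲 𝒜 → ℝ) ∈ Θ k) {π : Policy 𝒳 𝒲 𝒜}
    (hπ : π ∈ Pol) (hH : H.Nonempty) (k : Fin 4) :
    (0 : Trial 𝒰 𝒳 𝒵 𝒲 𝒜 → ℝ) ∈ classQ Pol H Θ k := by
  obtain ⟨h, hh⟩ := hH
  exact ⟨π, hπ, h, hh, 0, h0 k, by funext o; simp⟩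

lemma starConvex_classQ (hstar : ∀ k, StarConvex ℝ 0 (Θ k)) (k : Fin 4) :
    StarConvex ℝ 0 (classQ Pol H Θ k) := by
  rintro _ ⟨π, hπ, h, hh, θ, hθ, rfl⟩ a b ha hb hab
  refine ⟨π, hπ, h, hh, _, hstar k hθ ha hb hab, ?_⟩
  funext o
  simp only [smul_zero, zero_add, Pi.smul_apply, smul_eq_mul]
  ring

end Star

variable {𝒰 𝒳 𝒵 𝒲 𝒜 : Type*} [MeasurableSpace 𝒰] [MeasurableSpace 𝒳] [MeasurableSpace 𝒵]
  [MeasurableSpace 𝒲] [MeasurableSpace 𝒜] [Fintype 𝒜] (M : Model 𝒰 𝒳 𝒵 𝒲 𝒜)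
  {Pol : Set (Policy 𝒳 𝒲 𝒜)} {H : Set (Bridge 𝒳 𝒵 𝒲 𝒜)}
  {Θ : Fin 4 → Set (Trial 𝒰 𝒳 𝒵 𝒲 𝒜 → ℝ)} {LY Lh Lα Lθ : ℝ}

section Classes

lemma Model.Realizable.nonempty {gExact : Policy 𝒳 𝒲 𝒜 → 𝒳 → ℝ} {εH : ℝ}
    (hH : M.Realizable Pol H gExact εH) {π : Policy 𝒳 𝒲 𝒜} (hπ : π ∈ Pol) : H.Nonempty := by
  obtain ⟨h, hh, -⟩ := hH π hπ
  exact ⟨h, hh⟩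

/-- An empty test class would make the infimum in `Compatible` infinite, and a nonempty class
star-shaped around 0 contains 0. -/
lemma zero_mem_test {εΘ : ℝ} (hC : M.Compatible Pol H Θ εΘ) (hstar : ∀ k, StarConvex ℝ 0 (Θ k))
    {π : Policy 𝒳 𝒲 𝒜} (hπ : π ∈ Pol) (hH : H.Nonempty) (k : Fin 4) :
    (0 : Trial 𝒰 𝒳 𝒵 𝒲 𝒜 → ℝ) ∈ Θ k := by
  obtain ⟨h, hh⟩ := hH
  refine (hstar k).mem (Set.nonempty_iff_ne_empty.2 fun h0 => ?_)
  have h1 := hC π hπ h hh k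
  simp [h0] at h1

lemma measurable_of_mem_test (hR : M.Regular Pol H Θ LY Lh Lα Lθ) (k : Fin 4) :
    ∀ θ ∈ Θ k, Measurable θ := fun θ hθ => (hR.2.2.2 k θ hθ).1.mono (condSigma_le k) le_rfl

lemma abs_le_of_mem_classQ (hR : M.Regular Pol H Θ LY Lh Lα Lθ) (hLα : 0 ≤ Lα) (k : Fin 4) :
    ∀ f ∈ classQ Pol H Θ k, ∀ o, |rew o| ≤ LY → |f o| ≤ Lα * Lθ := by
  rintro _ ⟨π, hπ, h, hh, θ, hθ, rfl⟩ o ho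
  rw [abs_mul]
  exact mul_le_mul (hR.2.2.1 π hπ h hh k o ho) ((hR.2.2.2 k θ hθ).2 o) (abs_nonneg _) hLα

variable [MeasurableSingletonClass 𝒜]

lemma measurable_of_mem_classQ (hR : M.Regular Pol H Θ LY Lh Lα Lθ) (k : Fin 4) :
    ∀ f ∈ classQ Pol H Θ k, Measurable f := by
  rintro _ ⟨π, hπ, h, hh, θ, hθ, rfl⟩
  exact (measurable_alpha k π (hR.2.1 h hh).1).mul (measurable_of_mem_test M hR k θ hθ)

/-- If the critical radii are bounded at level `ξ`, the data is good up to probability `8 ξ`. -/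
lemma dataLaw_not_goodData_le (hR : M.Regular Pol H Θ LY Lh Lα Lθ)
    (hLα : 0 < Lα) (hLθ : 0 < Lθ) (h0 : ∀ k, (0 : Trial 𝒰 𝒳 𝒵 𝒲 𝒜 → ℝ) ∈ Θ k)
    (hstar : ∀ k, StarConvex ℝ 0 (Θ k)) {π : Policy 𝒳 𝒲 𝒜} (hπ : π ∈ Pol) (hH : H.Nonempty)
    (hsep : ∀ k, PointwiseSeparable (Θ k) ∧ PointwiseSeparable (classQ Pol H Θ k)) {T : ℕ}
    {κ q ξ : ℝ} {η : Fin 4 → ℝ} (hq : 0 < q) (hq1 : q ≤ 1 / 1400) (hqα : q ≤ Lα * Lθ / 300)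
    (hqθ : q ≤ Lθ / 300) (hκ : (1 + Lα * Lθ + Lθ) / q ≤ κ) (hξ : 0 < ξ) (hξ1 : ξ < 1)
    (hcrit : ∀ k, M.dataLaw T {D | ¬ CriticalBound Pol H Θ Lα Lθ κ 16 ξ k (η k) D} ≤
      ENNReal.ofReal ξ) :
    M.dataLaw T {D | ¬ GoodData M Pol H Θ η D} ≤ ENNReal.ofReal (8 * ξ) := by
  set Ω₀ : Set (Trial 𝒰 𝒳 𝒵 𝒲 𝒜) := {o | |rew o| ≤ LY} with hΩ
  have hΩm : MeasurableSet Ω₀ := measurableSet_le measurable_rew.norm measurable_const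
  have hΩp : M.pOb Ω₀ᶜ = 0 := ae_iff.1 (ae_abs_rew_le M hR.1)
  have hαθ : 0 < Lα * Lθ := mul_pos hLα hLθ
  have hκ1 : 1 / q ≤ κ := le_trans (by gcongr; linarith) hκ
  have hκα : Lα * Lθ / q ≤ κ := le_trans (by gcongr; linarith) hκ
  have hκθ : Lθ / q ≤ κ := le_trans (by gcongr; linarith) hκ
  have hκ0 : 0 ≤ κ := le_trans (by positivity) hκ1
  set A : Fin 4 → Set (Fin T → Trial 𝒰 𝒳 𝒵 𝒲 𝒜) :=
    fun k => {D | ¬ CriticalBound Pol H Θ Lα Lθ κ 16 ξ k (η k) D}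
  set B : Fin 4 → Set (Fin T → Trial 𝒰 𝒳 𝒵 𝒲 𝒜) := fun k =>
    {D | 0 < subSize D k ∧ (∃ δ, IsCriticalRadius D k (Θ k) Lθ δ ∧
        κ * (δ + √(Real.log (16 / ξ) / (subSize D k : ℝ))) ≤ η k) ∧
        ¬ UniformlyClose M D k (Θ k) (η k / 2)}
  set B' : Fin 4 → Set (Fin T → Trial 𝒰 𝒳 𝒵 𝒲 𝒜) := fun k =>
    {D | 0 < subSize D k ∧ (∃ δ, IsCriticalRadius D k (classQ Pol H Θ k) (Lα * Lθ) δ ∧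
        κ * (δ + √(Real.log (16 / ξ) / (subSize D k : ℝ))) ≤ η k) ∧
        ¬ UniformlyClose M D k (classQ Pol H Θ k) (η k / 2)}
  have hB : ∀ k, M.dataLaw T (B k) ≤ ENNReal.ofReal (ξ / 2) := fun k =>
    dataLaw_not_uniformlyClose_le M T k (hsep k).1 (measurable_of_mem_test M hR k) (h0 k)
      (hstar k) hΩm hΩp hLθ (fun θ hθ o _ => (hR.2.2.2 k θ hθ).2 o) hq hq1 hqθ hκ1 hκθ hξ hξ1
  have hB' : ∀ k, M.dataLaw T (B' k) ≤ ENNReal.ofReal (ξ / 2) := fun k =>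
    dataLaw_not_uniformlyClose_le M T k (hsep k).2 (measurable_of_mem_classQ M hR k)
      (zero_mem_classQ h0 hπ hH k) (starConvex_classQ hstar k) hΩm hΩp hαθ
      (abs_le_of_mem_classQ M hR hLα.le k) hq hq1 hqα hκ1 hκα hξ hξ1
  have hsub : {D | ¬ GoodData M Pol H Θ η D} ⊆ ⋃ k, (A k ∪ (B k ∪ B' k)) := by
    intro D hD
    by_contra hnot
    refine hD fun k => ?_
    have hk : D ∉ A k ∪ (B k ∪ B' k) := fun h => hnot (Set.mem_iUnion.2 ⟨k, h⟩)
    have hA : CriticalBound Pol H Θ Lα Lθ κ 16 ξ k (η k) D :=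
      not_not.1 fun h => hk (Or.inl h)
    obtain ⟨hs, δ, hQ, hT, hδ⟩ := hA
    refine ⟨le_trans ?_ hδ, ?_, ?_⟩
    · exact mul_nonneg hκ0 (add_nonneg hT.1.le (Real.sqrt_nonneg _))
    · exact not_not.1 fun h => hk (Or.inr (Or.inl ⟨hs, ⟨δ, hT, hδ⟩, h⟩))
    · exact not_not.1 fun h => hk (Or.inr (Or.inr ⟨hs, ⟨δ, hQ, hδ⟩, h⟩))
  calc M.dataLaw T {D | ¬ GoodData M Pol H Θ η D}
      ≤ M.dataLaw T (⋃ k, (A k ∪ (B k ∪ B' k))) := measure_mono hsub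
    _ ≤ ∑ k : Fin 4, M.dataLaw T (A k ∪ (B k ∪ B' k)) := measure_iUnion_fintype_le _ _
    -- Each equation costs ξ for the critical radii and ξ/2 for each of its two classes.
    _ ≤ ∑ _k : Fin 4, ENNReal.ofReal (2 * ξ) := by
        refine Finset.sum_le_sum fun k _ => ?_
        refine (measure_union_le _ _).trans ((add_le_add (hcrit k)
          ((measure_union_le _ _).trans (add_le_add (hB k) (hB' k)))).trans (le_of_eq ?_))
        rw [← ENNReal.ofReal_add (by positivity) (by positivity),
          ← ENNReal.ofReal_add (by positivity) (by positivity)]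
        congr 1
        ring
    _ = ENNReal.ofReal (8 * ξ) := by
        rw [← ENNReal.ofReal_sum_of_nonneg fun _ _ => by positivity]
        congr 1
        simp
        ring

end Classes

/-! ### The error of a candidate and the pessimism argument -/

section Pessimism

variable [MeasurableSingletonClass 𝒜] [StandardBorelSpace 𝒰] [StandardBorelSpace 𝒳] [StandardBorelSpace 𝒵]
  [StandardBorelSpace 𝒲] [Nonempty 𝒲] [Nonempty 𝒜]

/-- The error of a candidate is bounded by its conditional residuals. -/
lemma abs_integral_g_sub_value_le (hPV : M.PVIndependence) {b₁ : 𝒳 × 𝒜 × 𝒵 → ℝ}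
    (hb : M.IsShift b₁) (hO : M.Overlap) (hR : M.Regular Pol H Θ LY Lh Lα Lθ)
    {π : Policy 𝒳 𝒲 𝒜} (hπ : π ∈ Pol) {h : Bridge 𝒳 𝒵 𝒲 𝒜} (hh : h ∈ H)
    (hS : ∑ k, eLpNorm (M.shiftFun b₁ k) 2 (M.mu k) ≠ ∞) {c : ℝ} (hc : 0 ≤ c)
    (hT : ∀ k, eLpNorm (M.opT k π h) 2 (M.mu k) ≤ ENNReal.ofReal c) :
    |(∫ x, h.g x ∂M.pTilde) - M.value π| ≤
      (∑ k, eLpNorm (M.shiftFun b₁ k) 2 (M.mu k)).toReal * c := by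
  obtain ⟨hm, hbd⟩ := hR.2.1 h hh
  have hbm : ∀ k, Measurable[condSigma k] (M.shiftFun b₁ k) := measurable_shiftFun M hb.1
  have hbs : ∀ k, AEStronglyMeasurable (M.shiftFun b₁ k) (M.mu k) := fun k =>
    ((hbm k).mono (condSigma_le k) le_rfl).aestronglyMeasurable
  have hbi : ∀ k, Integrable (M.shiftFun b₁ k) (M.mu k) := fun k => by
    have h2 : MemLp (M.shiftFun b₁ k) 2 (M.mu k) :=
      ⟨hbs k, (ENNReal.sum_ne_top.1 hS k (Finset.mem_univ k)).lt_top⟩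
    exact h2.integrable (by norm_num)
  have hα := ae_mu_abs_alpha_le M hR hπ hh
  have key : ‖(∫ x, h.g x ∂M.pTilde) - M.value π‖ₑ ≤
      (∑ k, eLpNorm (M.shiftFun b₁ k) 2 (M.mu k)) * ENNReal.ofReal c := by
    rw [integral_g_sub_value M hPV hb hO hR.1 hm hbd π (hR.2.2.1 π hπ h hh), Finset.sum_mul]
    refine (enorm_sum_le _ _).trans (Finset.sum_le_sum fun k _ => ?_)
    rw [integral_mul_alpha_eq M (measurable_alpha k π hm) (hα k) (hbm k) (hbi k)]
    exact (enorm_integral_mul_le (hbs k) (memLp_opT M (hα k)).aestronglyMeasurable).trans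
      (mul_le_mul_right (hT k) _)
  rw [Real.enorm_eq_ofReal_abs, ← ENNReal.ofReal_toReal hS,
    ← ENNReal.ofReal_mul ENNReal.toReal_nonneg] at key
  exact (ENNReal.ofReal_le_ofReal_iff (mul_nonneg ENNReal.toReal_nonneg hc)).1 key

/-- On good data every pessimistic policy is nearly optimal. -/
theorem GoodData.subOpt_le {T : ℕ} {D : Fin T → Trial 𝒰 𝒳 𝒵 𝒲 𝒜} {η : Fin 4 → ℝ}
    (hD : GoodData M Pol H Θ η D) (hPV : M.PVIndependence) {b₁ : 𝒳 × 𝒜 × 𝒵 → ℝ}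
    (hb : M.IsShift b₁) (hO : M.Overlap) (hR : M.Regular Pol H Θ LY Lh Lα Lθ) (hLα : 0 < Lα)
    {gExact : Policy 𝒳 𝒲 𝒜 → 𝒳 → ℝ} {εH εΘ e : ℝ} (hεH : 0 ≤ εH)
    (hreal : M.Realizable Pol H gExact εH) (hεΘ : 0 ≤ εΘ) (hC : M.Compatible Pol H Θ εΘ)
    (hstar : ∀ k, StarConvex ℝ 0 (Θ k))
    (he : 2 * εH ^ 2 + (2 * Lα ^ 2 + 5 / 4) * (∑ k, η k ^ 2) < e)
    {πStar πHat : Policy 𝒳 𝒲 𝒜} (hπS : πStar ∈ Pol) (hπH : M.IsPessimistic Pol H Θ e D πHat) :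
    ENNReal.ofReal (M.subOpt πStar πHat) ≤ ENNReal.ofReal (9 + 2 * Lα) *
      (∑ k, eLpNorm (M.shiftFun b₁ k) 2 (M.mu k)) *
        ENNReal.ofReal (εΘ + εH + √e + √(∑ k, η k ^ 2)) := by
  have hη0 : 0 ≤ √(∑ k, η k ^ 2) := Real.sqrt_nonneg _
  have he0 : 0 < e := lt_of_le_of_lt (by positivity) he
  have hse : 0 < √e := Real.sqrt_pos.2 he0
  set S := ∑ k, eLpNorm (M.shiftFun b₁ k) 2 (M.mu k) with hSdef
  -- If some weight has infinite norm, the bound is infinite: e > 0 keeps the last factor from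
  -- vanishing, where ∞ · 0 would be 0.
  rcases eq_or_ne S ∞ with hS | hS
  · rw [hS, ENNReal.mul_top, ENNReal.top_mul]
    · exact le_top
    · exact (ENNReal.ofReal_pos.2 (by positivity)).ne'
    · exact (ENNReal.ofReal_pos.2 (by positivity)).ne'
  have hΘ0 := zero_mem_test M hC hstar hπS (Model.Realizable.nonempty M hreal hπS)
  set Δ := εΘ + √e + √(∑ k, η k ^ 2) with hΔ
  have hΔ0 : 0 ≤ Δ := by positivity
  -- The realizable candidate has empirical loss below `e`, and the infimum of the loss is
  -- nonnegative, so it belongs to the confidence set.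
  have hreal_mem : ∀ π ∈ Pol, ∃ h ∈ H, h.g ∈ confSet H Θ e D π ∧
      |(∫ x, h.g x ∂M.pTilde) - M.value π| ≤ S.toReal * εH := by
    intro π hπ
    obtain ⟨h, hh, hε, -⟩ := hreal π hπ
    refine ⟨h, hh, ⟨h, hh, rfl, ?_⟩, abs_integral_g_sub_value_le M hPV hb hO hR hπ hh hS hεH
      (eLpNorm_opT_le_of_rmse_le M (ae_mu_abs_alpha_le M hR hπ hh) hε)⟩
    have h1 := hD.empLoss_le M hR hLα.le hΘ0 hπ hh hε
    have h2 : 0 ≤ ⨅ h' : H, empLoss Θ D π h'.1 :=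
      Real.iInf_nonneg fun h' => hD.empLoss_nonneg M hR hLα.le hΘ0 hπ h'.2
    linarith
  -- The infimum of the loss is itself below `e`, so every member of the confidence set has loss at
  -- most 2e.
  have hconf : ∀ π ∈ Pol, ∀ g ∈ confSet H Θ e D π,
      |(∫ x, g x ∂M.pTilde) - M.value π| ≤ S.toReal * ((8 + 2 * Lα) * Δ) := by
    rintro π hπ _ ⟨h, hh, rfl, hloss⟩
    obtain ⟨h', hh', hε, -⟩ := hreal π hπ
    have h1 := hD.empLoss_le M hR hLα.le hΘ0 hπ hh' hε
    have h2 : (⨅ h' : H, empLoss Θ D π h'.1) ≤ empLoss Θ D π h' :=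
      ciInf_le ⟨0, by rintro _ ⟨h'', rfl⟩; exact hD.empLoss_nonneg M hR hLα.le hΘ0 hπ h''.2⟩
        (⟨h', hh'⟩ : H)
    exact abs_integral_g_sub_value_le M hPV hb hO hR hπ hh hS (by positivity)
      (hD.eLpNorm_opT_le M hR hLα.le hΘ0 hstar hεΘ hC hπ hh he0 (by linarith))
  obtain ⟨hπHm, hmax⟩ := hπH
  obtain ⟨hS', hhS', hSm, -⟩ := hreal_mem πStar hπS
  obtain ⟨hH', -, hHm, hHe⟩ := hreal_mem πHat hπHm
  -- All members are used for the optimal policy, but a single realizable one for the output policy;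
  -- the two pessimistic values are compared by maximality.
  have hlow : M.value πStar - S.toReal * ((8 + 2 * Lα) * Δ) ≤ M.pessValue H Θ e D πStar := by
    refine le_csInf ⟨_, hS'.g, hSm, rfl⟩ ?_
    rintro _ ⟨g, hg, rfl⟩
    have h1 := abs_le.1 (hconf πStar hπS g hg)
    simp only []
    linarith [h1.1]
  have hup : M.pessValue H Θ e D πHat ≤ M.value πHat + S.toReal * εH := by
    have hbdd : BddBelow ((fun g => ∫ x, g x ∂M.pTilde) '' confSet H Θ e D πHat) := by
      refine ⟨M.value πHat - S.toReal * ((8 + 2 * Lα) * Δ), ?_⟩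
      rintro _ ⟨g, hg, rfl⟩
      have h1 := abs_le.1 (hconf πHat hπHm g hg)
      simp only []
      linarith [h1.1]
    refine (csInf_le hbdd ⟨_, hHm, rfl⟩).trans ?_
    have h1 := abs_le.1 hHe
    simp only []
    linarith [h1.2]
  have hfin : M.subOpt πStar πHat ≤
      (9 + 2 * Lα) * S.toReal * (εΘ + εH + √e + √(∑ k, η k ^ 2)) := by
    have h1 := hmax πStar hπS
    have hs0 : 0 ≤ S.toReal := ENNReal.toReal_nonneg
    have h2 : S.toReal * ((8 + 2 * Lα) * Δ) + S.toReal * εH ≤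
        (9 + 2 * Lα) * S.toReal * (Δ + εH) := by
      nlinarith [mul_nonneg hs0 hΔ0, mul_nonneg hs0 hεH,
        mul_nonneg (mul_nonneg hs0 hεH) hLα.le]
    have h3 : εΘ + εH + √e + √(∑ k, η k ^ 2) = Δ + εH := by rw [hΔ]; ring
    rw [h3, Model.subOpt]
    linarith
  refine (ENNReal.ofReal_le_ofReal hfin).trans (le_of_eq ?_)
  rw [ENNReal.ofReal_mul (by positivity), ENNReal.ofReal_mul (by positivity),
    ENNReal.ofReal_toReal hS]

end Pessimism

end CCB

/-! ### Choice of the constants -/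

theorem mainTheorem6 :
    ∀ Lα : ℝ, 0 < Lα → ∃ C : ℝ, 0 < C ∧ ∀ Lθ : ℝ, 0 < Lθ → ∃ κ c₁ : ℝ, 0 < κ ∧ 1 ≤ c₁ ∧
      ∀ (𝒰 𝒳 𝒵 𝒲 𝒜 : Type*)
        [MeasurableSpace 𝒰] [StandardBorelSpace 𝒰] [MeasurableSpace 𝒳] [StandardBorelSpace 𝒳]
        [MeasurableSpace 𝒵] [StandardBorelSpace 𝒵]
        [MeasurableSpace 𝒲] [StandardBorelSpace 𝒲] [Nonempty 𝒲]
        [MeasurableSpace 𝒜] [Fintype 𝒜] [MeasurableSingletonClass 𝒜] [Nonempty 𝒜]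
        (M : CCB.Model 𝒰 𝒳 𝒵 𝒲 𝒜) (Pol : Set (CCB.Policy 𝒳 𝒲 𝒜))
        (H : Set (CCB.Bridge 𝒳 𝒵 𝒲 𝒜)) (Θ : Fin 4 → Set (CCB.Trial 𝒰 𝒳 𝒵 𝒲 𝒜 → ℝ))
        (hStar : CCB.Policy 𝒳 𝒲 𝒜 → CCB.Bridge 𝒳 𝒵 𝒲 𝒜) (πStar : CCB.Policy 𝒳 𝒲 𝒜)
        (LY Lh εH εΘ e ξ : ℝ) (η : Fin 4 → ℝ) (b₁ : 𝒳 × 𝒜 × 𝒵 → ℝ) (T : ℕ),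
        M.PVCompleteness → M.PVIndependence →
        (∀ π ∈ Pol, M.IsSolution π (hStar π)) →
        0 ≤ εH → M.Realizable Pol H (fun π => (hStar π).g) εH →
        0 ≤ εΘ → M.Compatible Pol H Θ εΘ →
        M.Regular Pol H Θ LY Lh Lα Lθ →
        (∀ k, StarConvex ℝ 0 (Θ k)) →
        (∀ k, CCB.PointwiseSeparable (Θ k) ∧ CCB.PointwiseSeparable (CCB.classQ Pol H Θ k)) →
        M.IsOptimal Pol πStar →
        M.IsShift b₁ → M.Overlap →
        0 < ξ → ξ < 1 →
        (∀ k, M.dataLaw T {D | ¬ CCB.CriticalBound Pol H Θ Lα Lθ κ c₁ ξ k (η k) D}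
          ≤ ENNReal.ofReal ξ) →
        2 * εH ^ 2 + (2 * Lα ^ 2 + 5 / 4) * (∑ k, η k ^ 2) < e →
        M.dataLaw T {D | ¬ ∀ πHat, M.IsPessimistic Pol H Θ e D πHat →
            ENNReal.ofReal (M.subOpt πStar πHat) ≤
              ENNReal.ofReal C * (∑ k, eLpNorm (M.shiftFun b₁ k) 2 (M.mu k)) *
                ENNReal.ofReal (εΘ + εH + √e + √(∑ k, η k ^ 2))}
          ≤ ENNReal.ofReal (8 * ξ) := by
  intro Lα hLα
  -- Members of the confidence set contribute the coefficient 8 + 2Lα, the realizable candidate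
  -- contributes 1 on εH; 9 + 2Lα covers both.
  refine ⟨9 + 2 * Lα, by positivity, fun Lθ hLθ => ?_⟩
  have hαθ : 0 < Lα * Lθ := mul_pos hLα hLθ
  -- 1/1400 serves the square norms, c/300 the means, with c = LαLθ and c = Lθ for the two classes.
  -- κ then dominates 1/q and c/q for both, and 16 is the constant in log(16/ξ).
  set q : ℝ := min (1 / 1400) (min (Lα * Lθ / 300) (Lθ / 300)) with hq
  have hq0 : 0 < q := by positivity
  refine ⟨(1 + Lα * Lθ + Lθ) / q, 16, by positivity, by norm_num, ?_⟩
  intro 𝒰 𝒳 𝒵 𝒲 𝒜 _ _ _ _ _ _ _ _ _ _ _ _ _ M Pol H Θ hStar πStar LY Lh εH εΘ e ξ η b₁ T _ hPV _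
    hεH hreal hεΘ hC hR hstar hsep hopt hb hO hξ hξ1 hcrit he
  have hne := CCB.Model.Realizable.nonempty M hreal hopt.1
  refine (MeasureTheory.measure_mono ?_).trans (CCB.dataLaw_not_goodData_le M hR hLα hLθ
    (CCB.zero_mem_test M hC hstar hopt.1 hne) hstar hopt.1 hne hsep hq0 (min_le_left _ _)
    ((min_le_right _ _).trans (min_le_left _ _)) ((min_le_right _ _).trans (min_le_right _ _))
    le_rfl hξ hξ1 hcrit)
  intro D hD hgood
  exact hD fun πHat hπ =>
    hgood.subOpt_le M hPV hb hO hR hLα hεH hreal hεΘ hC hstar he hopt.1 hπ
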